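/- Let $(\Sigma,g)$ be a compact connected smooth Riemannian surface without boundary, with sectional (Gauss) curvature $K_\Sigma$ and Laplace–Beltrami operator $\Delta$ (the trace of the Hessian). Suppose that there is a smooth function $u>0$ on $\Sigma$ such that $$\frac{\Delta u}{u}\le \Big(K_\Sigma-\frac12\Big)+\frac12\,\frac{|\nabla u|^2}{u^2}\qquad\text{on }\Sigma. \tag{1}$$ Then the diameter of $\Sigma$ with respect to the Riemannian distance satisfies $\mathrm{Diam}(\Sigma)<2\pi$. This upper bound is sharp in the following sense: there are a sequence of smooth Riemannian metrics $g_k$ on the sphere $S^2$ and smooth functions $u_k>0$ on $S^2$ such that, for every $k$, the function $u_k$ satisfies (1) on $\Sigma_k=(S^2,g_k)$, and $\lim_{k\to\infty}\mathrm{Diam}(\Sigma_k)=2\pi$. -/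

import Mathlib

open Set Filter Topology Manifold Bundle
open scoped ContDiff ENNReal

/-- The Euclidean plane, the model space of surfaces. -/
abbrev Plane : Type := EuclideanSpace ℝ (Fin 2)

/-- The unit sphere of `ℝ³`. -/
abbrev UnitSphere : Type := Metric.sphere (0 : EuclideanSpace ℝ (Fin 3)) 1

/-- The dimension count through which Mathlib equips `UnitSphere` with its standard structure of a
smooth surface (stereographic charts). -/
instance finrank_space_fact : Fact (Module.finrank ℝ (EuclideanSpace ℝ (Fin 3)) = 2 + 1) :=
  ⟨by simp⟩

noncomputable section

/-! ### Riemannian geometry of a metric on an open subset of the plane, given by its coefficients -/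

namespace LocalGeom

/-- The partial derivative `∂ᵢ f` of a function on the plane. -/
def pd (i : Fin 2) (f : Plane → ℝ) (y : Plane) : ℝ :=
  fderiv ℝ f y (EuclideanSpace.single i 1)

/-- The Christoffel symbols
`Γᵏᵢⱼ = (1/2) ∑ₗ gᵏˡ (∂ᵢ gⱼₗ + ∂ⱼ gᵢₗ - ∂ₗ gᵢⱼ)` of the metric with coefficients `G = (gᵢⱼ)`. -/
def christoffel (G : Plane → Matrix (Fin 2) (Fin 2) ℝ) (k i j : Fin 2) (y : Plane) : ℝ :=
  (1 / 2) * ∑ l, (G y)⁻¹ k l *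
    (pd i (fun z => G z j l) y + pd j (fun z => G z i l) y - pd l (fun z => G z i j) y)

/-- The components `Rˡᵢⱼₖ` of the curvature tensor, `R(∂ᵢ, ∂ⱼ)∂ₖ = ∑ₗ Rˡᵢⱼₖ ∂ₗ`, where
`R(X, Y)Z = ∇_X ∇_Y Z - ∇_Y ∇_X Z - ∇_[X,Y] Z` for the Levi-Civita connection `∇`. -/
def riemann (G : Plane → Matrix (Fin 2) (Fin 2) ℝ) (l i j k : Fin 2) (y : Plane) : ℝ :=
  pd i (christoffel G l j k) y - pd j (christoffel G l i k) y
    + ∑ m, (christoffel G l i m y * christoffel G m j k y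
      - christoffel G l j m y * christoffel G m i k y)

/-- The sectional (Gauss) curvature `g(R(∂₁, ∂₂)∂₂, ∂₁) / (g₁₁ g₂₂ - g₁₂²)`. -/
def curvature (G : Plane → Matrix (Fin 2) (Fin 2) ℝ) (y : Plane) : ℝ :=
  (∑ l, G y 0 l * riemann G l 0 1 1 y) / (G y).det

/-- The Laplace-Beltrami operator, the trace of the Hessian:
`Δf = ∑ᵢⱼ gⁱʲ (∂ᵢ∂ⱼ f - ∑ₖ Γᵏᵢⱼ ∂ₖ f)`. -/
def laplacian (G : Plane → Matrix (Fin 2) (Fin 2) ℝ) (f : Plane → ℝ) (y : Plane) : ℝ :=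
  ∑ i, ∑ j, (G y)⁻¹ i j * (pd i (pd j f) y - ∑ k, christoffel G k i j y * pd k f y)

/-- The squared length of the gradient, `|∇f|² = ∑ᵢⱼ gⁱʲ ∂ᵢf ∂ⱼf`. -/
def gradSq (G : Plane → Matrix (Fin 2) (Fin 2) ℝ) (f : Plane → ℝ) (y : Plane) : ℝ :=
  ∑ i, ∑ j, (G y)⁻¹ i j * pd i f y * pd j f y

end LocalGeom

/-! ### Riemannian surfaces -/

section Surface

variable (M : Type*) [TopologicalSpace M] [ChartedSpace Plane M] [IsManifold (𝓡 2) ∞ M]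

/-- Smooth Riemannian metrics on the smooth surface (without boundary) `M`. -/
abbrev SurfaceMetric : Type _ :=
  ContMDiffRiemannianMetric (𝓡 2) ∞ Plane (fun x : M => TangentSpace (𝓡 2) x)

variable {M}

namespace SurfaceMetric

/-- The coefficients `gᵢⱼ = g(∂ᵢ, ∂ⱼ)` of `g` in the chart around `x`, as functions on the image of
the chart; `∂ᵢ` is the image of the `i`-th basis vector under the derivative of the inverse
chart. -/
def coeff (g : SurfaceMetric M) (x : M) (y : Plane) : Matrix (Fin 2) (Fin 2) ℝ :=
  Matrix.of fun i j =>
    g.inner ((extChartAt (𝓡 2) x).symm y)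
      (mfderiv 𝓘(ℝ, Plane) (𝓡 2) (extChartAt (𝓡 2) x).symm y (EuclideanSpace.single i (1 : ℝ)))
      (mfderiv 𝓘(ℝ, Plane) (𝓡 2) (extChartAt (𝓡 2) x).symm y (EuclideanSpace.single j (1 : ℝ)))

/-- The sectional curvature `K` of `(M, g)` at `x`, computed in the chart around `x`. -/
def curvature (g : SurfaceMetric M) (x : M) : ℝ :=
  LocalGeom.curvature (g.coeff x) (extChartAt (𝓡 2) x x)

/-- The Laplace-Beltrami operator of `(M, g)`, computed at `x` in the chart around `x`. -/
def laplacian (g : SurfaceMetric M) (u : M → ℝ) (x : M) : ℝ :=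
  LocalGeom.laplacian (g.coeff x) (u ∘ (extChartAt (𝓡 2) x).symm) (extChartAt (𝓡 2) x x)

/-- The squared length `|∇u|²` of the gradient of `u`, computed at `x` in the chart around `x`. -/
def gradSq (g : SurfaceMetric M) (u : M → ℝ) (x : M) : ℝ :=
  LocalGeom.gradSq (g.coeff x) (u ∘ (extChartAt (𝓡 2) x).symm) (extChartAt (𝓡 2) x x)

/-- The Riemannian distance: the infimum of the `g`-lengths of the `C¹` paths from `x` to `y`. -/
def dist (g : SurfaceMetric M) (x y : M) : ℝ≥0∞ :=
  letI : RiemannianBundle (fun x : M => TangentSpace (𝓡 2) x) := ⟨g.toRiemannianMetric⟩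
  riemannianEDist (𝓡 2) x y

/-- The diameter `sup {d(x, y) | x, y ∈ M}` for the Riemannian distance `d`. -/
def diam (g : SurfaceMetric M) : ℝ≥0∞ := ⨆ (x : M) (y : M), g.dist x y

/-- `u` is a smooth positive function with
`Δu / u ≤ (K - 1/2) + (1/2) |∇u|² / u²` everywhere on `(M, g)`. -/
structure IsPosSupersolution (g : SurfaceMetric M) (u : M → ℝ) : Prop where
  smooth : ContMDiff (𝓡 2) 𝓘(ℝ, ℝ) ∞ u
  pos : ∀ x, 0 < u x
  ineq : ∀ x, g.laplacian u x / u x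
    ≤ (g.curvature x - 1 / 2) + (1 / 2) * (g.gradSq u x / u x ^ 2)

end SurfaceMetric

end Surface

end

/-! The upper bound comes from the conformal metric `ĝ = u² g`. Put `w = log u`. Since `Δw = Δu/u -
|∇u|²/u²`, inequality (1) says `K - Δw ≥ 1/2 + |∇w|²/2`, and the formula `K̂ = u⁻² (K - Δw)`
(`curvature_conf`) turns this into `K̂ ≥ e^(-2w)/2 + |∇w|²/2`, the last norm now being that of `ĝ`.

By compactness two points `p`, `q` realize the diameter of `g`. Join them by a curve `γ` that
minimizes length for `ĝ`, parametrized by `ĝ`-arc length on `[0, ℓ]`. Its `g`-length is `L = ∫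
e^(-w)`, so the diameter is at most `L` (`rdist_le_integral`). Minimality makes the index form `∫
(ψ'² - κ ψ²)` non-negative for every `κ ≤ K̂` along `γ` and every `ψ` vanishing at the ends
(`index_form_nonneg`); here `κ = e^(-2w)/2 + w'²/2`. Test with `ψ = e^(w/2) sin(π S / L)`, where `S`
is the `g`-arc length. Completing a square, one sees that for `L ≥ 2π` the integrand is at most the
derivative of `(π/L) sin(2π S / L)`, strictly somewhere, and this derivative integrates to zero
(`exists_index_form_neg`). Hence the diameter, being attained, is strictly below `2π`.

The distance is only an infimum of lengths of paths, and the index form is reached without an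
exponential map. Minimizing curves exist by Tychonoff's theorem applied to finite chains of points
(`exists_isMinimizing`). In a chart they are Lipschitz, and vanishing of the first variation of
energy with the lemma of du Bois-Reymond makes them smooth enough to satisfy the geodesic equation
(`exists_isGeodesicOn`). The second variation is computed in one chart at a time
(`second_variation_le`), moving points along the parabolas `parab`, which are geodesics up to second
order. Such germs agree in all charts up to `o(τ²)` (`eventually_rdist_parab_le`), so the local
estimates can be added by the triangle inequality along the whole curve.

Sharpness comes from thin capped cylinders. On a flat cylinder with axial coordinate `s`, the
function `u = cos²(s/2)` gives equality in (1) for `|s| < π`. The metrics `ε²/(a² - z²) g₀` on the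
unit sphere, with `a > 1` close to `1` and `ε` small, are smooth approximations of it. With `s`
replaced by `profile a ε z`, a function of gradient at most `1` reaching `±B` at the poles, (1)
still holds, and the diameter is at least `2B` for any prescribed `B < π` (`exists_le_diam_sphere`).
-/

noncomputable section

set_option synthInstance.maxHeartbeats 200000

/-! ### Normed structures on bilinear maps of the plane -/

section Instances

variable {F : Type*} [NormedAddCommGroup F] [NormedSpace ℝ F]

set_option synthInstance.maxHeartbeats 400000 in
instance planeBilinNormedAddCommGroup : NormedAddCommGroup (Plane →L[ℝ] Plane →L[ℝ] F) :=
  ContinuousLinearMap.toNormedAddCommGroup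

set_option synthInstance.maxHeartbeats 400000 in
instance planeBilinNormedSpace : NormedSpace ℝ (Plane →L[ℝ] Plane →L[ℝ] F) :=
  ContinuousLinearMap.toNormedSpace

instance planeBilinSeminormedAddCommGroup : SeminormedAddCommGroup (Plane →L[ℝ] Plane →L[ℝ] F) :=
  planeBilinNormedAddCommGroup.toSeminormedAddCommGroup

instance planeBilinPseudoMetricSpace : PseudoMetricSpace (Plane →L[ℝ] Plane →L[ℝ] F) :=
  planeBilinSeminormedAddCommGroup.toPseudoMetricSpace

instance planeBilinAddCommGroup : AddCommGroup (Plane →L[ℝ] Plane →L[ℝ] F) :=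
  planeBilinNormedAddCommGroup.toAddCommGroup

instance planeBilinAddGroup : AddGroup (Plane →L[ℝ] Plane →L[ℝ] F) :=
  planeBilinAddCommGroup.toAddGroup

instance planeBilinAddCommMonoid : AddCommMonoid (Plane →L[ℝ] Plane →L[ℝ] F) :=
  planeBilinAddCommGroup.toAddCommMonoid

instance planeBilinModule : Module ℝ (Plane →L[ℝ] Plane →L[ℝ] F) :=
  planeBilinNormedSpace.toModule

set_option synthInstance.maxHeartbeats 400000 in
instance planeBilinIsBoundedSMul : IsBoundedSMul ℝ (Plane →L[ℝ] Plane →L[ℝ] F) :=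
  NormedSpace.toIsBoundedSMul

end Instances

/-! ### Metrics in coordinates and their Levi-Civita connection -/

namespace LocalGeom

/-- The `i`-th standard basis vector of the plane. -/
def bv (i : Fin 2) : Plane := EuclideanSpace.single i 1

/-- The `i`-th coordinate functional on the plane. -/
def cf (i : Fin 2) : Plane →L[ℝ] ℝ := EuclideanSpace.proj i

@[simp] lemma cf_apply (i : Fin 2) (v : Plane) : cf i v = v i := rfl

lemma bv_apply (i j : Fin 2) : bv i j = if j = i then 1 else 0 := by
  simp [bv]

@[simp] lemma bv_same (i : Fin 2) : bv i i = 1 := by simp [bv_apply]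
@[simp] lemma bv_zero_one : bv 0 1 = 0 := by simp [bv_apply]
@[simp] lemma bv_one_zero : bv 1 0 = 0 := by simp [bv_apply]

lemma eq_sum_bv (v : Plane) : v = v 0 • bv 0 + v 1 • bv 1 := by
  ext i; fin_cases i <;> simp

/-- The bilinear form with matrix `G y`. -/
def bil (G : Plane → Matrix (Fin 2) (Fin 2) ℝ) (y : Plane) : Plane →L[ℝ] Plane →L[ℝ] ℝ :=
  ∑ i, ∑ j, G y i j • (cf i).smulRight (cf j)

/-- The Christoffel symbols as a bilinear map. -/
def conn (G : Plane → Matrix (Fin 2) (Fin 2) ℝ) (y : Plane) : Plane →L[ℝ] Plane →L[ℝ] Plane :=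
  ∑ k, ∑ i, ∑ j, christoffel G k i j y • (cf i).smulRight ((cf j).smulRight (bv k))

/-- The curvature tensor `R(a, b) c` of a connection form `Γ`. -/
def curv (Γ : Plane → Plane →L[ℝ] Plane →L[ℝ] Plane) (y a b c : Plane) : Plane :=
  fderiv ℝ Γ y a b c - fderiv ℝ Γ y b a c + Γ y a (Γ y b c) - Γ y b (Γ y a c)

variable {G : Plane → Matrix (Fin 2) (Fin 2) ℝ} {U : Set Plane} {y : Plane}

lemma bil_apply (a b : Plane) :
    bil G y a b = G y 0 0 * (a 0 * b 0) + G y 0 1 * (a 0 * b 1) + G y 1 0 * (a 1 * b 0)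
      + G y 1 1 * (a 1 * b 1) := by
  simp [bil, Fin.sum_univ_two]; ring

lemma bil_bv (i j : Fin 2) : bil G y (bv i) (bv j) = G y i j := by
  fin_cases i <;> fin_cases j <;> simp [bil_apply]

lemma conn_apply (a b : Plane) (k : Fin 2) :
    conn G y a b k = christoffel G k 0 0 y * (a 0 * b 0) + christoffel G k 0 1 y * (a 0 * b 1)
      + christoffel G k 1 0 y * (a 1 * b 0) + christoffel G k 1 1 y * (a 1 * b 1) := by
  fin_cases k <;> simp [conn, Fin.sum_univ_two] <;> ring

/-- `G` is a smooth Riemannian metric on the open set `U`. -/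
structure IsMetricOn (G : Plane → Matrix (Fin 2) (Fin 2) ℝ) (U : Set Plane) : Prop where
  isOpen : IsOpen U
  smooth : ∀ i j, ContDiffOn ℝ ∞ (fun y => G y i j) U
  symm : ∀ y ∈ U, G y 0 1 = G y 1 0
  pos : ∀ y ∈ U, ∀ v : Plane, v ≠ 0 → 0 < bil G y v v

lemma fderiv_apply_pd {f : Plane → ℝ} (a : Plane) :
    fderiv ℝ f y a = a 0 * pd 0 f y + a 1 * pd 1 f y := by
  conv_lhs => rw [eq_sum_bv a]
  simp [pd, bv]

namespace IsMetricOn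

variable (hG : IsMetricOn G U)
include hG

lemma bil_symm (hy : y ∈ U) (a b : Plane) : bil G y a b = bil G y b a := by
  simp only [bil_apply, hG.symm y hy]; ring

lemma bil_nonneg (hy : y ∈ U) (a : Plane) : 0 ≤ bil G y a a := by
  by_cases h : a = 0
  · simp [h]
  · exact (hG.pos y hy a h).le

lemma G_pos (hy : y ∈ U) : 0 < G y 0 0 := by
  have := hG.pos y hy (bv 0) (fun h => by simpa using congrArg (fun v : Plane => v 0) h)
  rwa [bil_bv] at this

lemma det_pos (hy : y ∈ U) : 0 < (G y).det := by
  have h0 := hG.G_pos hy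
  have := hG.pos y hy (-G y 0 1 • bv 0 + G y 0 0 • bv 1)
    (fun h => by have := congrArg (fun v : Plane => v 1) h; simp at this; linarith)
  rw [bil_apply] at this
  simp at this
  rw [Matrix.det_fin_two]
  have hs := hG.symm y hy
  rw [← hs] at this ⊢
  have h2 : 0 < G y 0 0 * (G y 0 0 * G y 1 1 - G y 0 1 * G y 0 1) := by nlinarith
  exact pos_of_mul_pos_right h2 h0.le

lemma eq_of_bil_eq (hy : y ∈ U) {a b : Plane} (h : ∀ c, bil G y a c = bil G y b c) : a = b := by
  by_contra hne
  have := hG.pos y hy (a - b) (sub_ne_zero.2 hne)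
  have e : bil G y (a - b) (a - b) = 0 := by
    have := h (a - b)
    simp only [map_sub, sub_apply] at this ⊢
    linarith
  linarith

lemma contDiffOn_bil : ContDiffOn ℝ ∞ (bil G) U := by
  unfold bil
  refine ContDiffOn.sum fun i _ => ContDiffOn.sum fun j _ => ?_
  exact (hG.smooth i j).smul contDiffOn_const

lemma contDiffOn_det : ContDiffOn ℝ ∞ (fun y => (G y).det) U := by
  simp only [Matrix.det_fin_two]
  exact ((hG.smooth 0 0).mul (hG.smooth 1 1)).sub ((hG.smooth 0 1).mul (hG.smooth 1 0))

lemma contDiffOn_inv (i j : Fin 2) : ContDiffOn ℝ ∞ (fun y => (G y)⁻¹ i j) U := by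
  have hd : ContDiffOn ℝ ∞ (fun y => (G y).det⁻¹) U :=
    hG.contDiffOn_det.inv fun y hy => (hG.det_pos hy).ne'
  have : ∀ y, (G y)⁻¹ i j = (G y).det⁻¹ * (G y).adjugate i j := fun y => by
    rw [Matrix.inv_def, Ring.inverse_eq_inv', Matrix.smul_apply, smul_eq_mul]
  simp only [this, Matrix.adjugate_fin_two]
  refine hd.mul ?_
  have := hG.smooth 0 0
  have := hG.smooth 1 1
  have := (hG.smooth 0 1).neg
  have := (hG.smooth 1 0).neg
  fin_cases i <;> fin_cases j <;> simpa

lemma contDiffOn_pd {f : Plane → ℝ} (hf : ContDiffOn ℝ ∞ f U) (i : Fin 2) :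
    ContDiffOn ℝ ∞ (pd i f) U := by
  have : ContDiffOn ℝ ∞ (fderiv ℝ f) U := hf.fderiv_of_isOpen hG.isOpen (by simp)
  exact this.clm_apply contDiffOn_const

lemma contDiffOn_christoffel (k i j : Fin 2) : ContDiffOn ℝ ∞ (christoffel G k i j) U := by
  unfold christoffel
  refine contDiffOn_const.mul (ContDiffOn.sum fun l _ => (hG.contDiffOn_inv k l).mul ?_)
  exact ((hG.contDiffOn_pd (hG.smooth _ _) _).add (hG.contDiffOn_pd (hG.smooth _ _) _)).sub
    (hG.contDiffOn_pd (hG.smooth _ _) _)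

lemma contDiffOn_conn : ContDiffOn ℝ ∞ (conn G) U := by
  unfold conn
  refine ContDiffOn.sum fun k _ => ContDiffOn.sum fun i _ => ContDiffOn.sum fun j _ => ?_
  exact (hG.contDiffOn_christoffel k i j).smul contDiffOn_const

lemma pd_symm (hy : y ∈ U) (i : Fin 2) : pd i (fun y => G y 0 1) y = pd i (fun y => G y 1 0) y := by
  unfold pd
  rw [Filter.EventuallyEq.fderiv_eq]
  filter_upwards [hG.isOpen.mem_nhds hy] with z hz using hG.symm z hz

lemma conn_symm (hy : y ∈ U) (a b : Plane) : conn G y a b = conn G y b a := by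
  have : ∀ k, christoffel G k 0 1 y = christoffel G k 1 0 y := fun k => by
    simp only [christoffel, Fin.sum_univ_two, hG.pd_symm hy]; ring
  ext k
  simp only [conn_apply, this]; ring

/-- Contracting the definition with `G` cancels the inverse matrix. The resulting symbols of the
first kind are linear in the derivatives of the metric. -/
lemma christoffel_lower (hy : y ∈ U) (l i j : Fin 2) :
    G y l 0 * christoffel G 0 i j y + G y l 1 * christoffel G 1 i j y
      = (1 / 2) * (pd i (fun z => G z j l) y + pd j (fun z => G z i l) y
        - pd l (fun z => G z i j) y) := by
  have hinv : G y * (G y)⁻¹ = 1 := Matrix.mul_nonsing_inv _ (hG.det_pos hy).ne'.isUnit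
  have e : ∀ m, G y l 0 * (G y)⁻¹ 0 m + G y l 1 * (G y)⁻¹ 1 m = if l = m then 1 else 0 := by
    intro m
    have := congrFun (congrFun hinv l) m
    rwa [Matrix.mul_apply, Fin.sum_univ_two, Matrix.one_apply] at this
  simp only [christoffel, Fin.sum_univ_two]
  have e0 := e 0
  have e1 := e 1
  fin_cases l
  · simp at e0 e1 ⊢
    linear_combination (1 / 2) * (pd i (fun z => G z j 0) y + pd j (fun z => G z i 0) y
        - pd 0 (fun z => G z i j) y) * e0 + (1 / 2) * (pd i (fun z => G z j 1) y + pd j (fun z => G z i 1) y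
        - pd 1 (fun z => G z i j) y) * e1
  · simp at e0 e1 ⊢
    linear_combination (1 / 2) * (pd i (fun z => G z j 0) y + pd j (fun z => G z i 0) y
        - pd 0 (fun z => G z i j) y) * e0 + (1 / 2) * (pd i (fun z => G z j 1) y + pd j (fun z => G z i 1) y
        - pd 1 (fun z => G z i j) y) * e1

lemma differentiableAt (hy : y ∈ U) (i j : Fin 2) : DifferentiableAt ℝ (fun y => G y i j) y :=
  ((hG.smooth i j).contDiffAt (hG.isOpen.mem_nhds hy)).differentiableAt (by simp)

lemma fderiv_bil (hy : y ∈ U) (a b c : Plane) :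
    fderiv ℝ (bil G) y a b c = fderiv ℝ (fun y => G y 0 0) y a * (b 0 * c 0)
      + fderiv ℝ (fun y => G y 0 1) y a * (b 0 * c 1) + fderiv ℝ (fun y => G y 1 0) y a * (b 1 * c 0)
      + fderiv ℝ (fun y => G y 1 1) y a * (b 1 * c 1) := by
  have : HasFDerivAt (bil G) (∑ i, ∑ j, (fderiv ℝ (fun y => G y i j) y).smulRight
      ((cf i).smulRight (cf j))) y := by
    unfold bil
    refine HasFDerivAt.fun_sum fun i _ => HasFDerivAt.fun_sum fun j _ => ?_
    exact HasFDerivAt.smul_const (f := (cf i).smulRight (cf j))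
      (hG.differentiableAt hy i j).hasFDerivAt
  rw [this.fderiv]
  simp [Fin.sum_univ_two]; ring

/-- Metric compatibility: in the sum of two lowered Christoffel symbols all derivatives but one
cancel. Together with `conn_symm` this replaces computations with indices in what follows. -/
lemma compat (hy : y ∈ U) (a b c : Plane) :
    fderiv ℝ (bil G) y a b c = bil G y (conn G y a b) c + bil G y b (conn G y a c) := by
  rw [hG.fderiv_bil hy, hG.bil_symm hy (conn G y a b) c]
  simp only [bil_apply, conn_apply, fderiv_apply_pd]
  have e := fun l i j => hG.christoffel_lower hy l i j
  have s := hG.symm y hy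
  have p := hG.pd_symm hy
  have e1 := e 0 0 0; have e2 := e 0 0 1; have e3 := e 0 1 0; have e4 := e 0 1 1
  have e5 := e 1 0 0; have e6 := e 1 0 1; have e7 := e 1 1 0; have e8 := e 1 1 1
  simp only [p, s] at *
  -- Each lowered symbol enters twice, with the roles of `b` and `c` exchanged.
  linear_combination (-(c 0) * a 0 * b 0 - b 0 * a 0 * c 0) * e1 + (-(c 0) * a 0 * b 1 - b 0 * a 0 * c 1) * e2
    + (-(c 0) * a 1 * b 0 - b 0 * a 1 * c 0) * e3 + (-(c 0) * a 1 * b 1 - b 0 * a 1 * c 1) * e4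
    + (-(c 1) * a 0 * b 0 - b 1 * a 0 * c 0) * e5 + (-(c 1) * a 0 * b 1 - b 1 * a 0 * c 1) * e6
    + (-(c 1) * a 1 * b 0 - b 1 * a 1 * c 0) * e7 + (-(c 1) * a 1 * b 1 - b 1 * a 1 * c 1) * e8

end IsMetricOn

end LocalGeom

/-! ### Derivatives along curves, orthonormal frames and the curvature tensor -/

namespace LocalGeom

section Calculus

variable {F : Type*} [NormedAddCommGroup F] [NormedSpace ℝ F]

lemma hasDerivWithinAt_bilin {T : Plane → Plane →L[ℝ] Plane →L[ℝ] F} {σ β χ : ℝ → Plane}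
    {a b c : Plane} {t : ℝ} {s : Set ℝ} (hT : DifferentiableAt ℝ T (σ t))
    (hσ : HasDerivWithinAt σ a s t) (hβ : HasDerivWithinAt β b s t)
    (hχ : HasDerivWithinAt χ c s t) :
    HasDerivWithinAt (fun t => T (σ t) (β t) (χ t))
      (fderiv ℝ T (σ t) a (β t) (χ t) + T (σ t) b (χ t) + T (σ t) (β t) c) s t := by
  have h1 : HasDerivWithinAt (fun t => T (σ t)) (fderiv ℝ T (σ t) a) s t :=
    hT.hasFDerivAt.comp_hasDerivWithinAt t hσ
  have h2 := (h1.clm_apply hβ).clm_apply hχ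
  convert! h2 using 1

lemma hasDerivAt_bilin {T : Plane → Plane →L[ℝ] Plane →L[ℝ] F} {σ β χ : ℝ → Plane}
    {a b c : Plane} {t : ℝ} (hT : DifferentiableAt ℝ T (σ t))
    (hσ : HasDerivAt σ a t) (hβ : HasDerivAt β b t) (hχ : HasDerivAt χ c t) :
    HasDerivAt (fun t => T (σ t) (β t) (χ t))
      (fderiv ℝ T (σ t) a (β t) (χ t) + T (σ t) b (χ t) + T (σ t) (β t) c) t := by
  rw [← hasDerivWithinAt_univ] at *
  exact hasDerivWithinAt_bilin hT hσ hβ hχ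

lemma hasDerivAt_apply_const {E F : Type*} [NormedAddCommGroup E] [NormedSpace ℝ E]
    [NormedAddCommGroup F] [NormedSpace ℝ F] {T : ℝ → E →L[ℝ] F} {T' : E →L[ℝ] F} {t : ℝ}
    (h : HasDerivAt T T' t) (a : E) : HasDerivAt (fun t => T t a) (T' a) t := by
  simpa using h.clm_apply (hasDerivAt_const t a)

lemma hasDerivAt_line (y a : Plane) : HasDerivAt (fun t : ℝ => y + t • a) a 0 := by
  simpa using ((hasDerivAt_id (0 : ℝ)).smul_const a).const_add y

lemma hasDerivAt_comp_line {f : Plane → F} {y : Plane} (hf : DifferentiableAt ℝ f y) (d : Plane) :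
    HasDerivAt (fun t : ℝ => f (y + t • d)) (fderiv ℝ f y d) 0 := by
  have hf' : HasFDerivAt f (fderiv ℝ f y) (y + (0 : ℝ) • d) := by simpa using hf.hasFDerivAt
  exact hf'.comp_hasDerivAt (f := fun t : ℝ => y + t • d) 0 (hasDerivAt_line y d)

lemma eventually_line_mem {U : Set Plane} (hU : IsOpen U) {y : Plane} (hy : y ∈ U) (a : Plane) :
    ∀ᶠ t : ℝ in 𝓝 0, y + t • a ∈ U := by
  have : ContinuousAt (fun t : ℝ => y + t • a) 0 := (hasDerivAt_line y a).continuousAt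
  exact this.preimage_mem_nhds (by simpa using hU.mem_nhds hy)

end Calculus

variable {G : Plane → Matrix (Fin 2) (Fin 2) ℝ} {U : Set Plane} {y : Plane}

/-- The vector dual to a linear form. -/
def raise (G : Plane → Matrix (Fin 2) (Fin 2) ℝ) (y : Plane) (ξ : Plane →L[ℝ] ℝ) : Plane :=
  ∑ k, (∑ i, (G y)⁻¹ k i * ξ (bv i)) • bv k

/-- The rotation by a right angle. -/
def rot (G : Plane → Matrix (Fin 2) (Fin 2) ℝ) (y v : Plane) : Plane :=
  (Real.sqrt (G y).det)⁻¹ •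
    (-(G y 0 1 * v 0 + G y 1 1 * v 1) • bv 0 + (G y 0 0 * v 0 + G y 0 1 * v 1) • bv 1)

namespace IsMetricOn

variable (hG : IsMetricOn G U)
include hG

lemma differentiableAt_bil (hy : y ∈ U) : DifferentiableAt ℝ (bil G) y :=
  (hG.contDiffOn_bil.contDiffAt (hG.isOpen.mem_nhds hy)).differentiableAt (by simp)

lemma differentiableAt_conn (hy : y ∈ U) : DifferentiableAt ℝ (conn G) y :=
  (hG.contDiffOn_conn.contDiffAt (hG.isOpen.mem_nhds hy)).differentiableAt (by simp)

lemma differentiableAt_fderiv_bil (hy : y ∈ U) : DifferentiableAt ℝ (fderiv ℝ (bil G)) y :=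
  (((hG.contDiffOn_bil.contDiffAt (hG.isOpen.mem_nhds hy)).fderiv_right (m := ∞)
    (by simp))).differentiableAt (by simp)

lemma bil_raise (hy : y ∈ U) (ξ : Plane →L[ℝ] ℝ) (c : Plane) : bil G y (raise G y ξ) c = ξ c := by
  have hinv : (G y) * (G y)⁻¹ = 1 := Matrix.mul_nonsing_inv _ (hG.det_pos hy).ne'.isUnit
  have e : ∀ l m, G y l 0 * (G y)⁻¹ 0 m + G y l 1 * (G y)⁻¹ 1 m = if l = m then 1 else 0 := by
    intro l m
    have := congrFun (congrFun hinv l) m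
    rwa [Matrix.mul_apply, Fin.sum_univ_two, Matrix.one_apply] at this
  have e00 := e 0 0; have e01 := e 0 1; have e10 := e 1 0; have e11 := e 1 1
  have hc : ξ c = c 0 * ξ (bv 0) + c 1 * ξ (bv 1) := by
    conv_lhs => rw [eq_sum_bv c]
    simp
  rw [hc, hG.bil_symm hy]
  simp [bil_apply, raise, Fin.sum_univ_two] at *
  linear_combination c 0 * ξ (bv 0) * e00 + c 0 * ξ (bv 1) * e01 + c 1 * ξ (bv 0) * e10
    + c 1 * ξ (bv 1) * e11

lemma bil_rot_left (hy : y ∈ U) (v : Plane) : bil G y (rot G y v) v = 0 := by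
  simp [bil_apply, rot, ← hG.symm y hy]; ring

lemma bil_rot_rot (hy : y ∈ U) (v : Plane) : bil G y (rot G y v) (rot G y v) = bil G y v v := by
  have hd := hG.det_pos hy
  have h2 := Real.sq_sqrt hd.le
  have h0 : Real.sqrt (G y).det ≠ 0 := (Real.sqrt_pos.2 hd).ne'
  simp [bil_apply, rot, ← hG.symm y hy]
  field_simp
  rw [h2, Matrix.det_fin_two, ← hG.symm y hy]; ring

lemma exists_orthonormal (hy : y ∈ U) :
    ∃ a b, bil G y a a = 1 ∧ bil G y b b = 1 ∧ bil G y a b = 0 := by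
  have h0 := hG.G_pos hy
  have hv : bil G y ((Real.sqrt (G y 0 0))⁻¹ • bv 0) ((Real.sqrt (G y 0 0))⁻¹ • bv 0) = 1 := by
    simp only [map_smul, smul_apply, bil_bv, smul_eq_mul]
    rw [← mul_assoc, ← mul_inv, Real.mul_self_sqrt h0.le, inv_mul_cancel₀ h0.ne']
  refine ⟨_, rot G y ((Real.sqrt (G y 0 0))⁻¹ • bv 0), hv, ?_, ?_⟩
  · rw [hG.bil_rot_rot hy, hv]
  · rw [hG.bil_symm hy, hG.bil_rot_left hy]

/-- The Gram determinant. It yields the Cauchy-Schwarz inequality and the linear independence of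
orthonormal pairs. -/
lemma det_mul (hy : y ∈ U) (a b : Plane) :
    (G y).det * (a 0 * b 1 - a 1 * b 0) ^ 2
      = bil G y a a * bil G y b b - bil G y a b ^ 2 := by
  rw [Matrix.det_fin_two]
  simp only [bil_apply, ← hG.symm y hy]; ring

/-- If `P` has rows `a` and `b`, orthonormality reads `P G Pᵀ = 1`, whence `G⁻¹ = Pᵀ P`. Traces
taken with `G⁻¹` thus become sums over the frame. -/
lemma inv_eq (hy : y ∈ U) {a b : Plane} (haa : bil G y a a = 1) (hbb : bil G y b b = 1)
    (hab : bil G y a b = 0) (i j : Fin 2) : (G y)⁻¹ i j = a i * a j + b i * b j := by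
  have h1 : (!![a 0, a 1; b 0, b 1] * G y) * !![a 0, b 0; a 1, b 1] = 1 := by
    have hba := hG.bil_symm hy b a ▸ hab
    rw [bil_apply] at haa hbb hab hba
    ext i j
    fin_cases i <;> fin_cases j <;> simp [Matrix.mul_apply, Matrix.vecMul, dotProduct, Fin.sum_univ_two] <;> linarith
  have h2 := mul_eq_one_comm.1 h1
  have h3 : (G y)⁻¹ = !![a 0, b 0; a 1, b 1] * !![a 0, a 1; b 0, b 1] :=
    Matrix.inv_eq_left_inv (by rw [Matrix.mul_assoc]; exact h2)
  rw [h3]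
  fin_cases i <;> fin_cases j <;> simp [Matrix.mul_apply, Fin.sum_univ_two] 

lemma gradSq_eq (hy : y ∈ U) {a b : Plane} (haa : bil G y a a = 1) (hbb : bil G y b b = 1)
    (hab : bil G y a b = 0) (f : Plane → ℝ) :
    gradSq G f y = fderiv ℝ f y a ^ 2 + fderiv ℝ f y b ^ 2 := by
  simp only [gradSq, Fin.sum_univ_two, hG.inv_eq hy haa hbb hab, fderiv_apply_pd]; ring

/-- The vector `v` is completed by `rot` to an orthonormal frame, and one of the two squares is
dropped. -/
lemma sq_fderiv_le_gradSq (hy : y ∈ U) {v : Plane} (hv : bil G y v v = 1) (f : Plane → ℝ) :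
    fderiv ℝ f y v ^ 2 ≤ gradSq G f y := by
  rw [hG.gradSq_eq hy hv (b := rot G y v) (by rw [hG.bil_rot_rot hy, hv])
    (by rw [hG.bil_symm hy, hG.bil_rot_left hy])]
  nlinarith [sq_nonneg (fderiv ℝ f y (rot G y v))]

lemma isSymmSndFDerivAt_bil (hy : y ∈ U) : IsSymmSndFDerivAt ℝ (bil G) y :=
  (hG.contDiffOn_bil.contDiffAt (hG.isOpen.mem_nhds hy)).isSymmSndFDerivAt
    (by simp only [minSmoothness_of_isRCLikeNormedField]; exact WithTop.coe_le_coe.2 le_top)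

/-- Both sides of `compat` are differentiated along the line through `y` in the direction `d`. -/
lemma snd_fderiv_bil (hy : y ∈ U) (d a b c : Plane) :
    fderiv ℝ (fderiv ℝ (bil G)) y d a b c =
      (fderiv ℝ (bil G) y d (conn G y a b) c + bil G y (fderiv ℝ (conn G) y d a b) c)
      + (fderiv ℝ (bil G) y d b (conn G y a c) + bil G y b (fderiv ℝ (conn G) y d a c)) := by
  have hl := hasDerivAt_line y d
  have hc : ∀ e : Plane, HasDerivAt (fun _ : ℝ => e) 0 (0 : ℝ) := fun e => hasDerivAt_const _ e
  have y0 : y + (0 : ℝ) • d = y := by simp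
  have hconn : ∀ e f : Plane, HasDerivAt (fun t : ℝ => conn G (y + t • d) e f)
      (fderiv ℝ (conn G) y d e f) 0 := fun e f => by
    have := hasDerivAt_bilin (T := conn G) (t := 0) (by rw [y0]; exact hG.differentiableAt_conn hy)
      hl (hc e) (hc f)
    simpa using this
  have h1 := hasDerivAt_bilin (T := bil G) (t := 0) (by rw [y0]; exact hG.differentiableAt_bil hy)
    hl (hconn a b) (hc c)
  have h2 := hasDerivAt_bilin (T := bil G) (t := 0) (by rw [y0]; exact hG.differentiableAt_bil hy)
    hl (hc b) (hconn a c)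
  have h3 : HasDerivAt (fun t : ℝ => fderiv ℝ (bil G) (y + t • d) a b c)
      (fderiv ℝ (fderiv ℝ (bil G)) y d a b c) 0 := by
    exact hasDerivAt_apply_const (hasDerivAt_apply_const (hasDerivAt_apply_const
      (hasDerivAt_comp_line (hG.differentiableAt_fderiv_bil hy) d) a) b) c
  have h5 := h3.unique ((h1.add h2).congr_of_eventuallyEq (by
    filter_upwards [eventually_line_mem hG.isOpen hy d] with t ht using hG.compat ht a b c))
  simpa using h5

/-- The second derivatives of the metric commute. Writing both orders by `snd_fderiv_bil` and
`compat`, only the two curvature terms survive. -/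
lemma bil_curv_skew (hy : y ∈ U) (a b c d : Plane) :
    bil G y (curv (conn G) y a b c) d = -bil G y (curv (conn G) y a b d) c := by
  have h : fderiv ℝ (fderiv ℝ (bil G)) y a b = fderiv ℝ (fderiv ℝ (bil G)) y b a :=
    hG.isSymmSndFDerivAt_bil hy a b
  have h1 : fderiv ℝ (fderiv ℝ (bil G)) y a b c d = fderiv ℝ (fderiv ℝ (bil G)) y b a c d := by
    rw [h]
  rw [hG.snd_fderiv_bil hy, hG.snd_fderiv_bil hy] at h1
  simp only [hG.compat hy] at h1
  rw [hG.bil_symm hy (curv (conn G) y a b d) c]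
  simp only [curv, map_add, map_sub, add_apply, sub_apply]
  linarith

lemma riemann_eq (hy : y ∈ U) (l i j k : Fin 2) :
    riemann G l i j k y = curv (conn G) y (bv i) (bv j) (bv k) l := by
  have hd : ∀ i j k l, (fderiv ℝ (conn G) y (bv i) (bv j) (bv k)) l = pd i (christoffel G l j k) y := by
    intro i j k l
    have h1 : HasDerivAt (fun t : ℝ => conn G (y + t • bv i) (bv j) (bv k))
        (fderiv ℝ (conn G) y (bv i) (bv j) (bv k)) 0 := by
      have := hasDerivAt_bilin (T := conn G) (t := 0) (by simpa using hG.differentiableAt_conn hy)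
        (hasDerivAt_line y (bv i)) (hasDerivAt_const _ (bv j)) (hasDerivAt_const _ (bv k))
      simpa using this
    have h2 : HasDerivAt (fun t : ℝ => christoffel G l j k (y + t • bv i))
        (pd i (christoffel G l j k) y) 0 :=
      hasDerivAt_comp_line (((hG.contDiffOn_christoffel l j k).contDiffAt
        (hG.isOpen.mem_nhds hy)).differentiableAt (by simp)) _
    have h3 := (cf l).hasFDerivAt.comp_hasDerivAt (0 : ℝ) h1
    refine h3.unique (h2.congr_of_eventuallyEq (Eventually.of_forall fun t => ?_))
    fin_cases j <;> fin_cases k <;> simp [conn_apply]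
  have hdd := fun i j => hd i j k l
  simp only [riemann, curv, PiLp.add_apply, PiLp.sub_apply, hdd]
  simp only [Fin.sum_univ_two]
  fin_cases i <;> fin_cases j <;> fin_cases k <;> simp [conn_apply] <;> ring

/-- The curvature is skew in its first pair of arguments by construction and in its last pair by
`bil_curv_skew`. In dimension two it is therefore one number times the square of the area spanned by
`a` and `b`. -/
lemma bil_curv_eq (hy : y ∈ U) (a b : Plane) :
    bil G y (curv (conn G) y a b b) a
      = curvature G y * (bil G y a a * bil G y b b - bil G y a b ^ 2) := by
  have hK : curvature G y * (G y).det = bil G y (curv (conn G) y (bv 0) (bv 1) (bv 1)) (bv 0) := by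
    rw [curvature, div_mul_cancel₀ _ (hG.det_pos hy).ne', Fin.sum_univ_two, hG.riemann_eq hy,
      hG.riemann_eq hy, hG.bil_symm hy, bil_apply]
    simp
  rw [← hG.det_mul hy, ← mul_assoc, hK]
  have hlin : ∀ c, curv (conn G) y a b c = (a 0 * b 1 - a 1 * b 0) •
      curv (conn G) y (bv 0) (bv 1) c := by
    intro c
    have ha := eq_sum_bv a
    have hb := eq_sum_bv b
    simp only [curv]
    generalize a 0 = a0 at *; generalize a 1 = a1 at *
    generalize b 0 = b0 at *; generalize b 1 = b1 at *
    subst ha hb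
    simp only [map_add, map_smul, add_apply, smul_apply]
    module
  have hlin2 : ∀ c d : Plane, curv (conn G) y c d b = b 0 • curv (conn G) y c d (bv 0)
      + b 1 • curv (conn G) y c d (bv 1) := by
    intro c d
    conv_lhs => rw [eq_sum_bv b]
    simp only [curv, map_add, map_smul]
    module
  have s00 := hG.bil_curv_skew hy (bv 0) (bv 1) (bv 0) (bv 0)
  have s11 := hG.bil_curv_skew hy (bv 0) (bv 1) (bv 1) (bv 1)
  have s01 := hG.bil_curv_skew hy (bv 0) (bv 1) (bv 0) (bv 1)
  rw [hlin, hlin2]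
  have ea : ∀ v, bil G y v a = a 0 * bil G y v (bv 0) + a 1 * bil G y v (bv 1) := fun v => by
    conv_lhs => rw [eq_sum_bv a]
    simp only [map_add, map_smul, smul_eq_mul]
  simp only [map_add, map_smul, add_apply, smul_apply, ea, smul_eq_mul]
  linear_combination (a 0 * b 1 - a 1 * b 0) * (a 0 * b 0 / 2 * s00 + a 1 * b 1 / 2 * s11 + b 0 * a 1 * s01)

end IsMetricOn

end LocalGeom

/-! ### Local isometries preserve connection and curvature -/

namespace LocalGeom

section Isometry

variable {G₁ G₂ : Plane → Matrix (Fin 2) (Fin 2) ℝ} {U₁ U₂ : Set Plane} {Φ : Plane → Plane}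

/-- `Φ` is a smooth local isometry from the metric `G₁` on `U₁` to the metric `G₂` on `U₂`. -/
structure IsLocalIsometry (G₁ G₂ : Plane → Matrix (Fin 2) (Fin 2) ℝ) (U₁ U₂ : Set Plane)
    (Φ : Plane → Plane) : Prop where
  metric₁ : IsMetricOn G₁ U₁
  metric₂ : IsMetricOn G₂ U₂
  smooth : ContDiffOn ℝ ∞ Φ U₁
  mapsTo : MapsTo Φ U₁ U₂
  bil_eq : ∀ y ∈ U₁, ∀ a b, bil G₁ y a b = bil G₂ (Φ y) (fderiv ℝ Φ y a) (fderiv ℝ Φ y b)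

namespace IsLocalIsometry

variable (h : IsLocalIsometry G₁ G₂ U₁ U₂ Φ) {y : Plane}
include h

lemma contDiffAt (hy : y ∈ U₁) : ContDiffAt ℝ ∞ Φ y :=
  h.smooth.contDiffAt (h.metric₁.isOpen.mem_nhds hy)

lemma contDiffAt_fderiv (hy : y ∈ U₁) : ContDiffAt ℝ ∞ (fderiv ℝ Φ) y :=
  (h.contDiffAt hy).fderiv_right (m := ∞) (by simp)

lemma contDiffAt_snd_fderiv (hy : y ∈ U₁) : ContDiffAt ℝ ∞ (fderiv ℝ (fderiv ℝ Φ)) y :=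
  (h.contDiffAt_fderiv hy).fderiv_right (m := ∞) (by simp)

lemma snd_symm (hy : y ∈ U₁) (a b : Plane) :
    fderiv ℝ (fderiv ℝ Φ) y a b = fderiv ℝ (fderiv ℝ Φ) y b a :=
  (h.contDiffAt hy).isSymmSndFDerivAt
    (by simp only [minSmoothness_of_isRCLikeNormedField]; exact WithTop.coe_le_coe.2 le_top) a b

lemma third_symm (hy : y ∈ U₁) (a b c : Plane) :
    fderiv ℝ (fderiv ℝ (fderiv ℝ Φ)) y a b c = fderiv ℝ (fderiv ℝ (fderiv ℝ Φ)) y b a c := by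
  have : fderiv ℝ (fderiv ℝ (fderiv ℝ Φ)) y a b = fderiv ℝ (fderiv ℝ (fderiv ℝ Φ)) y b a :=
    (h.contDiffAt_fderiv hy).isSymmSndFDerivAt
      (by simp only [minSmoothness_of_isRCLikeNormedField]; exact WithTop.coe_le_coe.2 le_top) a b
  rw [this]

lemma surjective (hy : y ∈ U₁) (v : Plane) : ∃ a, fderiv ℝ Φ y a = v := by
  have hinj : Function.Injective (fderiv ℝ Φ y : Plane →ₗ[ℝ] Plane) := by
    rw [injective_iff_map_eq_zero]
    intro a ha
    by_contra hne
    have h1 := h.metric₁.pos y hy a hne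
    rw [h.bil_eq y hy] at h1
    have ha' : fderiv ℝ Φ y a = 0 := ha
    simp [ha'] at h1
  exact LinearMap.injective_iff_surjective.1 hinj v

lemma hasDerivAt_fderiv_line (hy : y ∈ U₁) (d a : Plane) :
    HasDerivAt (fun t : ℝ => fderiv ℝ Φ (y + t • d) a) (fderiv ℝ (fderiv ℝ Φ) y d a) 0 :=
  hasDerivAt_apply_const
    (hasDerivAt_comp_line ((h.contDiffAt_fderiv hy).differentiableAt (by simp)) d) a

/-- The isometry condition differentiated along a line. -/
lemma fderiv_bil_comp (hy : y ∈ U₁) (a b c : Plane) :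
    fderiv ℝ (bil G₁) y a b c =
      fderiv ℝ (bil G₂) (Φ y) (fderiv ℝ Φ y a) (fderiv ℝ Φ y b) (fderiv ℝ Φ y c)
      + bil G₂ (Φ y) (fderiv ℝ (fderiv ℝ Φ) y a b) (fderiv ℝ Φ y c)
      + bil G₂ (Φ y) (fderiv ℝ Φ y b) (fderiv ℝ (fderiv ℝ Φ) y a c) := by
  have h1 : HasDerivAt (fun t : ℝ => bil G₁ (y + t • a) b c) (fderiv ℝ (bil G₁) y a b c) 0 :=
    hasDerivAt_apply_const (hasDerivAt_apply_const
      (hasDerivAt_comp_line (h.metric₁.differentiableAt_bil hy) a) b) c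
  have h2 := hasDerivAt_bilin (T := bil G₂) (t := 0) (σ := fun t : ℝ => Φ (y + t • a))
    (by simpa using h.metric₂.differentiableAt_bil (h.mapsTo hy))
    (hasDerivAt_comp_line ((h.contDiffAt hy).differentiableAt (by simp)) a)
    (h.hasDerivAt_fderiv_line hy a b) (h.hasDerivAt_fderiv_line hy a c)
  have h3 := h1.unique (h2.congr_of_eventuallyEq (by
    filter_upwards [eventually_line_mem h.metric₁.isOpen hy a] with t ht using h.bil_eq _ ht b c))
  simpa using h3

/-- Uniqueness of the Levi-Civita connection: the defect of the formula, paired with a third vector,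
is symmetric in its first two slots and skew in its last two, so it vanishes. -/
lemma map_conn (hy : y ∈ U₁) (a b : Plane) :
    fderiv ℝ Φ y (conn G₁ y a b)
      = conn G₂ (Φ y) (fderiv ℝ Φ y a) (fderiv ℝ Φ y b) + fderiv ℝ (fderiv ℝ Φ) y a b := by
  have hy2 := h.mapsTo hy
  have key : ∀ a b c, bil G₂ (Φ y) (fderiv ℝ Φ y (conn G₁ y a b) - fderiv ℝ (fderiv ℝ Φ) y a b
      - conn G₂ (Φ y) (fderiv ℝ Φ y a) (fderiv ℝ Φ y b)) (fderiv ℝ Φ y c) = - bil G₂ (Φ y)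
      (fderiv ℝ Φ y (conn G₁ y a c) - fderiv ℝ (fderiv ℝ Φ) y a c
      - conn G₂ (Φ y) (fderiv ℝ Φ y a) (fderiv ℝ Φ y c)) (fderiv ℝ Φ y b) := by
    intro a b c
    have h1 := h.fderiv_bil_comp hy a b c
    rw [h.metric₁.compat hy, h.metric₂.compat hy2, h.bil_eq y hy, h.bil_eq y hy] at h1
    have e1 := h.metric₂.bil_symm hy2 (fderiv ℝ Φ y b) (fderiv ℝ Φ y (conn G₁ y a c))
    have e2 := h.metric₂.bil_symm hy2 (fderiv ℝ Φ y b) (fderiv ℝ (fderiv ℝ Φ) y a c)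
    have e3 := h.metric₂.bil_symm hy2 (fderiv ℝ Φ y b)
      (conn G₂ (Φ y) (fderiv ℝ Φ y a) (fderiv ℝ Φ y c))
    simp only [map_sub, sub_apply]
    linarith
  have hsymm : ∀ a b, fderiv ℝ Φ y (conn G₁ y a b) - fderiv ℝ (fderiv ℝ Φ) y a b
      - conn G₂ (Φ y) (fderiv ℝ Φ y a) (fderiv ℝ Φ y b) =
      fderiv ℝ Φ y (conn G₁ y b a) - fderiv ℝ (fderiv ℝ Φ) y b a
      - conn G₂ (Φ y) (fderiv ℝ Φ y b) (fderiv ℝ Φ y a) := fun a b => by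
    rw [h.metric₁.conn_symm hy a b, h.snd_symm hy a b, h.metric₂.conn_symm hy2]
  have hzero : fderiv ℝ Φ y (conn G₁ y a b) - fderiv ℝ (fderiv ℝ Φ) y a b
      - conn G₂ (Φ y) (fderiv ℝ Φ y a) (fderiv ℝ Φ y b) = 0 := by
    refine h.metric₂.eq_of_bil_eq hy2 fun v => ?_
    obtain ⟨c, rfl⟩ := h.surjective hy v
    -- Three skew exchanges alternating with three symmetric ones return to the start with the
    -- opposite sign.
    have k1 := key a b c
    rw [hsymm a c, key c a b, hsymm c b, key b c a, hsymm b a] at k1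
    rw [map_zero, zero_apply]
    linarith
  rw [sub_sub, sub_eq_zero] at hzero
  rw [hzero, add_comm]

lemma map_fderiv_conn (hy : y ∈ U₁) (d a b : Plane) :
    fderiv ℝ (fderiv ℝ Φ) y d (conn G₁ y a b) + fderiv ℝ Φ y (fderiv ℝ (conn G₁) y d a b)
      = fderiv ℝ (conn G₂) (Φ y) (fderiv ℝ Φ y d) (fderiv ℝ Φ y a) (fderiv ℝ Φ y b)
      + conn G₂ (Φ y) (fderiv ℝ (fderiv ℝ Φ) y d a) (fderiv ℝ Φ y b)
      + conn G₂ (Φ y) (fderiv ℝ Φ y a) (fderiv ℝ (fderiv ℝ Φ) y d b)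
      + fderiv ℝ (fderiv ℝ (fderiv ℝ Φ)) y d a b := by
  have h1 : HasDerivAt (fun t : ℝ => conn G₁ (y + t • d) a b) (fderiv ℝ (conn G₁) y d a b) 0 :=
    hasDerivAt_apply_const (hasDerivAt_apply_const
      (hasDerivAt_comp_line (h.metric₁.differentiableAt_conn hy) d) a) b
  have h1' := (hasDerivAt_comp_line ((h.contDiffAt_fderiv hy).differentiableAt (by simp)) d).clm_apply
    h1
  have h2 := hasDerivAt_bilin (T := conn G₂) (t := 0) (σ := fun t : ℝ => Φ (y + t • d))
    (by simpa using h.metric₂.differentiableAt_conn (h.mapsTo hy))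
    (hasDerivAt_comp_line ((h.contDiffAt hy).differentiableAt (by simp)) d)
    (h.hasDerivAt_fderiv_line hy d a) (h.hasDerivAt_fderiv_line hy d b)
  have h4 : HasDerivAt (fun t : ℝ => fderiv ℝ (fderiv ℝ Φ) (y + t • d) a b)
      (fderiv ℝ (fderiv ℝ (fderiv ℝ Φ)) y d a b) 0 :=
    hasDerivAt_apply_const (hasDerivAt_apply_const
      (hasDerivAt_comp_line ((h.contDiffAt_snd_fderiv hy).differentiableAt (by simp)) d) a) b
  have h3 := h1'.unique ((h2.add h4).congr_of_eventuallyEq (by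
    filter_upwards [eventually_line_mem h.metric₁.isOpen hy d] with t ht using h.map_conn ht a b))
  simpa using h3

/-- Skew-symmetrizing the derivative of the transformation law removes the third derivatives of `Φ`,
and the terms with second derivatives cancel against those from the quadratic part of the curvature.
-/
lemma map_curv (hy : y ∈ U₁) (a b c : Plane) :
    fderiv ℝ Φ y (curv (conn G₁) y a b c)
      = curv (conn G₂) (Φ y) (fderiv ℝ Φ y a) (fderiv ℝ Φ y b) (fderiv ℝ Φ y c) := by
  have e1 := h.map_fderiv_conn hy a b c
  have e2 := h.map_fderiv_conn hy b a c
  have e3 := h.map_conn hy a (conn G₁ y b c)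
  have e4 := h.map_conn hy b (conn G₁ y a c)
  rw [h.map_conn hy b c, map_add] at e3
  rw [h.map_conn hy a c, map_add] at e4
  rw [h.third_symm hy b a, h.snd_symm hy b a] at e2
  have e1' := eq_sub_of_add_eq' e1
  have e2' := eq_sub_of_add_eq' e2
  simp only [curv, map_add, map_sub]
  rw [e1', e2', e3, e4]
  abel

lemma curvature_eq (hy : y ∈ U₁) : curvature G₁ y = curvature G₂ (Φ y) := by
  obtain ⟨a, b, haa, hbb, hab⟩ := h.metric₁.exists_orthonormal hy
  have h1 := h.metric₁.bil_curv_eq hy a b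
  have h2 := h.metric₂.bil_curv_eq (h.mapsTo hy) (fderiv ℝ Φ y a) (fderiv ℝ Φ y b)
  rw [← h.map_curv hy] at h2
  simp only [← h.bil_eq y hy] at h2
  rw [haa, hbb, hab] at h1 h2
  linarith

end IsLocalIsometry

end Isometry

/-! ### Conformal change of the metric -/

section Conformal

variable {G : Plane → Matrix (Fin 2) (Fin 2) ℝ} {U : Set Plane} {y : Plane} {u : Plane → ℝ}

/-- The metric `u² G`. -/
def conf (u : Plane → ℝ) (G : Plane → Matrix (Fin 2) (Fin 2) ℝ) (y : Plane) :
    Matrix (Fin 2) (Fin 2) ℝ := u y ^ 2 • G y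

lemma bil_conf (a b : Plane) : bil (conf u G) y a b = u y ^ 2 * bil G y a b := by
  simp [bil_apply, conf]; ring

namespace IsMetricOn

variable (hG : IsMetricOn G U)
include hG

lemma conf (hu : ContDiffOn ℝ ∞ u U) (hpos : ∀ y ∈ U, 0 < u y) :
    IsMetricOn (conf u G) U where
  isOpen := hG.isOpen
  smooth i j := by
    simpa [LocalGeom.conf] using (hu.pow 2).mul (hG.smooth i j)
  symm y hy := by simp [LocalGeom.conf, hG.symm y hy]
  pos y hy v hv := by
    rw [bil_conf]
    have := hpos y hy
    have := hG.pos y hy v hv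
    positivity

variable (hu : ContDiffOn ℝ ∞ u U) (hpos : ∀ y ∈ U, 0 < u y)
include hu hpos

lemma contDiffOn_raise_fderiv_log :
    ContDiffOn ℝ ∞ (fun z => raise G z (fderiv ℝ (fun z => Real.log (u z)) z)) U := by
  unfold raise
  refine ContDiffOn.sum fun k _ => ?_
  have : ContDiffOn ℝ ∞ (fun x => ∑ i, (G x)⁻¹ k i * (fderiv ℝ (fun z => Real.log (u z)) x) (bv i)) U := by
    refine ContDiffOn.sum fun i _ => ?_
    exact (hG.contDiffOn_inv k i).mul (hG.contDiffOn_pd (hu.log fun z hz => (hpos z hz).ne') i)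
  exact this.smul contDiffOn_const

/-- The expression on the right is torsion-free and compatible with `u² G`; the argument of
`map_conn` shows that there is only one such connection. -/
lemma conn_conf (hy : y ∈ U) (a b : Plane) :
    conn (LocalGeom.conf u G) y a b = conn G y a b
      + fderiv ℝ (fun z => Real.log (u z)) y a • b + fderiv ℝ (fun z => Real.log (u z)) y b • a
      - bil G y a b • raise G y (fderiv ℝ (fun z => Real.log (u z)) y) := by
  have hG' := hG.conf hu hpos
  have hu0 := hpos y hy
  have hud : DifferentiableAt ℝ u y :=
    (hu.contDiffAt (hG.isOpen.mem_nhds hy)).differentiableAt (by simp)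
  have hlog : fderiv ℝ (fun z => Real.log (u z)) y = (u y)⁻¹ • fderiv ℝ u y :=
    (hud.hasFDerivAt.log hu0.ne').fderiv
  set φ := fderiv ℝ (fun z => Real.log (u z)) y with hφ
  have hfu : ∀ a, fderiv ℝ u y a = u y * φ a := fun a => by
    rw [hlog, smul_apply, smul_eq_mul]; field_simp
  have hd : ∀ a b c, fderiv ℝ (bil (LocalGeom.conf u G)) y a b c
      = u y ^ 2 * (2 * φ a * bil G y b c + fderiv ℝ (bil G) y a b c) := by
    intro a b c
    have h1 : HasDerivAt (fun t : ℝ => bil (LocalGeom.conf u G) (y + t • a) b c)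
        (fderiv ℝ (bil (LocalGeom.conf u G)) y a b c) 0 :=
      hasDerivAt_apply_const (hasDerivAt_apply_const
        (hasDerivAt_comp_line (hG'.differentiableAt_bil hy) a) b) c
    have h2 : HasDerivAt (fun t : ℝ => bil G (y + t • a) b c) (fderiv ℝ (bil G) y a b c) 0 :=
      hasDerivAt_apply_const (hasDerivAt_apply_const
        (hasDerivAt_comp_line (hG.differentiableAt_bil hy) a) b) c
    have h3 := ((hasDerivAt_comp_line hud a).pow 2).mul h2
    have h4 := h1.unique (h3.congr_of_eventuallyEq (Eventually.of_forall fun t => bil_conf b c))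
    rw [h4, hfu]
    simp
    ring
  have key : ∀ a b c, bil G y (conn (LocalGeom.conf u G) y a b - (conn G y a b
      + φ a • b + φ b • a - bil G y a b • raise G y φ)) c
      = - bil G y (conn (LocalGeom.conf u G) y a c - (conn G y a c
      + φ a • c + φ c • a - bil G y a c • raise G y φ)) b := by
    intro a b c
    have h1 := hG'.compat hy a b c
    rw [hd, bil_conf, bil_conf, hG.compat hy, ← mul_add] at h1
    have h2 := mul_left_cancel₀ (pow_pos hu0 2).ne' h1
    have e1 := hG.bil_symm hy b (conn G y a c)
    have e2 := hG.bil_symm hy b (conn (LocalGeom.conf u G) y a c)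
    have e3 := hG.bil_symm hy b c
    simp only [map_sub, map_add, map_smul, sub_apply, add_apply, smul_apply, smul_eq_mul,
      hG.bil_raise hy]
    linear_combination -h2 + e1 - e2 + φ a * e3
  have hsymm : ∀ a b, conn (LocalGeom.conf u G) y a b - (conn G y a b
      + φ a • b + φ b • a - bil G y a b • raise G y φ)
      = conn (LocalGeom.conf u G) y b a - (conn G y b a
      + φ b • a + φ a • b - bil G y b a • raise G y φ) := fun a b => by
    rw [hG'.conn_symm hy a b, hG.conn_symm hy a b, hG.bil_symm hy a b]; abel
  refine sub_eq_zero.1 (hG.eq_of_bil_eq hy fun c => ?_)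
  have k1 := key a b c
  rw [hsymm a c, key c a b, hsymm c b, key b c a, hsymm b a] at k1
  rw [map_zero, zero_apply]
  linarith

/-- The curvature of the conformal metric `u² G` is `u⁻² (K - Δ log u)`. -/
lemma curvature_conf (hy : y ∈ U) :
    curvature (LocalGeom.conf u G) y * u y ^ 2
      = curvature G y - laplacian G (fun z => Real.log (u z)) y := by
  have hG' := hG.conf hu hpos
  obtain ⟨a, b, haa, hbb, hab⟩ := hG.exists_orthonormal hy
  have hba : bil G y b a = 0 := by rw [hG.bil_symm hy, hab]
  have hφs : ContDiffOn ℝ ∞ (fun z => Real.log (u z)) U := hu.log fun z hz => (hpos z hz).ne'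
  set φ := fun z => Real.log (u z) with hφ
  have hφ2 : ContDiffAt ℝ ∞ (fderiv ℝ φ) y :=
    (hφs.contDiffAt (hG.isOpen.mem_nhds hy)).fderiv_right (m := ∞) (by simp)
  have hsym : ∀ c d, fderiv ℝ (fderiv ℝ φ) y c d = fderiv ℝ (fderiv ℝ φ) y d c :=
    (hφs.contDiffAt (hG.isOpen.mem_nhds hy)).isSymmSndFDerivAt
    (by simp only [minSmoothness_of_isRCLikeNormedField]; exact WithTop.coe_le_coe.2 le_top)
  -- The Laplacian becomes the trace of the covariant Hessian in the frame `a`, `b`.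
  have hlap : laplacian G φ y = (fderiv ℝ (fderiv ℝ φ) y a a - fderiv ℝ φ y (conn G y a a))
      + (fderiv ℝ (fderiv ℝ φ) y b b - fderiv ℝ φ y (conn G y b b)) := by
    have hpd : ∀ i j, pd i (pd j φ) y = fderiv ℝ (fderiv ℝ φ) y (bv i) (bv j) := fun i j =>
      (hasDerivAt_comp_line (f := pd j φ) (((hG.contDiffOn_pd hφs j).contDiffAt
        (hG.isOpen.mem_nhds hy)).differentiableAt (by simp)) (bv i)).unique
        (hasDerivAt_apply_const (hasDerivAt_comp_line (hφ2.differentiableAt (by simp)) (bv i)) (bv j))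
    have hexp : ∀ c : Plane, fderiv ℝ (fderiv ℝ φ) y c c =
        c 0 * c 0 * fderiv ℝ (fderiv ℝ φ) y (bv 0) (bv 0)
        + c 0 * c 1 * fderiv ℝ (fderiv ℝ φ) y (bv 0) (bv 1)
        + c 1 * c 0 * fderiv ℝ (fderiv ℝ φ) y (bv 1) (bv 0)
        + c 1 * c 1 * fderiv ℝ (fderiv ℝ φ) y (bv 1) (bv 1) := by
      intro c
      conv_lhs => rw [eq_sum_bv c]
      simp only [map_add, map_smul, add_apply, smul_apply, smul_eq_mul]; ring
    simp only [laplacian, Fin.sum_univ_two, hG.inv_eq hy haa hbb hab, hpd, hexp a, hexp b,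
      fderiv_apply_pd, conn_apply]
    ring
  set n : Plane → Plane := fun z => raise G z (fderiv ℝ φ z) with hn
  have hnd : DifferentiableAt ℝ n y :=
    ((hG.contDiffOn_raise_fderiv_log hu hpos).contDiffAt (hG.isOpen.mem_nhds hy)).differentiableAt
      (by simp)
  have hBn : ∀ z ∈ U, ∀ c, bil G z (n z) c = fderiv ℝ φ z c := fun z hz c => hG.bil_raise hz _ c
  have hline : ∀ d e f, HasDerivAt (fun t : ℝ => bil G (y + t • d) e f)
      (fderiv ℝ (bil G) y d e f) 0 := fun d e f =>
    hasDerivAt_apply_const (hasDerivAt_apply_const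
      (hasDerivAt_comp_line (hG.differentiableAt_bil hy) d) e) f
  have hlineφ : ∀ d e, HasDerivAt (fun t : ℝ => fderiv ℝ φ (y + t • d) e)
      (fderiv ℝ (fderiv ℝ φ) y d e) 0 := fun d e =>
    hasDerivAt_apply_const (hasDerivAt_comp_line (hφ2.differentiableAt (by simp)) d) e
  -- The covariant derivative of the gradient `n` of `φ` is dual to the Hessian of `φ`.
  have hDn : ∀ d c, bil G y (fderiv ℝ n y d) c = fderiv ℝ (fderiv ℝ φ) y d c
      - fderiv ℝ φ y (conn G y d c) - bil G y (conn G y d (n y)) c := by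
    intro d c
    have h1 := hasDerivAt_bilin (T := bil G) (t := 0)
      (by simpa using hG.differentiableAt_bil hy) (hasDerivAt_line y d)
      (hasDerivAt_comp_line hnd d) (hasDerivAt_const _ c)
    have h2 := h1.unique ((hlineφ d c).congr_of_eventuallyEq (by
      filter_upwards [eventually_line_mem hG.isOpen hy d] with t ht using hBn _ ht c))
    simp only [zero_smul, add_zero, map_zero, hG.compat hy, hBn y hy] at h2
    linarith
  have hDΓ : ∀ d e f, fderiv ℝ (conn (LocalGeom.conf u G)) y d e f =
      fderiv ℝ (conn G) y d e f + fderiv ℝ (fderiv ℝ φ) y d e • f + fderiv ℝ (fderiv ℝ φ) y d f • e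
      - (bil G y e f • fderiv ℝ n y d + fderiv ℝ (bil G) y d e f • n y) := by
    intro d e f
    have h1 : HasDerivAt (fun t : ℝ => conn (LocalGeom.conf u G) (y + t • d) e f)
        (fderiv ℝ (conn (LocalGeom.conf u G)) y d e f) 0 :=
      hasDerivAt_apply_const (hasDerivAt_apply_const
        (hasDerivAt_comp_line (hG'.differentiableAt_conn hy) d) e) f
    have h2 : HasDerivAt (fun t : ℝ => conn G (y + t • d) e f)
        (fderiv ℝ (conn G) y d e f) 0 :=
      hasDerivAt_apply_const (hasDerivAt_apply_const
        (hasDerivAt_comp_line (hG.differentiableAt_conn hy) d) e) f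
    have h3 := ((h2.add ((hlineφ d e).smul_const f)).add ((hlineφ d f).smul_const e)).sub
      ((hline d e f).smul (hasDerivAt_comp_line hnd d))
    have h4 := h1.unique (h3.congr_of_eventuallyEq (by
      filter_upwards [eventually_line_mem hG.isOpen hy d] with t ht
        using hG.conn_conf hu hpos ht e f))
    simpa using h4
  have h1 := hG'.bil_curv_eq hy a b
  simp only [bil_conf, haa, hbb, hab] at h1
  -- The conformal Gram determinant of `a`, `b` is `u⁴`, while the pairing on the left of
  -- `bil_curv_eq` carries a factor `u²`; a factor `u²` remains.
  have h2 : curvature (LocalGeom.conf u G) y * u y ^ 2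
      = bil G y (curv (conn (LocalGeom.conf u G)) y a b b) a := by
    have := (hpos y hy).ne'
    apply mul_left_cancel₀ (pow_ne_zero 2 this)
    linear_combination -h1
  have h3 := hG.bil_curv_eq hy a b
  rw [haa, hbb, hab] at h3
  have hS := fun e f => hG.conn_conf hu hpos hy e f
  rw [← hφ] at hS
  change ∀ e f, conn (LocalGeom.conf u G) y e f = conn G y e f
      + fderiv ℝ φ y e • f + fderiv ℝ φ y f • e - bil G y e f • n y at hS
  rw [h2, hlap]
  simp only [curv, map_add, map_sub, add_apply, sub_apply] at h3
  simp only [curv, hDΓ, hS, hG.compat hy, map_add, map_sub, map_smul, add_apply, sub_apply,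
    smul_apply, smul_eq_mul, haa, hbb, hab, hba, hDn, hBn y hy]
  have c1 := hG.conn_symm hy a b
  have q1 := hG.bil_symm hy b (conn G y a b)
  have q2 := hG.bil_symm hy a (conn G y b b)
  have q3 := hG.bil_symm hy a (n y)
  have hnn : fderiv ℝ φ y (n y) = fderiv ℝ φ y a ^ 2 + fderiv ℝ φ y b ^ 2 := by
    simp only [hn, raise, Fin.sum_univ_two, hG.inv_eq hy haa hbb hab, map_add, map_smul,
      smul_eq_mul, fderiv_apply_pd (f := φ) a, fderiv_apply_pd (f := φ) b, pd, bv]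
    ring
  simp only [← c1, q1, q2, q3, hBn y hy]
  -- The quadratic terms in the gradient reduce to `hnn`, and what remains is the trace of the
  -- Hessian.
  linear_combination h3 - hnn

end IsMetricOn

end Conformal

end LocalGeom

/-! ### The differential inequality in terms of the logarithm of `u` -/

namespace LocalGeom.IsMetricOn

variable {G : Plane → Matrix (Fin 2) (Fin 2) ℝ} {U : Set Plane} {y : Plane} {u : Plane → ℝ}

variable (hG : IsMetricOn G U) (hu : ContDiffOn ℝ ∞ u U) (hpos : ∀ y ∈ U, 0 < u y)
include hG hu hpos

lemma pd_log (hy : y ∈ U) (i : Fin 2) : pd i (fun z => Real.log (u z)) y = pd i u y / u y := by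
  have hud : DifferentiableAt ℝ u y :=
    (hu.contDiffAt (hG.isOpen.mem_nhds hy)).differentiableAt (by simp)
  rw [pd, (hud.hasFDerivAt.log (hpos y hy).ne').fderiv, smul_apply, smul_eq_mul, pd]
  field_simp

lemma gradSq_log (hy : y ∈ U) :
    gradSq G (fun z => Real.log (u z)) y = gradSq G u y / u y ^ 2 := by
  have := (hpos y hy).ne'
  simp only [gradSq, Fin.sum_univ_two, hG.pd_log hu hpos hy]
  field_simp

lemma laplacian_log (hy : y ∈ U) :
    laplacian G (fun z => Real.log (u z)) y
      = laplacian G u y / u y - gradSq G u y / u y ^ 2 := by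
  have hy0 := (hpos y hy).ne'
  have h2 : ∀ i j, pd i (pd j fun z => Real.log (u z)) y
      = pd i (pd j u) y / u y - pd i u y * pd j u y / u y ^ 2 := by
    intro i j
    have h1 : HasDerivAt (fun t : ℝ => pd j (fun z => Real.log (u z)) (y + t • bv i))
        (pd i (pd j fun z => Real.log (u z)) y) 0 :=
      hasDerivAt_comp_line (((hG.contDiffOn_pd (hu.log fun z hz => (hpos z hz).ne') j).contDiffAt
        (hG.isOpen.mem_nhds hy)).differentiableAt (by simp)) (bv i)
    have h3 : HasDerivAt (fun t : ℝ => pd j u (y + t • bv i)) (pd i (pd j u) y) 0 :=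
      hasDerivAt_comp_line (((hG.contDiffOn_pd hu j).contDiffAt
        (hG.isOpen.mem_nhds hy)).differentiableAt (by simp)) (bv i)
    have h4 : HasDerivAt (fun t : ℝ => u (y + t • bv i)) (pd i u y) 0 :=
      hasDerivAt_comp_line ((hu.contDiffAt
        (hG.isOpen.mem_nhds hy)).differentiableAt (by simp)) (bv i)
    have h5 := h3.div h4 (by simpa using hy0)
    rw [h1.unique (h5.congr_of_eventuallyEq (by
      filter_upwards [eventually_line_mem hG.isOpen hy (bv i)] with t ht
        using hG.pd_log hu hpos ht j))]
    simp only [zero_smul, add_zero]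
    field_simp
  simp only [laplacian, gradSq, Fin.sum_univ_two, h2, hG.pd_log hu hpos hy]
  field_simp
  ring

/-- Replacing `Δu / u` by `Δ log u + |∇ log u|²` leaves the gradient term with coefficient `1/2` on
the favourable side. -/
lemma curvature_conf_ge (hy : y ∈ U)
    (h : laplacian G u y / u y ≤ (curvature G y - 1 / 2) + (1 / 2) * (gradSq G u y / u y ^ 2)) :
    1 / 2 + (1 / 2) * gradSq G (fun z => Real.log (u z)) y
      ≤ curvature (LocalGeom.conf u G) y * u y ^ 2 := by
  rw [hG.curvature_conf hu hpos hy, hG.laplacian_log hu hpos hy, hG.gradSq_log hu hpos hy]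
  linarith

end LocalGeom.IsMetricOn

/-! ### Surfaces: metrics in charts and changes of charts -/

namespace SurfaceMetric

open LocalGeom

variable {M : Type*} [TopologicalSpace M] [ChartedSpace Plane M] [IsManifold (𝓡 2) ∞ M]

/-- The derivative of the inverse chart around `x`. -/
def dsymm (x : M) (y : Plane) : Plane →L[ℝ] TangentSpace (𝓡 2) ((extChartAt (𝓡 2) x).symm y) :=
  mfderiv 𝓘(ℝ, Plane) (𝓡 2) (extChartAt (𝓡 2) x).symm y

lemma isOpen_target (x : M) : IsOpen (extChartAt (𝓡 2) x).target := isOpen_extChartAt_target x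

lemma contMDiffAt_symm {x : M} {y : Plane} (hy : y ∈ (extChartAt (𝓡 2) x).target) :
    ContMDiffAt 𝓘(ℝ, Plane) (𝓡 2) ∞ (extChartAt (𝓡 2) x).symm y :=
  (contMDiffOn_extChartAt_symm x).contMDiffAt ((isOpen_target x).mem_nhds hy)

lemma hasMFDerivAt_symm {x : M} {y : Plane} (hy : y ∈ (extChartAt (𝓡 2) x).target) :
    HasMFDerivAt 𝓘(ℝ, Plane) (𝓡 2) (extChartAt (𝓡 2) x).symm y (dsymm x y) :=
  ((contMDiffAt_symm hy).mdifferentiableAt (by simp)).hasMFDerivAt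

lemma mfderiv_dsymm {x : M} {y : Plane} (hy : y ∈ (extChartAt (𝓡 2) x).target) (a : Plane) :
    mfderiv (𝓡 2) 𝓘(ℝ, Plane) (extChartAt (𝓡 2) x) ((extChartAt (𝓡 2) x).symm y) (dsymm x y a)
      = a := by
  have h := mfderiv_extChartAt_comp_mfderivWithin_extChartAt_symm (I := 𝓡 2) hy
  have h2 : mfderivWithin 𝓘(ℝ, Plane) (𝓡 2) (extChartAt (𝓡 2) x).symm (range (𝓡 2)) y
      = dsymm x y := by
    simp [dsymm, mfderivWithin_univ]
    rfl
  rw [h2] at h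
  exact DFunLike.congr_fun h a

lemma dsymm_mfderiv {x p : M} (hp : p ∈ (extChartAt (𝓡 2) x).source) (v : TangentSpace (𝓡 2) p) :
    (mfderiv 𝓘(ℝ, Plane) (𝓡 2) (extChartAt (𝓡 2) x).symm (extChartAt (𝓡 2) x p))
      (mfderiv (𝓡 2) 𝓘(ℝ, Plane) (extChartAt (𝓡 2) x) p v) = v := by
  have h := mfderivWithin_extChartAt_symm_comp_mfderiv_extChartAt' (I := 𝓡 2) hp
  have h2 : mfderivWithin 𝓘(ℝ, Plane) (𝓡 2) (extChartAt (𝓡 2) x).symm (range (𝓡 2))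
      (extChartAt (𝓡 2) x p)
      = mfderiv 𝓘(ℝ, Plane) (𝓡 2) (extChartAt (𝓡 2) x).symm (extChartAt (𝓡 2) x p) := by
    simp [mfderivWithin_univ]
    rfl
  rw [h2] at h
  exact DFunLike.congr_fun h v

lemma bil_coeff (g : SurfaceMetric M) (x : M) (y a b : Plane) :
    bil (g.coeff x) y a b = g.inner ((extChartAt (𝓡 2) x).symm y) (dsymm x y a) (dsymm x y b) := by
  rw [eq_sum_bv a, eq_sum_bv b]
  simp only [map_add, map_smul, add_apply, smul_apply, bil_bv, smul_eq_mul]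
  rfl

/-- This is the tangent map of the inverse chart composed with a constant vector field of the plane.
-/
lemma contMDiffAt_dsymm {x : M} {y : Plane} (hy : y ∈ (extChartAt (𝓡 2) x).target) (a : Plane) :
    ContMDiffAt 𝓘(ℝ, Plane) (𝓡 2).tangent ∞
      (fun z => (⟨(extChartAt (𝓡 2) x).symm z, dsymm x z a⟩ : TangentBundle (𝓡 2) M)) y := by
  have h1 := ((contMDiffOn_extChartAt_symm (I := 𝓡 2) (n := ∞) x).contMDiffOn_tangentMapWithin
    (m := ∞) (by simp) (isOpen_target x).uniqueMDiffOn)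
  have h2 : ContMDiffAt 𝓘(ℝ, Plane) 𝓘(ℝ, Plane).tangent ∞
      (fun z => (⟨z, a⟩ : TangentBundle 𝓘(ℝ, Plane) Plane)) y :=
    contMDiffAt_vectorSpace_iff_contDiffAt.2 contDiffAt_const
  have h3 := (h1.contMDiffAt (x := (⟨y, a⟩ : TangentBundle 𝓘(ℝ, Plane) Plane))
    (((isOpen_target x).preimage (FiberBundle.continuous_proj Plane (TangentSpace 𝓘(ℝ, Plane)))).mem_nhds hy)).comp y h2
  refine h3.congr_of_eventuallyEq ?_
  filter_upwards [(isOpen_target x).mem_nhds hy] with z hz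
  simp only [Function.comp, tangentMapWithin, dsymm]
  rw [mfderivWithin_of_isOpen (isOpen_target x) hz]
  rfl

lemma isMetricOn_coeff (g : SurfaceMetric M) (x : M) :
    IsMetricOn (g.coeff x) (extChartAt (𝓡 2) x).target where
  isOpen := isOpen_target x
  smooth i j := by
    intro y hy
    have h1 : ContMDiffAt 𝓘(ℝ, Plane) ((𝓡 2).prod 𝓘(ℝ, Plane →L[ℝ] Plane →L[ℝ] ℝ)) ∞
        (fun z => TotalSpace.mk' (Plane →L[ℝ] Plane →L[ℝ] ℝ)
          (E := fun p : M => TangentSpace (𝓡 2) p →L[ℝ] TangentSpace (𝓡 2) p →L[ℝ] Bundle.Trivial M ℝ p)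
          ((extChartAt (𝓡 2) x).symm z)
          (g.inner ((extChartAt (𝓡 2) x).symm z))) y :=
      g.contMDiff.contMDiffAt.comp y (contMDiffAt_symm hy)
    have h2 := ContMDiffAt.clm_bundle_apply₂ (F₁ := Plane) (F₂ := Plane) (F₃ := ℝ)
      (E₃ := Bundle.Trivial M ℝ) h1
      (contMDiffAt_dsymm hy (bv i)) (contMDiffAt_dsymm hy (bv j))
    simp only [contMDiffAt_totalSpace] at h2
    exact h2.2.contDiffAt.contDiffWithinAt
  symm y hy := g.symm _ _ _
  pos y hy v hv := by
    rw [bil_coeff]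
    refine g.pos _ _ fun h => hv ?_
    rw [← mfderiv_dsymm hy v, h, map_zero]
    rfl

/-- The change of coordinates between the charts around `x` and `x'`. -/
def transition (x x' : M) (y : Plane) : Plane := extChartAt (𝓡 2) x' ((extChartAt (𝓡 2) x).symm y)

/-- The part of the chart around `x` that is covered by the chart around `x'`. -/
def overlap (x x' : M) : Set Plane :=
  (extChartAt (𝓡 2) x).target ∩ (extChartAt (𝓡 2) x).symm ⁻¹' (extChartAt (𝓡 2) x').source

lemma isOpen_overlap (x x' : M) : IsOpen (overlap x x') :=
  (continuousOn_extChartAt_symm x).isOpen_inter_preimage (isOpen_target x)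
    (isOpen_extChartAt_source x')

lemma mapsTo_transition (x x' : M) :
    MapsTo (transition x x') (overlap x x') (extChartAt (𝓡 2) x').target :=
  fun _ hy => (extChartAt (𝓡 2) x').map_source hy.2

lemma symm_transition {x x' : M} {y : Plane} (hy : y ∈ overlap x x') :
    (extChartAt (𝓡 2) x').symm (transition x x' y) = (extChartAt (𝓡 2) x).symm y :=
  (extChartAt (𝓡 2) x').left_inv hy.2

lemma contDiffOn_transition (x x' : M) : ContDiffOn ℝ ∞ (transition x x') (overlap x x') := by
  have h := ContMDiffOn.comp (I' := 𝓡 2) (contMDiffOn_extChartAt (I := 𝓡 2) (n := ∞) (x := x'))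
    ((contMDiffOn_extChartAt_symm (I := 𝓡 2) (n := ∞) x).mono
      (inter_subset_left (t := (extChartAt (𝓡 2) x).symm ⁻¹' (extChartAt (𝓡 2) x').source)))
    (fun y hy => by simpa using hy.2)
  exact h.contDiffOn

lemma dsymm_fderiv_transition {x x' : M} {y : Plane} (hy : y ∈ overlap x x') (a : Plane) :
    dsymm x' (transition x x' y) (fderiv ℝ (transition x x') y a) = dsymm x y a := by
  have h1 : HasMFDerivAt (𝓡 2) 𝓘(ℝ, Plane) (extChartAt (𝓡 2) x')
      ((extChartAt (𝓡 2) x).symm y) (mfderiv (𝓡 2) 𝓘(ℝ, Plane) (extChartAt (𝓡 2) x')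
      ((extChartAt (𝓡 2) x).symm y)) :=
    (mdifferentiableAt_extChartAt (by simpa using hy.2)).hasMFDerivAt
  have h2 := h1.comp y (hasMFDerivAt_symm hy.1)
  have h4 : fderiv ℝ (transition x x') y a = mfderiv (𝓡 2) 𝓘(ℝ, Plane) (extChartAt (𝓡 2) x')
      ((extChartAt (𝓡 2) x).symm y) (dsymm x y a) := by
    rw [← mfderiv_eq_fderiv]
    exact DFunLike.congr_fun h2.mfderiv a
  rw [h4]
  exact dsymm_mfderiv hy.2 _

lemma isLocalIsometry_transition (g : SurfaceMetric M) (x x' : M) :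
    IsLocalIsometry (g.coeff x) (g.coeff x') (overlap x x') (extChartAt (𝓡 2) x').target
      (transition x x') where
  metric₁ :=
    { isOpen := isOpen_overlap x x'
      smooth := fun i j => ((g.isMetricOn_coeff x).smooth i j).mono inter_subset_left
      symm := fun y hy => (g.isMetricOn_coeff x).symm y hy.1
      pos := fun y hy => (g.isMetricOn_coeff x).pos y hy.1 }
  metric₂ := g.isMetricOn_coeff x'
  smooth := contDiffOn_transition x x'
  mapsTo := mapsTo_transition x x'
  bil_eq y hy a b := by
    rw [bil_coeff, bil_coeff, dsymm_fderiv_transition hy, dsymm_fderiv_transition hy,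
      symm_transition hy]

/-- `g.curvature` uses a different chart at each point. Since changes of charts are local
isometries, any one chart may be used for all of its points, as is needed along a curve. -/
lemma curvature_eq (g : SurfaceMetric M) (x : M) {y : Plane}
    (hy : y ∈ (extChartAt (𝓡 2) x).target) :
    g.curvature ((extChartAt (𝓡 2) x).symm y) = LocalGeom.curvature (g.coeff x) y := by
  set p := (extChartAt (𝓡 2) x).symm y
  have hy' : y ∈ overlap x p := ⟨hy, mem_extChartAt_source _⟩
  rw [(g.isLocalIsometry_transition x p).curvature_eq hy']
  rfl

/-- By homogeneity it suffices that the form has a positive minimum on the compact unit circle. -/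
lemma isVonNBounded_of_pos (B : Plane →L[ℝ] Plane →L[ℝ] ℝ) (hB : ∀ v ≠ 0, 0 < B v v) :
    Bornology.IsVonNBounded ℝ {v : Plane | B v v < 1} := by
  rw [NormedSpace.isVonNBounded_iff']
  have hc : Continuous fun v : Plane => B v v := by fun_prop
  obtain ⟨v, hv, hmin⟩ := (isCompact_sphere (0 : Plane) 1).exists_isMinOn
    ((NormedSpace.sphere_nonempty (x := (0 : Plane)) (r := 1)).2 zero_le_one) hc.continuousOn
  have hv0 : v ≠ 0 := fun h => by simp [h] at hv
  have hm := hB v hv0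
  refine ⟨Real.sqrt (1 / B v v), fun w hw => ?_⟩
  by_cases hw0 : w = 0
  · simp [hw0]
  have hn : 0 < ‖w‖ := norm_pos_iff.2 hw0
  have h1 : B v v ≤ B (‖w‖⁻¹ • w) (‖w‖⁻¹ • w) :=
    hmin (by simp [norm_smul, hn.ne'])
  simp only [map_smul, smul_apply, smul_eq_mul] at h1
  have hw' : B w w < 1 := hw
  apply Real.le_sqrt_of_sq_le
  rw [le_div_iff₀ hm]
  have : ‖w‖ ^ 2 * (‖w‖⁻¹ * (‖w‖⁻¹ * B w w)) = B w w := by field_simp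
  nlinarith [mul_le_mul_of_nonneg_left h1 (sq_nonneg ‖w‖)]

/-- The conformal metric `ρ g`. -/
def scale (g : SurfaceMetric M) (ρ : M → ℝ) (hρ : ContMDiff (𝓡 2) 𝓘(ℝ, ℝ) ∞ ρ)
    (hpos : ∀ x, 0 < ρ x) : SurfaceMetric M where
  inner x := ρ x • g.inner x
  symm x v w := by
    change ρ x * g.inner x v w = ρ x * g.inner x w v
    rw [g.symm]
  pos x v hv := mul_pos (hpos x) (g.pos x v hv)
  isVonNBounded x := isVonNBounded_of_pos (ρ x • g.inner x)
    fun v hv => mul_pos (hpos x) (g.pos x v hv)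
  contMDiff := hρ.smul_section g.contMDiff

lemma contDiffOn_comp_symm {u : M → ℝ} (hu : ContMDiff (𝓡 2) 𝓘(ℝ, ℝ) ∞ u) (x : M) :
    ContDiffOn ℝ ∞ (u ∘ (extChartAt (𝓡 2) x).symm) (extChartAt (𝓡 2) x).target :=
  (hu.comp_contMDiffOn (contMDiffOn_extChartAt_symm x)).contDiffOn

lemma coeff_scale_sq (g : SurfaceMetric M) {u : M → ℝ} (hu : ContMDiff (𝓡 2) 𝓘(ℝ, ℝ) ∞ (u ^ 2))
    (hpos : ∀ x, 0 < (u ^ 2) x) (x : M) :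
    (g.scale (u ^ 2) hu hpos).coeff x = conf (u ∘ (extChartAt (𝓡 2) x).symm) (g.coeff x) := by
  ext y i j
  rfl

end SurfaceMetric

/-! ### Lengths of paths and the Riemannian distance -/

open MeasureTheory

namespace LocalGeom.IsMetricOn

variable {G : Plane → Matrix (Fin 2) (Fin 2) ℝ} {U : Set Plane} {y : Plane}
  (hG : IsMetricOn G U)
include hG

lemma exists_lower (hy : y ∈ U) : ∃ m > 0, ∀ v, m * ‖v‖ ^ 2 ≤ bil G y v v := by
  have hc : Continuous fun v : Plane => bil G y v v := by fun_prop
  obtain ⟨v, hv, hmin⟩ := (isCompact_sphere (0 : Plane) 1).exists_isMinOn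
    ((NormedSpace.sphere_nonempty (x := (0 : Plane)) (r := 1)).2 zero_le_one) hc.continuousOn
  have hv0 : v ≠ 0 := fun h => by simp [h] at hv
  refine ⟨_, hG.pos y hy v hv0, fun w => ?_⟩
  by_cases hw0 : w = 0
  · simp [hw0]
  have hn : 0 < ‖w‖ := norm_pos_iff.2 hw0
  have h1 : bil G y v v ≤ bil G y (‖w‖⁻¹ • w) (‖w‖⁻¹ • w) :=
    hmin (by simp [norm_smul, hn.ne'])
  simp only [map_smul, smul_apply, smul_eq_mul] at h1
  have : ‖w‖ ^ 2 * (‖w‖⁻¹ * (‖w‖⁻¹ * bil G y w w)) = bil G y w w := by field_simp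
  nlinarith [mul_le_mul_of_nonneg_left h1 (sq_nonneg ‖w‖)]

/-- Continuity of the coefficients, measured against the lower bound `m ‖v‖²` at the centre. -/
lemma exists_ball_sqrt_le (hy : y ∈ U) {ε : ℝ} (hε : 0 < ε) :
    ∃ δ > 0, Metric.ball y δ ⊆ U ∧ ∀ z ∈ Metric.ball y δ, ∀ v,
      Real.sqrt (bil G z v v) ≤ (1 + ε) * Real.sqrt (bil G y v v) ∧
      Real.sqrt (bil G y v v) ≤ (1 + ε) * Real.sqrt (bil G z v v) := by
  obtain ⟨m, hm, hlow⟩ := hG.exists_lower hy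
  -- The first bound on `η` serves the comparison from above, the second the one from below.
  obtain ⟨η, hη, hη1, hη2⟩ : ∃ η > 0, η ≤ m * ε ∧ η * (1 + ε) ≤ m * ε := by
    refine ⟨m * ε / (1 + ε), by positivity, ?_, ?_⟩
    · exact div_le_self (by positivity) (by linarith)
    · rw [div_mul_cancel₀ _ (by positivity)]
  have hcont := (hG.differentiableAt_bil hy).continuousAt
  obtain ⟨δ₁, hδ₁, h₁⟩ := Metric.continuousAt_iff.1 hcont η hη
  obtain ⟨δ₂, hδ₂, h₂⟩ := Metric.isOpen_iff.1 hG.isOpen y hy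
  refine ⟨min δ₁ δ₂, lt_min hδ₁ hδ₂,
    (Metric.ball_subset_ball (min_le_right _ _)).trans h₂, fun z hz v => ?_⟩
  have hzU : z ∈ U := h₂ (Metric.ball_subset_ball (min_le_right _ _) hz)
  have hd : ‖bil G z - bil G y‖ ≤ η := by
    have := h₁ (lt_of_lt_of_le hz (min_le_left _ _))
    rw [dist_eq_norm] at this
    exact this.le
  have hb : |bil G z v v - bil G y v v| ≤ η * ‖v‖ ^ 2 := by
    have h1 := (bil G z - bil G y).le_opNorm₂ v v
    rw [sub_apply, sub_apply, Real.norm_eq_abs] at h1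
    calc _ ≤ _ := h1
      _ ≤ η * ‖v‖ * ‖v‖ := by gcongr
      _ = η * ‖v‖ ^ 2 := by ring
  have hb' := abs_le.1 hb
  have hl := hlow v
  have hn : 0 ≤ ‖v‖ ^ 2 := by positivity
  have hy0 := hG.bil_nonneg hy v
  have hz0 := hG.bil_nonneg hzU v
  constructor
  · rw [← Real.sqrt_sq (by positivity : (0 : ℝ) ≤ 1 + ε), ← Real.sqrt_mul (by positivity)]
    apply Real.sqrt_le_sqrt
    nlinarith [mul_le_mul_of_nonneg_right hη1 hn, mul_le_mul_of_nonneg_left hl hε.le]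
  · rw [← Real.sqrt_sq (by positivity : (0 : ℝ) ≤ 1 + ε), ← Real.sqrt_mul (by positivity)]
    apply Real.sqrt_le_sqrt
    nlinarith [mul_le_mul_of_nonneg_right hη2 hn, mul_le_mul_of_nonneg_left hl hε.le]

lemma abs_bil_le (hy : y ∈ U) (a b : Plane) :
    |bil G y a b| ≤ Real.sqrt (bil G y a a) * Real.sqrt (bil G y b b) := by
  rw [← Real.sqrt_mul (hG.bil_nonneg hy a)]
  apply Real.abs_le_sqrt
  nlinarith [hG.det_mul hy a b, mul_nonneg (hG.det_pos hy).le (sq_nonneg (a 0 * b 1 - a 1 * b 0))]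

end LocalGeom.IsMetricOn

namespace SurfaceMetric

open LocalGeom

variable {M : Type*} [TopologicalSpace M] [ChartedSpace Plane M] [IsManifold (𝓡 2) ∞ M]

/-- The length of a tangent vector. -/
def len (g : SurfaceMetric M) {x : M} (v : TangentSpace (𝓡 2) x) : ℝ := Real.sqrt (g.inner x v v)

/-- The differential of a real function. -/
def dfun (F : M → ℝ) (p : M) : TangentSpace (𝓡 2) p →L[ℝ] ℝ := mfderiv (𝓡 2) 𝓘(ℝ, ℝ) F p

/-- The velocity of a curve. -/
def vel (γ : ℝ → M) (t : ℝ) : TangentSpace (𝓡 2) (γ t) := mfderiv 𝓘(ℝ, ℝ) (𝓡 2) γ t (1 : ℝ)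

lemma enorm_eq (g : SurfaceMetric M) {x : M} (v : TangentSpace (𝓡 2) x) :
    letI : RiemannianBundle (fun x : M => TangentSpace (𝓡 2) x) := ⟨g.toRiemannianMetric⟩
    ‖v‖ₑ = ENNReal.ofReal (g.len v) := by
  let _ : RiemannianBundle (fun x : M => TangentSpace (𝓡 2) x) := ⟨g.toRiemannianMetric⟩
  rw [← ofReal_norm, norm_eq_sqrt_real_inner]
  rfl

lemma dist_le_lintegral (g : SurfaceMetric M) {γ : ℝ → M} {a b : ℝ} (hab : a ≤ b)
    (hγ : ContMDiffOn 𝓘(ℝ, ℝ) (𝓡 2) 1 γ (Icc a b)) :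
    g.dist (γ a) (γ b) ≤ ∫⁻ t in Icc a b, ENNReal.ofReal (g.len (vel γ t)) := by
  let _ : RiemannianBundle (fun x : M => TangentSpace (𝓡 2) x) := ⟨g.toRiemannianMetric⟩
  have h := riemannianEDist_le_pathELength (I := 𝓡 2) hγ rfl rfl hab
  rw [pathELength] at h
  simp only [g.enorm_eq] at h
  exact h

lemma exists_path (g : SurfaceMetric M) {x y : M} {r : ℝ≥0∞} (h : g.dist x y < r) :
    ∃ γ : ℝ → M, γ 0 = x ∧ γ 1 = y ∧ ContMDiff 𝓘(ℝ, ℝ) (𝓡 2) 1 γ ∧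
      ∫⁻ t in Icc 0 1, ENNReal.ofReal (g.len (vel γ t)) < r := by
  let _ : RiemannianBundle (fun x : M => TangentSpace (𝓡 2) x) := ⟨g.toRiemannianMetric⟩
  obtain ⟨γ, h0, h1, hs, hl, -⟩ :=
    exists_lt_locally_constant_of_riemannianEDist_lt (I := 𝓡 2) h zero_lt_one
  refine ⟨γ, h0, h1, hs, ?_⟩
  rw [pathELength] at hl
  simp only [g.enorm_eq] at hl
  exact hl

lemma dist_self (g : SurfaceMetric M) (x : M) : g.dist x x = 0 := by
  let _ : RiemannianBundle (fun x : M => TangentSpace (𝓡 2) x) := ⟨g.toRiemannianMetric⟩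
  exact riemannianEDist_self

lemma dist_comm (g : SurfaceMetric M) (x y : M) : g.dist x y = g.dist y x := by
  let _ : RiemannianBundle (fun x : M => TangentSpace (𝓡 2) x) := ⟨g.toRiemannianMetric⟩
  exact riemannianEDist_comm

lemma dist_triangle (g : SurfaceMetric M) (x y z : M) : g.dist x z ≤ g.dist x y + g.dist y z := by
  let _ : RiemannianBundle (fun x : M => TangentSpace (𝓡 2) x) := ⟨g.toRiemannianMetric⟩
  exact riemannianEDist_triangle

lemma isContinuousRiemannianBundle (g : SurfaceMetric M) :
    letI : RiemannianBundle (fun x : M => TangentSpace (𝓡 2) x) := ⟨g.toRiemannianMetric⟩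
    IsContinuousRiemannianBundle Plane (fun x : M => TangentSpace (𝓡 2) x) :=
  let _ : RiemannianBundle (fun x : M => TangentSpace (𝓡 2) x) := ⟨g.toRiemannianMetric⟩
  ⟨g.inner, g.contMDiff.continuous, fun _ _ _ => rfl⟩

lemma eventually_dist_lt (g : SurfaceMetric M) (x : M) {c : ℝ≥0∞} (hc : 0 < c) :
    ∀ᶠ y in 𝓝 x, g.dist x y < c := by
  let _ : RiemannianBundle (fun x : M => TangentSpace (𝓡 2) x) := ⟨g.toRiemannianMetric⟩
  have := g.isContinuousRiemannianBundle
  exact eventually_riemannianEDist_lt (𝓡 2) x hc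

lemma exists_dist_lt_subset [RegularSpace M] (g : SurfaceMetric M) {x : M} {s : Set M}
    (hs : s ∈ 𝓝 x) : ∃ c > 0, {y | g.dist x y < c} ⊆ s := by
  let _ : RiemannianBundle (fun x : M => TangentSpace (𝓡 2) x) := ⟨g.toRiemannianMetric⟩
  have := g.isContinuousRiemannianBundle
  exact setOfPred_riemannianEDist_lt_subset_nhds' (𝓡 2) hs

/-- A function whose derivative has norm at most `L` along a path grows along it by at most `L`
times the length of the path. -/
lemma ofReal_abs_sub_le (g : SurfaceMetric M) {F : M → ℝ} {W : Set M} (hW : IsOpen W)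
    (hF : ContMDiffOn (𝓡 2) 𝓘(ℝ, ℝ) 1 F W) {L : ℝ} (hL : 0 ≤ L)
    (hle : ∀ p ∈ W, ∀ v : TangentSpace (𝓡 2) p,
      |dfun F p v| ≤ L * g.len v)
    {γ : ℝ → M} (hγ : ContMDiff 𝓘(ℝ, ℝ) (𝓡 2) 1 γ) (hγW : ∀ t ∈ Icc (0 : ℝ) 1, γ t ∈ W) :
    ENNReal.ofReal |F (γ 1) - F (γ 0)| ≤
      ENNReal.ofReal L * ∫⁻ t in Icc 0 1, ENNReal.ofReal (g.len (vel γ t)) := by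
  have hsm : ∀ t ∈ Icc (0 : ℝ) 1, ContDiffAt ℝ 1 (F ∘ γ) t := fun t ht =>
    ((hF.contMDiffAt (hW.mem_nhds (hγW t ht))).comp t hγ.contMDiffAt).contDiffAt
  have hd : ∀ t ∈ Icc (0 : ℝ) 1, deriv (F ∘ γ) t
      = dfun F (γ t) (vel γ t) := fun t ht => by
    have h1 := ((hF.contMDiffAt (hW.mem_nhds (hγW t ht))).mdifferentiableAt one_ne_zero).hasMFDerivAt
    have h2 := (hγ.contMDiffAt (x := t)).mdifferentiableAt one_ne_zero |>.hasMFDerivAt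
    have h3 := (h1.comp t h2).mfderiv
    rw [mfderiv_eq_fderiv] at h3
    rw [← fderiv_apply_one_eq_deriv]
    exact DFunLike.congr_fun h3 (1 : ℝ)
  have hcd : ContinuousOn (deriv (F ∘ γ)) (Icc 0 1) := by
    intro t ht
    have : ContDiffAt ℝ 0 (fderiv ℝ (F ∘ γ)) t := (hsm t ht).fderiv_right (by simp)
    have h2 : ContinuousAt (fun t => fderiv ℝ (F ∘ γ) t 1) t :=
      this.continuousAt.clm_apply continuousAt_const
    exact h2.continuousWithinAt
  have hint : ∫ t in (0 : ℝ)..1, deriv (F ∘ γ) t = F (γ 1) - F (γ 0) :=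
    intervalIntegral.integral_deriv_eq_sub
      (fun t ht => (hsm t (by simpa using ht)).differentiableAt one_ne_zero)
      (by apply ContinuousOn.intervalIntegrable; simpa using hcd)
  rw [← hint, intervalIntegral.integral_of_le zero_le_one, ← integral_Icc_eq_integral_Ioc,
    ← Real.norm_eq_abs, ofReal_norm]
  refine (enorm_integral_le_lintegral_enorm _).trans ?_
  rw [← lintegral_const_mul' _ _ ENNReal.ofReal_ne_top]
  refine setLIntegral_mono_ae' measurableSet_Icc (Eventually.of_forall fun t ht => ?_)
  rw [← ENNReal.ofReal_mul hL, ← ofReal_norm, Real.norm_eq_abs, hd t ht]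
  exact ENNReal.ofReal_le_ofReal (hle _ (hγW t ht) _)

/-- The points at finite distance from `x` form a clopen set, because nearby points are at finite
distance from each other. -/
lemma dist_lt_top [ConnectedSpace M] (g : SurfaceMetric M) (x y : M) : g.dist x y < ⊤ := by
  have hclopen : IsClopen {z | g.dist x z < ⊤} := by
    constructor
    · rw [← isOpen_compl_iff, isOpen_iff_mem_nhds]
      intro z hz
      filter_upwards [g.eventually_dist_lt z ENNReal.zero_lt_top] with w hw hw'
      apply hz
      refine lt_of_le_of_lt (g.dist_triangle x w z) (ENNReal.add_lt_top.2 ⟨hw', ?_⟩)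
      rwa [g.dist_comm]
    · rw [isOpen_iff_mem_nhds]
      intro z hz
      filter_upwards [g.eventually_dist_lt z ENNReal.zero_lt_top] with w hw
      exact lt_of_le_of_lt (g.dist_triangle x z w) (ENNReal.add_lt_top.2 ⟨hz, hw⟩)
  have := hclopen.eq_univ ⟨x, by simp [g.dist_self]⟩
  exact this.symm.subset (mem_univ y)

/-- The Riemannian distance as a real number. -/
def rdist (g : SurfaceMetric M) (x y : M) : ℝ := (g.dist x y).toReal

section Connected

variable [ConnectedSpace M] (g : SurfaceMetric M)

lemma ofReal_rdist (x y : M) : ENNReal.ofReal (g.rdist x y) = g.dist x y :=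
  ENNReal.ofReal_toReal (g.dist_lt_top x y).ne

omit [ConnectedSpace M] in
lemma rdist_nonneg (x y : M) : 0 ≤ g.rdist x y := ENNReal.toReal_nonneg

omit [ConnectedSpace M] in
lemma rdist_self (x : M) : g.rdist x x = 0 := by simp [rdist, g.dist_self]

omit [ConnectedSpace M] in
lemma rdist_comm (x y : M) : g.rdist x y = g.rdist y x := by rw [rdist, g.dist_comm, rdist]

lemma rdist_triangle (x y z : M) : g.rdist x z ≤ g.rdist x y + g.rdist y z := by
  rw [rdist, rdist, rdist, ← ENNReal.toReal_add (g.dist_lt_top _ _).ne (g.dist_lt_top _ _).ne]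
  exact ENNReal.toReal_mono (ENNReal.add_lt_top.2 ⟨g.dist_lt_top _ _, g.dist_lt_top _ _⟩).ne
    (g.dist_triangle x y z)

lemma continuous_rdist : Continuous fun p : M × M => g.rdist p.1 p.2 := by
  rw [continuous_iff_continuousAt]
  rintro ⟨x, y⟩
  rw [Metric.continuousAt_iff']
  intro ε hε
  have hx := g.eventually_dist_lt x (c := ENNReal.ofReal (ε / 2)) (by positivity)
  have hy := g.eventually_dist_lt y (c := ENNReal.ofReal (ε / 2)) (by positivity)
  rw [nhds_prod_eq]
  filter_upwards [hx.prod_mk hy] with ⟨x', y'⟩ ⟨h1, h2⟩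
  simp only at h1 h2
  have h1' : g.rdist x x' < ε / 2 := (ENNReal.lt_ofReal_iff_toReal_lt (g.dist_lt_top _ _).ne).1 h1
  have h2' : g.rdist y y' < ε / 2 := (ENNReal.lt_ofReal_iff_toReal_lt (g.dist_lt_top _ _).ne).1 h2
  rw [Real.dist_eq, abs_lt]
  have a1 := g.rdist_triangle x x' y
  have a2 := g.rdist_triangle x' y' y
  have a3 := g.rdist_triangle x' x y'
  have a4 := g.rdist_triangle x y y'
  have c1 := g.rdist_comm y' y
  have c2 := g.rdist_comm x' x
  constructor <;> linarith

/-- On a path of length less than `d(x, y) + ε` the intermediate value theorem finds `z`, and the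
remainder of the path bounds the distance from `z` to `y`. -/
lemma exists_intermediate {x y : M} {r ε : ℝ} (hr : 0 ≤ r) (hr' : r ≤ g.rdist x y) (hε : 0 < ε) :
    ∃ z, g.rdist x z = r ∧ g.rdist z y ≤ g.rdist x y - r + ε := by
  have hlt : g.dist x y < ENNReal.ofReal (g.rdist x y + ε) := by
    rw [← g.ofReal_rdist]
    exact ENNReal.ofReal_lt_ofReal_iff_of_nonneg (g.rdist_nonneg x y) |>.2 (by linarith)
  obtain ⟨γ, h0, h1, hs, hl⟩ := g.exists_path hlt
  have hcont : Continuous fun t => g.rdist x (γ t) :=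
    g.continuous_rdist.comp (continuous_const.prodMk hs.continuous)
  obtain ⟨t, ht, htr⟩ : r ∈ (fun t => g.rdist x (γ t)) '' Icc 0 1 := by
    apply intermediate_value_Icc zero_le_one hcont.continuousOn
    simp only [h0, h1, g.rdist_self]
    exact ⟨hr, hr'⟩
  refine ⟨γ t, htr, ?_⟩
  have e1 := g.dist_le_lintegral ht.1 (hs.contMDiffOn (s := Icc 0 t))
  have e2 := g.dist_le_lintegral ht.2 (hs.contMDiffOn (s := Icc t 1))
  have e3 : g.dist (γ 0) (γ t) + g.dist (γ t) (γ 1) < ENNReal.ofReal (g.rdist x y + ε) := by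
    refine lt_of_le_of_lt (add_le_add e1 e2) (lt_of_le_of_lt ?_ hl)
    rw [← Icc_union_Ioc_eq_Icc ht.1 ht.2, lintegral_union measurableSet_Ioc]
    · rw [restrict_Ioc_eq_restrict_Icc]
    · exact disjoint_left.2 fun s hs hs' => not_lt.2 hs.2 hs'.1
  rw [h0, h1, ← g.ofReal_rdist, ← g.ofReal_rdist, ← ENNReal.ofReal_add (g.rdist_nonneg _ _)
    (g.rdist_nonneg _ _), ENNReal.ofReal_lt_ofReal_iff_of_nonneg
      (add_nonneg (g.rdist_nonneg _ _) (g.rdist_nonneg _ _))] at e3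
  simp only at htr
  linarith

end Connected

end SurfaceMetric

/-! ### The distance in a chart compared with the metric -/

namespace SurfaceMetric

open LocalGeom

variable {M : Type*} [TopologicalSpace M] [ChartedSpace Plane M] [IsManifold (𝓡 2) ∞ M]

lemma vel_symm_comp {x : M} {c : ℝ → Plane} {v : Plane} {t : ℝ}
    (hc : c t ∈ (extChartAt (𝓡 2) x).target) (hd : HasDerivAt c v t) :
    vel ((extChartAt (𝓡 2) x).symm ∘ c) t = dsymm x (c t) v := by
  have h1 := (hasMFDerivAt_symm hc).comp t hd.hasFDerivAt.hasMFDerivAt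
  have h2 := DFunLike.congr_fun h1.mfderiv (1 : ℝ)
  refine h2.trans ?_
  change dsymm x (c t) ((ContinuousLinearMap.toSpanSingleton ℝ v) (1 : ℝ)) = _
  simp

lemma len_dsymm (g : SurfaceMetric M) (x : M) (y v : Plane) :
    g.len (dsymm x y v) = Real.sqrt (bil (g.coeff x) y v v) := by
  rw [bil_coeff, len]

lemma len_vel_symm_comp (g : SurfaceMetric M) {x : M} {c : ℝ → Plane} {v : Plane} {t : ℝ}
    (hc : c t ∈ (extChartAt (𝓡 2) x).target) (hd : HasDerivAt c v t) :
    g.len (vel ((extChartAt (𝓡 2) x).symm ∘ c) t) = Real.sqrt (bil (g.coeff x) (c t) v v) := by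
  have h1 : ∀ w : TangentSpace (𝓡 2) ((extChartAt (𝓡 2) x).symm (c t)), w = dsymm x (c t) v →
      g.len w = Real.sqrt (bil (g.coeff x) (c t) v v) := by
    rintro w rfl
    exact g.len_dsymm x (c t) v
  exact h1 _ (vel_symm_comp hc hd)

lemma len_eq_of_mem_source (g : SurfaceMetric M) {x p : M} (hp : p ∈ (extChartAt (𝓡 2) x).source)
    (v : TangentSpace (𝓡 2) p) :
    g.len v = Real.sqrt (bil (g.coeff x) (extChartAt (𝓡 2) x p)
      (mfderiv (𝓡 2) 𝓘(ℝ, Plane) (extChartAt (𝓡 2) x) p v)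
      (mfderiv (𝓡 2) 𝓘(ℝ, Plane) (extChartAt (𝓡 2) x) p v)) := by
  obtain ⟨y, hy, rfl⟩ : ∃ y ∈ (extChartAt (𝓡 2) x).target, (extChartAt (𝓡 2) x).symm y = p :=
    ⟨_, (extChartAt (𝓡 2) x).map_source hp, (extChartAt (𝓡 2) x).left_inv hp⟩
  rw [(extChartAt (𝓡 2) x).right_inv hy]
  obtain ⟨w, rfl⟩ : ∃ w, dsymm x y w = v := by
    have h := dsymm_mfderiv hp v
    rw [(extChartAt (𝓡 2) x).right_inv hy] at h
    exact ⟨_, h⟩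
  have h1 : ∀ q : Plane, q = w → g.len (dsymm x y w) = Real.sqrt (bil (g.coeff x) y q q) := by
    rintro q rfl
    exact g.len_dsymm x y q
  exact h1 _ (mfderiv_dsymm hy w)

variable [ConnectedSpace M] (g : SurfaceMetric M)

/-- The distance in the chart around `x`. -/
def chartDist (x : M) (y z : Plane) : ℝ :=
  g.rdist ((extChartAt (𝓡 2) x).symm y) ((extChartAt (𝓡 2) x).symm z)

/-- The straight segment in the chart is a competitor whose length is computed with nearly constant
coefficients. -/
lemma exists_chartDist_le (x : M) {y : Plane} (hy : y ∈ (extChartAt (𝓡 2) x).target) {ε : ℝ}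
    (hε : 0 < ε) : ∃ δ > 0, ∀ z ∈ Metric.ball y δ, ∀ z' ∈ Metric.ball y δ,
      g.chartDist x z z' ≤ (1 + ε) * Real.sqrt (bil (g.coeff x) y (z' - z) (z' - z)) := by
  obtain ⟨δ, hδ, hsub, hle⟩ := (g.isMetricOn_coeff x).exists_ball_sqrt_le hy hε
  refine ⟨δ, hδ, fun z hz z' hz' => ?_⟩
  have hmem : ∀ t ∈ Icc (0 : ℝ) 1, z + t • (z' - z) ∈ Metric.ball y δ := fun t ht =>
    (convex_ball y δ).add_smul_sub_mem hz hz' ht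
  have hd : ∀ t : ℝ, HasDerivAt (fun t : ℝ => z + t • (z' - z)) (z' - z) t := fun t => by
    simpa using ((hasDerivAt_id t).smul_const (z' - z)).const_add z
  have hsm : ContMDiffOn 𝓘(ℝ, ℝ) (𝓡 2) 1
      ((extChartAt (𝓡 2) x).symm ∘ fun t : ℝ => z + t • (z' - z)) (Icc 0 1) := by
    refine ((contMDiffOn_extChartAt_symm (n := ∞) x).of_le (by simp)).comp (t := (extChartAt (𝓡 2) x).target)
      (I' := 𝓘(ℝ, Plane)) ?_
      (fun t ht => hsub (hmem t ht))
    rw [contMDiffOn_iff_contDiffOn]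
    exact (contDiff_const.add (contDiff_id.smul contDiff_const)).contDiffOn
  have h1 := g.dist_le_lintegral zero_le_one hsm
  have e0 : ((extChartAt (𝓡 2) x).symm ∘ fun t : ℝ => z + t • (z' - z)) 0
      = (extChartAt (𝓡 2) x).symm z := by simp
  have e1 : ((extChartAt (𝓡 2) x).symm ∘ fun t : ℝ => z + t • (z' - z)) 1
      = (extChartAt (𝓡 2) x).symm z' := by simp
  have h4 : ∀ t ∈ Icc (0 : ℝ) 1,
      g.len (vel ((extChartAt (𝓡 2) x).symm ∘ fun t : ℝ => z + t • (z' - z)) t)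
        = Real.sqrt (bil (g.coeff x) (z + t • (z' - z)) (z' - z) (z' - z)) := fun t ht =>
    g.len_vel_symm_comp (c := fun t : ℝ => z + t • (z' - z)) (hsub (hmem t ht)) (hd t)
  rw [e0, e1] at h1
  have h2 : g.dist ((extChartAt (𝓡 2) x).symm z) ((extChartAt (𝓡 2) x).symm z')
      ≤ ENNReal.ofReal ((1 + ε) * Real.sqrt (bil (g.coeff x) y (z' - z) (z' - z))) := by
    refine h1.trans ?_
    calc _ ≤ ∫⁻ t in Icc (0 : ℝ) 1,
        ENNReal.ofReal ((1 + ε) * Real.sqrt (bil (g.coeff x) y (z' - z) (z' - z))) := by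
          refine setLIntegral_mono_ae' measurableSet_Icc (Eventually.of_forall fun t ht => ?_)
          apply ENNReal.ofReal_le_ofReal
          exact (h4 t ht).le.trans (hle _ (hmem t ht) _).1
      _ = _ := by simp
  exact ENNReal.toReal_le_of_le_ofReal (by positivity) h2

/-- Calibration by a linear function: with `w = z' - z`, the function dual to `w` has differential
of norm at most `(1 + ε)|w|`, and it grows by `|w|²` from `z` to `z'`. Every short path thus has
length at least `|w| / (1 + ε)`. -/
lemma exists_le_chartDist [RegularSpace M] (x : M) {y : Plane}
    (hy : y ∈ (extChartAt (𝓡 2) x).target) {ε : ℝ}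
    (hε : 0 < ε) : ∃ δ > 0, ∀ z ∈ Metric.ball y δ, ∀ z' ∈ Metric.ball y δ,
      Real.sqrt (bil (g.coeff x) y (z' - z) (z' - z)) ≤ (1 + ε) * g.chartDist x z z' := by
  have hG := g.isMetricOn_coeff x
  obtain ⟨δ, hδ, hsub, hle⟩ := hG.exists_ball_sqrt_le hy hε
  set φ := extChartAt (𝓡 2) x with hφ
  set W : Set M := φ.source ∩ φ ⁻¹' Metric.ball y δ with hW
  have hWo : IsOpen W := (continuousOn_extChartAt x).isOpen_inter_preimage
    (isOpen_extChartAt_source x) Metric.isOpen_ball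
  have hyW : φ.symm y ∈ W :=
    ⟨φ.map_target hy, by rw [mem_preimage, φ.right_inv hy]; exact Metric.mem_ball_self hδ⟩
  obtain ⟨c, hc, hcW⟩ := g.exists_dist_lt_subset (hWo.mem_nhds hyW)
  have hc2 : (0 : ℝ≥0∞) < c / 2 := ENNReal.half_pos hc.ne'
  -- points of a small ball are close to the centre
  have hnear : ∀ᶠ z in 𝓝 y, z ∈ φ.target ∧ g.dist (φ.symm y) (φ.symm z) < c / 2 / 2 := by
    have h1 := (contMDiffAt_symm (M := M) hy).continuousAt
    exact Filter.Eventually.and (show ∀ᶠ z in 𝓝 y, z ∈ φ.target from (isOpen_target x).mem_nhds hy)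
      (h1.eventually (g.eventually_dist_lt (φ.symm y) (ENNReal.half_pos hc2.ne')))
  obtain ⟨δ', hδ', hball⟩ := Metric.eventually_nhds_iff_ball.1 hnear
  refine ⟨δ', hδ', fun z hz z' hz' => ?_⟩
  obtain ⟨hzt, hz2⟩ := hball z hz
  obtain ⟨hzt', hz2'⟩ := hball z' hz'
  set w := z' - z with hw
  have hlt : g.dist (φ.symm z) (φ.symm z') < c / 2 := by
    refine lt_of_le_of_lt (g.dist_triangle _ (φ.symm y) _) ?_
    rw [g.dist_comm (φ.symm z)]
    exact (ENNReal.add_lt_add hz2 hz2').trans_eq (ENNReal.add_halves _)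
  have hB0 := hG.bil_nonneg hy w
  set L := (1 + ε) * Real.sqrt (bil (g.coeff x) y w w) with hL
  have hL0 : 0 ≤ L := by positivity
  -- the linear function dual to `w`
  set F : M → ℝ := fun p => bil (g.coeff x) y w (φ p) with hF
  have hφs : ContMDiffOn (𝓡 2) 𝓘(ℝ, Plane) 1 φ φ.source := by
    rw [extChartAt_source]; exact contMDiffOn_extChartAt
  have hFs : ContMDiffOn (𝓡 2) 𝓘(ℝ, ℝ) 1 F W :=
    (bil (g.coeff x) y w).contMDiff.comp_contMDiffOn (hφs.mono inter_subset_left)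
  have hFd : ∀ p ∈ W, ∀ v : TangentSpace (𝓡 2) p, |dfun F p v| ≤ L * g.len v := by
    intro p hp v
    have h1 : HasMFDerivAt (𝓡 2) 𝓘(ℝ, Plane) φ p (mfderiv (𝓡 2) 𝓘(ℝ, Plane) φ p) :=
      (mdifferentiableAt_extChartAt (by simpa [hφ] using hp.1)).hasMFDerivAt
    have h2 := (bil (g.coeff x) y w).hasMFDerivAt.comp p h1
    have h3 : dfun F p v = bil (g.coeff x) y w (mfderiv (𝓡 2) 𝓘(ℝ, Plane) φ p v) :=
      DFunLike.congr_fun h2.mfderiv v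
    rw [h3, g.len_eq_of_mem_source hp.1]
    refine (hG.abs_bil_le hy _ _).trans ?_
    rw [hL, mul_comm (1 + ε), mul_assoc]
    exact mul_le_mul_of_nonneg_left (hle _ hp.2 _).2 (Real.sqrt_nonneg _)
  -- A path shorter than `c / 2` starting near the centre cannot leave `W`, where the bound on the
  -- differential holds.
  have key : ∀ r, g.dist (φ.symm z) (φ.symm z') < r → r ≤ c / 2 →
      ENNReal.ofReal (bil (g.coeff x) y w w) ≤ ENNReal.ofReal L * r := by
    intro r hr hrc
    obtain ⟨γ, h0, h1, hs, hl⟩ := g.exists_path hr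
    have hγW : ∀ t ∈ Icc (0 : ℝ) 1, γ t ∈ W := by
      intro t ht
      apply hcW
      have e1 := g.dist_le_lintegral ht.1 (hs.contMDiffOn (s := Icc 0 t))
      have e2 : g.dist (γ 0) (γ t) < c / 2 :=
        lt_of_le_of_lt e1 (lt_of_le_of_lt (lintegral_mono_set (Icc_subset_Icc le_rfl ht.2))
          (hl.trans_le hrc))
      have e3 := g.dist_triangle (φ.symm y) (γ 0) (γ t)
      rw [h0] at e3 e2
      refine lt_of_le_of_lt e3 ?_
      exact (ENNReal.add_lt_add (hz2.trans_le ENNReal.half_le_self) e2).trans_eq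
        (ENNReal.add_halves _)
    have h2 := g.ofReal_abs_sub_le hWo hFs hL0 hFd hs hγW
    have h3 : F (γ 1) - F (γ 0) = bil (g.coeff x) y w w := by
      simp only [hF, h0, h1, φ.right_inv hzt, φ.right_inv hzt', ← map_sub, ← hw]
    rw [h3, abs_of_nonneg hB0] at h2
    exact h2.trans (mul_le_mul_right hl.le _)
  have key2 : ENNReal.ofReal (bil (g.coeff x) y w w)
      ≤ ENNReal.ofReal L * g.dist (φ.symm z) (φ.symm z') := by
    have hev : ∀ᶠ r in 𝓝[>] (g.dist (φ.symm z) (φ.symm z')),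
        ENNReal.ofReal (bil (g.coeff x) y w w) ≤ ENNReal.ofReal L * r := by
      filter_upwards [self_mem_nhdsWithin, mem_nhdsWithin_of_mem_nhds (Iio_mem_nhds hlt)] with r h1 h2
        using key r h1 (le_of_lt h2)
    have ht : Tendsto (fun r => ENNReal.ofReal L * r) (𝓝[>] (g.dist (φ.symm z) (φ.symm z')))
        (𝓝 (ENNReal.ofReal L * g.dist (φ.symm z) (φ.symm z'))) :=
      (ENNReal.Tendsto.const_mul tendsto_id (Or.inr ENNReal.ofReal_ne_top)).mono_left
        nhdsWithin_le_nhds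
    have : (𝓝[>] (g.dist (φ.symm z) (φ.symm z'))).NeBot :=
      nhdsGT_neBot_of_exists_gt ⟨_, hlt⟩
    exact ge_of_tendsto ht hev
  rw [← g.ofReal_rdist, ← ENNReal.ofReal_mul hL0] at key2
  have key3 := (ENNReal.ofReal_le_ofReal_iff (mul_nonneg hL0 (g.rdist_nonneg _ _))).1 key2
  by_cases hs : Real.sqrt (bil (g.coeff x) y w w) = 0
  · rw [hs]; exact mul_nonneg (by positivity) (g.rdist_nonneg _ _)
  · have hs' : 0 < Real.sqrt (bil (g.coeff x) y w w) :=
      lt_of_le_of_ne (Real.sqrt_nonneg _) (Ne.symm hs)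
    have hsq := Real.mul_self_sqrt hB0
    apply le_of_mul_le_mul_left _ hs'
    rw [hsq]
    refine key3.trans_eq ?_
    rw [hL, chartDist]; ring

end SurfaceMetric

/-! ### Distances infinitesimally given by a metric, and energy -/

namespace LocalGeom

/-- `D` is a distance on the open set `U` which is infinitesimally given by the metric `G`. -/
structure IsLocalDist (G : Plane → Matrix (Fin 2) (Fin 2) ℝ) (U : Set Plane)
    (D : Plane → Plane → ℝ) : Prop where
  metric : IsMetricOn G U
  comm : ∀ y z, D y z = D z y
  triangle : ∀ x y z, D x z ≤ D x y + D y z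
  exists_le : ∀ y ∈ U, ∀ ε > 0, ∃ δ > 0, ∀ z ∈ Metric.ball y δ, ∀ z' ∈ Metric.ball y δ,
    D z z' ≤ (1 + ε) * Real.sqrt (bil G y (z' - z) (z' - z))
  exists_ge : ∀ y ∈ U, ∀ ε > 0, ∃ δ > 0, ∀ z ∈ Metric.ball y δ, ∀ z' ∈ Metric.ball y δ,
    Real.sqrt (bil G y (z' - z) (z' - z)) ≤ (1 + ε) * D z z'
  exists_bound : ∃ C : ℝ, 0 < C ∧ ∀ z ∈ U, ∀ z' ∈ U, D z z' ≤ C * ‖z' - z‖ ∧ ‖z' - z‖ ≤ C * D z z'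

namespace IsLocalDist

variable {G : Plane → Matrix (Fin 2) (Fin 2) ℝ} {U : Set Plane} {D : Plane → Plane → ℝ}
  (hD : IsLocalDist G U D)
include hD

lemma self_le {z : Plane} (hz : z ∈ U) : D z z ≤ 0 := by
  obtain ⟨C, -, hC⟩ := hD.exists_bound
  simpa using (hC z hz z hz).1

lemma abs_sub_le (x y z : Plane) : |D x z - D x y| ≤ D y z := by
  rw [abs_le]
  have h1 := hD.triangle x y z
  have h2 := hD.triangle x z y
  rw [hD.comm z y] at h2
  constructor <;> linarith

/-- The metric derivative of a differentiable curve is its speed: both infinitesimal comparisons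
squeeze the quotient against the norm of the difference quotient of `c`. -/
lemma tendsto_div {c : ℝ → Plane} {v : Plane} {t : ℝ} (hc : HasDerivAt c v t) (ht : c t ∈ U) :
    Tendsto (fun s => D (c t) (c s) / (s - t)) (𝓝[>] t)
      (𝓝 (Real.sqrt (bil G (c t) v v))) := by
  set r : ℝ → ℝ := fun s => Real.sqrt (bil G (c t) (slope c t s) (slope c t s)) with hr
  have hcont : Continuous fun w : Plane => Real.sqrt (bil G (c t) w w) := by fun_prop
  have hslope : Tendsto (slope c t) (𝓝[>] t) (𝓝 v) :=
    (hasDerivAt_iff_tendsto_slope.1 hc).mono_left (nhdsWithin_mono _ fun s hs => ne_of_gt hs)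
  have hrt : Tendsto r (𝓝[>] t) (𝓝 (Real.sqrt (bil G (c t) v v))) :=
    (hcont.tendsto v).comp hslope
  set L := Real.sqrt (bil G (c t) v v) with hL
  have hL0 : 0 ≤ L := Real.sqrt_nonneg _
  have hdiff : Tendsto (fun s => D (c t) (c s) / (s - t) - r s) (𝓝[>] t) (𝓝 0) := by
    rw [Metric.tendsto_nhds]
    intro η hη
    set ε := min 1 (η / (4 * (L + 1))) with hε
    have hε0 : 0 < ε := lt_min one_pos (by positivity)
    have hε1 : ε ≤ 1 := min_le_left _ _
    have hε2 : ε * (4 * (L + 1)) ≤ η := (le_div_iff₀ (by positivity)).1 (min_le_right _ _)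
    obtain ⟨δ₁, hδ₁, h₁⟩ := hD.exists_le _ ht ε hε0
    obtain ⟨δ₂, hδ₂, h₂⟩ := hD.exists_ge _ ht ε hε0
    have hnear : ∀ᶠ s in 𝓝[>] t, c s ∈ Metric.ball (c t) (min δ₁ δ₂) :=
      (hc.continuousAt.eventually (Metric.ball_mem_nhds _ (lt_min hδ₁ hδ₂))).filter_mono
        nhdsWithin_le_nhds
    filter_upwards [hnear, hrt.eventually (gt_mem_nhds (lt_add_one L)), self_mem_nhdsWithin]
      with s hs hs1 hst
    have hpos : 0 < s - t := sub_pos.2 hst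
    have hrs : Real.sqrt (bil G (c t) (c s - c t) (c s - c t)) / (s - t) = r s := by
      rw [hr]
      simp only [slope, vsub_eq_sub, map_smul, smul_apply, smul_eq_mul]
      rw [← mul_assoc, Real.sqrt_mul (by positivity), Real.sqrt_mul_self (by positivity)]
      field_simp
    have a1 := h₁ _ (Metric.mem_ball_self hδ₁) _ (Metric.ball_subset_ball (min_le_left _ _) hs)
    have a2 := h₂ _ (Metric.mem_ball_self hδ₂) _ (Metric.ball_subset_ball (min_le_right _ _) hs)
    have b1 : D (c t) (c s) / (s - t) ≤ (1 + ε) * r s := by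
      rw [← hrs, ← mul_div_assoc]
      exact div_le_div_of_nonneg_right a1 hpos.le
    have b2 : r s ≤ (1 + ε) * (D (c t) (c s) / (s - t)) := by
      rw [← hrs, ← mul_div_assoc]
      exact div_le_div_of_nonneg_right a2 hpos.le
    have hr0 : 0 ≤ r s := Real.sqrt_nonneg _
    set q := D (c t) (c s) / (s - t)
    rw [dist_zero_right, Real.norm_eq_abs, abs_lt]
    constructor <;> nlinarith
  simpa using hdiff.add hrt

lemma comp_lipschitz {c : ℝ → Plane} {K : NNReal} (hc : LipschitzWith K c) (hU : ∀ t, c t ∈ U)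
    (z : Plane) : ∃ K', LipschitzWith K' fun t => D z (c t) := by
  obtain ⟨C, hC0, hC⟩ := hD.exists_bound
  refine ⟨Real.toNNReal (C * K), LipschitzWith.of_dist_le_mul fun s t => ?_⟩
  rw [Real.coe_toNNReal _ (by positivity), Real.dist_eq]
  refine (hD.abs_sub_le z (c t) (c s)).trans ((hC _ (hU t) _ (hU s)).1.trans ?_)
  rw [mul_assoc, ← dist_eq_norm]
  exact mul_le_mul_of_nonneg_left (hc.dist_le_mul s t) hC0.le

omit hD in
lemma _root_.LipschitzWith.integral_deriv_eq {f : ℝ → ℝ} {K : NNReal} (hf : LipschitzWith K f)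
    (a b : ℝ) : ∫ t in a..b, deriv f t = f b - f a :=
  hf.lipschitzOnWith.absolutelyContinuousOnInterval.integral_deriv_eq_sub

end IsLocalDist

lemma _root_.MeasureTheory.StronglyMeasurable.bilin {T : ℝ → Plane →L[ℝ] Plane →L[ℝ] ℝ}
    {v w : ℝ → Plane} (hT : StronglyMeasurable T) (hv : StronglyMeasurable v)
    (hw : StronglyMeasurable w) : StronglyMeasurable fun t => T t (v t) (w t) := by
  have hcont : Continuous fun p : (Plane →L[ℝ] Plane →L[ℝ] ℝ) × Plane × Plane =>
      p.1 p.2.1 p.2.2 := by fun_prop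
  exact hcont.comp_stronglyMeasurable (hT.prodMk (hv.prodMk hw))

section Energy

variable {G : Plane → Matrix (Fin 2) (Fin 2) ℝ} {U : Set Plane} (hG : IsMetricOn G U)
include hG

lemma IsMetricOn.continuous_bil_comp {X : Type*} [TopologicalSpace X] {c : X → Plane}
    (hc : Continuous c) (hU : ∀ t, c t ∈ U) : Continuous fun t => bil G (c t) :=
  hG.contDiffOn_bil.continuousOn.comp_continuous hc hU

lemma IsMetricOn.continuous_fderiv_bil_comp {X : Type*} [TopologicalSpace X] {c : X → Plane}
    (hc : Continuous c) (hU : ∀ t, c t ∈ U) : Continuous fun t => fderiv ℝ (bil G) (c t) :=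
  (hG.contDiffOn_bil.continuousOn_fderiv_of_isOpen hG.isOpen (by simp)).comp_continuous hc hU

end Energy

lemma _root_.LipschitzWith.norm_deriv_le {c : ℝ → Plane} {K : NNReal} (hc : LipschitzWith K c)
    (t : ℝ) : ‖deriv c t‖ ≤ K := norm_deriv_le_of_lipschitz hc

lemma intervalIntegrable_of_bounded {f : ℝ → ℝ} {a b C : ℝ} (hf : StronglyMeasurable f)
    (hC : ∀ t ∈ Set.uIcc a b, |f t| ≤ C) : IntervalIntegrable f volume a b := by
  have h0 : IntervalIntegrable (fun _ : ℝ => C) volume a b := intervalIntegrable_const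
  refine h0.mono_fun hf.aestronglyMeasurable ?_
  rw [Filter.EventuallyLE, ae_restrict_iff' measurableSet_uIoc]
  refine Eventually.of_forall fun t ht => ?_
  rw [Real.norm_eq_abs]
  exact (hC t (Set.uIoc_subset_uIcc ht)).trans (le_abs_self C)

namespace IsLocalDist

variable {G : Plane → Matrix (Fin 2) (Fin 2) ℝ} {U : Set Plane} {D : Plane → Plane → ℝ}
  (hD : IsLocalDist G U D)
include hD

lemma intervalIntegrable_energy {c : ℝ → Plane} {K : NNReal} (hc : LipschitzWith K c)
    (hU : ∀ t, c t ∈ U) (a b : ℝ) :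
    IntervalIntegrable (fun t => bil G (c t) (deriv c t) (deriv c t)) volume a b := by
  obtain ⟨C, hC⟩ := isCompact_uIcc.exists_bound_of_continuousOn
    (hD.metric.continuous_bil_comp hc.continuous hU).continuousOn (s := Set.uIcc a b)
  refine intervalIntegrable_of_bounded (C := C * K * K)
    ((hD.metric.continuous_bil_comp hc.continuous hU).stronglyMeasurable.bilin
      (stronglyMeasurable_deriv c) (stronglyMeasurable_deriv c)) fun t ht => ?_
  rw [← Real.norm_eq_abs]
  refine ((bil G (c t)).le_opNorm₂ _ _).trans ?_
  have h1 := hc.norm_deriv_le t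
  have h2 := hC t ht
  have : 0 ≤ C := (norm_nonneg _).trans h2
  gcongr

/-- Almost everywhere the derivative of the distance from `c a` is at most the speed, and `speed ≤
(speed² + 1)/2`. Energy is preferred to length because it is smooth in the velocity, and nothing is
lost at unit speed. -/
lemma le_energy {c : ℝ → Plane} {K : NNReal} (hc : LipschitzWith K c) (hU : ∀ t, c t ∈ U)
    {a b : ℝ} (hab : a ≤ b) :
    D (c a) (c b) ≤ 1 / 2 * ((∫ t in a..b, bil G (c t) (deriv c t) (deriv c t)) + (b - a)) := by
  obtain ⟨K', hF⟩ := hD.comp_lipschitz hc hU (c a)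
  have h1 := hF.integral_deriv_eq a b
  have h2 : D (c a) (c b) ≤ ∫ t in a..b, deriv (fun t => D (c a) (c t)) t := by
    rw [h1]; linarith [hD.self_le (hU a)]
  have hint := hD.intervalIntegrable_energy hc hU a b
  have h3 : ∫ t in a..b, deriv (fun t => D (c a) (c t)) t
      ≤ ∫ t in a..b, 1 / 2 * (bil G (c t) (deriv c t) (deriv c t) + 1) := by
    refine intervalIntegral.integral_mono_ae hab ?_ ?_ ?_
    · exact (hF.lipschitzOnWith.absolutelyContinuousOnInterval).intervalIntegrable_deriv
    · exact (hint.add intervalIntegrable_const).const_mul _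
    · filter_upwards [hF.ae_differentiableAt_real, hc.ae_differentiableAt_real] with t hd1 hd2
      have e1 := hD.tendsto_div hd2.hasDerivAt (hU t)
      have e2 : Tendsto (slope (fun t => D (c a) (c t)) t) (𝓝[>] t)
          (𝓝 (deriv (fun t => D (c a) (c t)) t)) :=
        (hasDerivAt_iff_tendsto_slope.1 hd1.hasDerivAt).mono_left
          (nhdsWithin_mono _ fun s hs => ne_of_gt hs)
      have e3 : deriv (fun t => D (c a) (c t)) t ≤ Real.sqrt (bil G (c t) (deriv c t) (deriv c t)) := by
        refine le_of_tendsto_of_tendsto e2 e1 ?_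
        filter_upwards [self_mem_nhdsWithin] with s hs
        have hs' : 0 < s - t := sub_pos.2 hs
        rw [slope_def_field]
        exact div_le_div_of_nonneg_right ((le_abs_self _).trans (hD.abs_sub_le _ _ _)) hs'.le
      have e4 := Real.sq_sqrt (hD.metric.bil_nonneg (hU t) (deriv c t))
      nlinarith [sq_nonneg (Real.sqrt (bil G (c t) (deriv c t) (deriv c t)) - 1)]
  rw [intervalIntegral.integral_const_mul, intervalIntegral.integral_add hint
    intervalIntegrable_const, intervalIntegral.integral_const] at h3
  simp only [smul_eq_mul, mul_one] at h3
  linarith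

lemma bil_deriv_eq_one {c : ℝ → Plane} {v : Plane} {a b t : ℝ} (ht : t ∈ Ioo a b) (hU : c t ∈ U)
    (hc : HasDerivAt c v t) (hgeo : ∀ s ∈ Icc a b, ∀ t ∈ Icc a b, D (c s) (c t) = |t - s|) :
    bil G (c t) v v = 1 := by
  have h1 := hD.tendsto_div hc hU
  have h2 : Tendsto (fun s => D (c t) (c s) / (s - t)) (𝓝[>] t) (𝓝 1) := by
    refine tendsto_const_nhds.congr' ?_
    filter_upwards [Ioo_mem_nhdsGT ht.2] with s hs
    have hs' : 0 < s - t := sub_pos.2 hs.1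
    rw [hgeo t ⟨ht.1.le, ht.2.le⟩ s ⟨ht.1.le.trans hs.1.le, hs.2.le⟩, abs_of_pos hs', div_self hs'.ne']
  exact Real.sqrt_eq_one.1 (tendsto_nhds_unique h1 h2)

end IsLocalDist

end LocalGeom

/-! ### First variation and regularity of minimizing curves -/

namespace LocalGeom

lemma abs_apply₃_le (T : Plane →L[ℝ] Plane →L[ℝ] Plane →L[ℝ] ℝ) (x y z : Plane) :
    |T x y z| ≤ ‖T‖ * ‖x‖ * ‖y‖ * ‖z‖ := by
  rw [← Real.norm_eq_abs]
  refine ((T x).le_opNorm₂ y z).trans ?_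
  gcongr
  exact T.le_opNorm x

lemma abs_apply₂_le (T : Plane →L[ℝ] Plane →L[ℝ] ℝ) (y z : Plane) :
    |T y z| ≤ ‖T‖ * ‖y‖ * ‖z‖ := by
  rw [← Real.norm_eq_abs]
  exact T.le_opNorm₂ y z

namespace IsLocalDist

variable {G : Plane → Matrix (Fin 2) (Fin 2) ℝ} {U : Set Plane} {D : Plane → Plane → ℝ}
  (hD : IsLocalDist G U D)
include hD

/-- The first variation of the energy of a length-minimizing curve vanishes. -/
lemma first_variation {c : ℝ → Plane} {K : NNReal} (hc : LipschitzWith K c) {S : Set Plane}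
    (hS : IsCompact S) (hSU : S ⊆ U) (hcS : ∀ t, c t ∈ S) {a b : ℝ} (hab : a < b)
    (hgeo : ∀ s ∈ Icc a b, ∀ t ∈ Icc a b, D (c s) (c t) = |t - s|)
    {θ : ℝ → ℝ} {K' : NNReal} (hθ : LipschitzWith K' θ) (ha : θ a = 0) (hb : θ b = 0) {m : ℝ}
    (hm : ∀ t, |θ t| ≤ m) (e : Plane) :
    IntervalIntegrable (fun t => θ t * fderiv ℝ (bil G) (c t) e (deriv c t) (deriv c t)
      + 2 * deriv θ t * bil G (c t) (deriv c t) e) volume a b ∧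
    ∫ t in a..b, (θ t * fderiv ℝ (bil G) (c t) e (deriv c t) (deriv c t)
      + 2 * deriv θ t * bil G (c t) (deriv c t) e) = 0 := by
  have hG := hD.metric
  -- The varied curves `c + x θ e` with `|x| ≤ r` remain in a compact neighbourhood of `S` inside
  -- `U`, where the metric and its derivative are bounded; this supplies the dominating constant.
  obtain ⟨δ, hδ, hδU⟩ := hS.exists_cthickening_subset_open hG.isOpen hSU
  have hS' : IsCompact (Metric.cthickening δ S) := hS.cthickening
  obtain ⟨C₀, hC₀⟩ := hS'.exists_bound_of_continuousOn (hG.contDiffOn_bil.continuousOn.mono hδU)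
  obtain ⟨C₁, hC₁⟩ := hS'.exists_bound_of_continuousOn
    ((hG.contDiffOn_bil.continuousOn_fderiv_of_isOpen hG.isOpen (by simp)).mono hδU)
  have hm0 : 0 ≤ m := (abs_nonneg _).trans (hm 0)
  set r : ℝ := min 1 (δ / (m * ‖e‖ + 1)) with hr
  have hr0 : 0 < r := lt_min one_pos (by positivity)
  set h : ℝ → ℝ → Plane := fun x t => c t + (x * θ t) • e with hh
  have hmem : ∀ x, |x| ≤ r → ∀ t, h x t ∈ Metric.cthickening δ S := by
    intro x hx t
    refine Metric.mem_cthickening_of_dist_le _ (c t) _ _ (hcS t) ?_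
    rw [dist_eq_norm, hh]
    simp only [add_sub_cancel_left, norm_smul, norm_mul, Real.norm_eq_abs]
    have h1 : r * (m * ‖e‖ + 1) ≤ δ := (le_div_iff₀ (by positivity)).1 (min_le_right _ _)
    calc |x| * |θ t| * ‖e‖ ≤ r * m * ‖e‖ := by gcongr; exact hm t
      _ ≤ δ := by nlinarith
  have hhL : ∀ x, ∃ K'', LipschitzWith K'' (h x) := by
    intro x
    refine ⟨K + Real.toNNReal (|x| * K' * ‖e‖), hc.add (LipschitzWith.of_dist_le_mul fun s t => ?_)⟩
    rw [dist_eq_norm, ← sub_smul, ← mul_sub, norm_smul, norm_mul, Real.norm_eq_abs]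
    have := hθ.dist_le_mul s t
    rw [dist_eq_norm] at this
    calc |x| * ‖θ s - θ t‖ * ‖e‖ ≤ |x| * (K' * dist s t) * ‖e‖ := by gcongr
      _ = _ := by rw [Real.coe_toNNReal _ (by positivity)]; ring
  set v : ℝ → ℝ → Plane := fun x t => deriv c t + (x * deriv θ t) • e with hv
  have hvm : ∀ x, StronglyMeasurable (v x) := fun x =>
    (stronglyMeasurable_deriv c).add
      (((stronglyMeasurable_deriv θ).const_mul x).smul stronglyMeasurable_const)
  have hdθ : ∀ t, |deriv θ t| ≤ K' := fun t => by
    rw [← Real.norm_eq_abs]; exact norm_deriv_le_of_lipschitz hθ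
  have hvb : ∀ x, |x| ≤ r → ∀ t, ‖v x t‖ ≤ K + K' * ‖e‖ := by
    intro x hx t
    refine (norm_add_le _ _).trans (add_le_add (hc.norm_deriv_le t) ?_)
    rw [norm_smul, norm_mul, Real.norm_eq_abs, Real.norm_eq_abs]
    have hx1 : |x| ≤ 1 := hx.trans (min_le_left _ _)
    calc |x| * |deriv θ t| * ‖e‖ ≤ 1 * K' * ‖e‖ := by gcongr; exact hdθ t
      _ = _ := by ring
  have hderiv : ∀ x, ∀ᵐ t, deriv (h x) t = v x t := by
    intro x
    filter_upwards [hθ.ae_differentiableAt_real, hc.ae_differentiableAt_real] with t h1 h2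
    exact (h2.hasDerivAt.add ((h1.hasDerivAt.const_mul x).smul_const e)).deriv
  set F : ℝ → ℝ → ℝ := fun x t => bil G (h x t) (v x t) (v x t) with hF
  set F' : ℝ → ℝ → ℝ := fun x t => fderiv ℝ (bil G) (h x t) (θ t • e) (v x t) (v x t)
    + bil G (h x t) (deriv θ t • e) (v x t) + bil G (h x t) (v x t) (deriv θ t • e) with hF'
  have hhU : ∀ x, |x| ≤ r → ∀ t, h x t ∈ U := fun x hx t => hδU (hmem x hx t)
  have hhc : ∀ x, Continuous (h x) := fun x => (hhL x).choose_spec.continuous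
  have hFm : ∀ x, |x| ≤ r → StronglyMeasurable (F x) := fun x hx =>
    (hG.continuous_bil_comp (hhc x) (hhU x hx)).stronglyMeasurable.bilin (hvm x) (hvm x)
  have h0r : |(0 : ℝ)| ≤ r := by simpa using hr0.le
  have hF'0 : ∀ t, F' 0 t = θ t * fderiv ℝ (bil G) (c t) e (deriv c t) (deriv c t)
      + 2 * deriv θ t * bil G (c t) (deriv c t) e := by
    intro t
    have h1 : h 0 t = c t := by simp [hh]
    have h2 : v 0 t = deriv c t := by simp [hv]
    simp only [hF', h1, h2, map_smul, smul_apply, smul_eq_mul]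
    rw [hG.bil_symm (hSU (hcS t)) e]
    ring
  have hball : ∀ x ∈ Metric.ball (0 : ℝ) r, |x| ≤ r := fun x hx => by
    rw [mem_ball_zero_iff, Real.norm_eq_abs] at hx; exact hx.le
  have key := intervalIntegral.hasDerivAt_integral_of_dominated_loc_of_deriv_le (μ := volume)
    (F := F) (F' := F') (x₀ := 0) (a := a) (b := b) (s := Metric.ball 0 r)
    (bound := fun _ => C₁ * (m * ‖e‖) * (K + K' * ‖e‖) * (K + K' * ‖e‖)
      + C₀ * (K' * ‖e‖) * (K + K' * ‖e‖) + C₀ * (K + K' * ‖e‖) * (K' * ‖e‖))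
    (Metric.ball_mem_nhds _ hr0) ?_ ?_ ?_ ?_ intervalIntegrable_const ?_
  · obtain ⟨k1, k2⟩ := key
    have hint : IntervalIntegrable (fun t => θ t * fderiv ℝ (bil G) (c t) e (deriv c t) (deriv c t)
      + 2 * deriv θ t * bil G (c t) (deriv c t) e) volume a b := by
      rw [show F' 0 = _ from funext hF'0] at k1; exact k1
    refine ⟨hint, ?_⟩
    simp only [hF'0] at k2
    -- At `x = 0` the speed is `1` and the energy equals `b - a`. For other `x` the end points are
    -- the same, so `le_energy` shows that the energy is at least `b - a`.
    refine IsLocalMin.hasDerivAt_eq_zero ?_ k2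
    have e0 : ∫ t in a..b, F 0 t = b - a := by
      have : ∫ t in a..b, F 0 t = ∫ t in a..b, (1 : ℝ) := by
        refine intervalIntegral.integral_congr_ae ?_
        have hne : ∀ᵐ t : ℝ, t ≠ b := by simp [ae_iff, measure_singleton]
        filter_upwards [hc.ae_differentiableAt_real, hne] with t ht htb htI
        rw [uIoc_of_le hab.le] at htI
        have := hD.bil_deriv_eq_one ⟨htI.1, lt_of_le_of_ne htI.2 htb⟩ (hSU (hcS t))
          ht.hasDerivAt hgeo
        simpa [hF, hh, hv] using this
      rw [this]; simp
    filter_upwards [Metric.ball_mem_nhds (0 : ℝ) hr0] with x hx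
    obtain ⟨K'', hK''⟩ := hhL x
    have h1 := hD.le_energy hK'' (hhU x (hball x hx)) hab.le
    have h2 : h x a = c a := by simp [hh, ha]
    have h3 : h x b = c b := by simp [hh, hb]
    rw [h2, h3, hgeo a ⟨le_rfl, hab.le⟩ b ⟨hab.le, le_rfl⟩, abs_of_pos (by linarith)] at h1
    have h4 : ∫ t in a..b, bil G (h x t) (deriv (h x) t) (deriv (h x) t) = ∫ t in a..b, F x t := by
      refine intervalIntegral.integral_congr_ae ?_
      filter_upwards [hderiv x] with t ht _
      rw [ht]
    rw [h4] at h1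
    rw [e0]
    linarith
  · filter_upwards [Metric.ball_mem_nhds (0 : ℝ) hr0] with x hx
    exact (hFm x (hball x hx)).aestronglyMeasurable
  · refine intervalIntegrable_of_bounded (C := C₀ * (K + K' * ‖e‖) * (K + K' * ‖e‖)) (hFm 0 h0r)
      fun t _ => ?_
    refine (abs_apply₂_le _ _ _).trans ?_
    have h2 := hvb 0 h0r t
    have h3 := hC₀ _ (hmem 0 h0r t)
    have : 0 ≤ C₀ := (norm_nonneg _).trans h3
    gcongr
  · have hcU : ∀ t, c t ∈ U := fun t => hSU (hcS t)
    have hb1 : StronglyMeasurable fun t => fderiv ℝ (bil G) (c t) e :=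
      ((hG.continuous_fderiv_bil_comp hc.continuous hcU).clm_apply
        continuous_const).stronglyMeasurable
    have hd := stronglyMeasurable_deriv c
    have hb2 := (hG.continuous_bil_comp hc.continuous hcU).stronglyMeasurable
    have := (hθ.continuous.stronglyMeasurable.mul (hb1.bilin hd hd)).add
      (((stronglyMeasurable_deriv θ).const_mul 2).mul
        (hb2.bilin hd (stronglyMeasurable_const (b := e))))
    have heq : F' 0 = fun t => θ t * fderiv ℝ (bil G) (c t) e (deriv c t) (deriv c t)
      + 2 * deriv θ t * bil G (c t) (deriv c t) e := funext hF'0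
    rw [heq]
    exact this.aestronglyMeasurable
  · refine Eventually.of_forall fun t _ x hx => ?_
    have hx' := hball x hx
    have h1 := hvb x hx' t
    have h2 := hC₀ _ (hmem x hx' t)
    have h3 := hC₁ _ (hmem x hx' t)
    have p0 : 0 ≤ C₀ := (norm_nonneg _).trans h2
    have p1 : 0 ≤ C₁ := (norm_nonneg _).trans h3
    have n1 : ‖θ t • e‖ ≤ m * ‖e‖ := by
      rw [norm_smul]; exact mul_le_mul_of_nonneg_right (hm t) (norm_nonneg _)
    have n2 : ‖deriv θ t • e‖ ≤ K' * ‖e‖ := by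
      rw [norm_smul]; exact mul_le_mul_of_nonneg_right (hdθ t) (norm_nonneg _)
    have q1 := abs_apply₃_le (fderiv ℝ (bil G) (h x t)) (θ t • e) (v x t) (v x t)
    have q2 := abs_apply₂_le (bil G (h x t)) (deriv θ t • e) (v x t)
    have q3 := abs_apply₂_le (bil G (h x t)) (v x t) (deriv θ t • e)
    rw [Real.norm_eq_abs]
    refine (abs_add_three _ _ _).trans (add_le_add_three (q1.trans ?_) (q2.trans ?_) (q3.trans ?_))
    all_goals gcongr
  · refine Eventually.of_forall fun t _ x hx => ?_
    have h1 : HasDerivAt (fun x => h x t) (θ t • e) x :=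
      ((((hasDerivAt_id x).mul_const (θ t)).smul_const e).const_add (c t)).congr_deriv (by simp)
    have h2 : HasDerivAt (fun x => v x t) (deriv θ t • e) x :=
      ((((hasDerivAt_id x).mul_const (deriv θ t)).smul_const e).const_add (deriv c t)).congr_deriv
        (by simp)
    exact hasDerivAt_bilin (hG.differentiableAt_bil (hhU x (hball x hx) t)) h1 h2 h2

end IsLocalDist

end LocalGeom

/-- The lemma of du Bois-Reymond. -/
lemma exists_ae_eq_const_add_integral {a b : ℝ} (hab : a < b) {g β : ℝ → ℝ} {C : ℝ}
    (hg : StronglyMeasurable g) (hβ : StronglyMeasurable β) (hgC : ∀ t, |g t| ≤ C)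
    (hβC : ∀ t, |β t| ≤ C)
    (h : ∀ (θ : ℝ → ℝ) (K : NNReal) (m : ℝ), LipschitzWith K θ → θ a = 0 → θ b = 0 →
      (∀ t, |θ t| ≤ m) → ∫ t in a..b, (θ t * g t + deriv θ t * β t) = 0) :
    ∃ m, ∀ᵐ t, t ∈ Ioc a b → β t = m + ∫ s in a..t, g s := by
  have hgi : ∀ x y, IntervalIntegrable g volume x y := fun x y =>
    LocalGeom.intervalIntegrable_of_bounded hg fun t _ => hgC t
  have hβi : ∀ x y, IntervalIntegrable β volume x y := fun x y =>
    LocalGeom.intervalIntegrable_of_bounded hβ fun t _ => hβC t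
  set A : ℝ → ℝ := fun t => ∫ s in a..t, g s with hA
  have hAc : Continuous A := intervalIntegral.continuous_primitive hgi a
  obtain ⟨CA, hCA⟩ := isCompact_Icc.exists_bound_of_continuousOn (hAc.continuousOn (s := Icc a b))
  -- The mean value of `β - A`, so that the primitive of `w = β - A - m` vanishes at both ends and
  -- is an admissible test function.
  set m := (b - a)⁻¹ * ∫ t in a..b, (β t - A t) with hm
  set w : ℝ → ℝ := fun t => β t - A t - m with hw
  have hwm : StronglyMeasurable w := (hβ.sub hAc.stronglyMeasurable).sub stronglyMeasurable_const
  have hwC : ∀ t ∈ Icc a b, |w t| ≤ C + CA + |m| := fun t ht => by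
    have h1 := hβC t
    have h2 := hCA t ht
    rw [Real.norm_eq_abs] at h2
    have := abs_sub (β t - A t) m
    have := abs_sub (β t) (A t)
    simp only [hw]; linarith
  have hwi : ∀ x ∈ Icc a b, ∀ y ∈ Icc a b, IntervalIntegrable w volume x y := fun x hx y hy =>
    LocalGeom.intervalIntegrable_of_bounded hwm fun t ht =>
      hwC t (uIcc_subset_Icc hx hy ht)
  have haI : a ∈ Icc a b := ⟨le_rfl, hab.le⟩
  have hbI : b ∈ Icc a b := ⟨hab.le, le_rfl⟩
  have hw0 : ∫ t in a..b, w t = 0 := by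
    have hne : b - a ≠ 0 := (sub_pos.2 hab).ne'
    simp only [hw]
    rw [intervalIntegral.integral_sub ((hβi _ _).sub (hAc.intervalIntegrable _ _))
      intervalIntegrable_const, intervalIntegral.integral_const, smul_eq_mul, hm]
    field_simp
    ring
  have hC0 : 0 ≤ C + CA + |m| := (abs_nonneg _).trans (hwC a haI)
  set θ : ℝ → ℝ := fun t => ∫ s in a..(projIcc a b hab.le t), w s with hθ
  have hθL : LipschitzWith (Real.toNNReal (C + CA + |m|)) θ := by
    refine LipschitzWith.of_dist_le_mul fun x y => ?_
    rw [Real.coe_toNNReal _ hC0, dist_eq_norm, hθ]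
    simp only
    rw [intervalIntegral.integral_interval_sub_left (hwi _ haI _ (projIcc a b hab.le x).2)
      (hwi _ haI _ (projIcc a b hab.le y).2)]
    have h1 := intervalIntegral.norm_integral_le_of_norm_le_const (f := w)
      (a := projIcc a b hab.le y) (b := projIcc a b hab.le x) (C := C + CA + |m|) fun t ht => by
        rw [Real.norm_eq_abs]
        exact hwC t (uIcc_subset_Icc (projIcc a b hab.le y).2 (projIcc a b hab.le x).2
          (uIoc_subset_uIcc ht))
    refine h1.trans (mul_le_mul_of_nonneg_left ?_ hC0)
    rw [Real.dist_eq]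
    exact abs_projIcc_sub_projIcc hab.le
  have hθI : ∀ t ∈ Icc a b, θ t = ∫ s in a..t, w s := fun t ht => by
    simp only [hθ, projIcc_of_mem hab.le ht]
  have hθa : θ a = 0 := by rw [hθI a haI]; simp
  have hθb : θ b = 0 := by rw [hθI b hbI, hw0]
  have hθm : ∀ t, |θ t| ≤ (C + CA + |m|) * (b - a) := by
    intro t
    have h1 := intervalIntegral.norm_integral_le_of_norm_le_const (f := w)
      (a := a) (b := projIcc a b hab.le t) (C := C + CA + |m|) fun s hs => by
        rw [Real.norm_eq_abs]
        exact hwC s (uIcc_subset_Icc haI (projIcc a b hab.le t).2 (uIoc_subset_uIcc hs))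
    refine h1.trans (mul_le_mul_of_nonneg_left ?_ hC0)
    have := (projIcc a b hab.le t).2
    rw [abs_of_nonneg (by linarith [this.1])]
    linarith [this.2]
  have hne : ∀ᵐ t : ℝ, t ≠ b := by simp [ae_iff, measure_singleton]
  have hdθ : ∀ᵐ t : ℝ, t ∈ uIoc a b → deriv θ t = w t := by
    filter_upwards [(hwi a haI b hbI).ae_hasDerivAt_integral, hne] with t ht htb htI
    rw [uIoc_of_le hab.le] at htI
    have htI' : t ∈ Ioo a b := ⟨htI.1, lt_of_le_of_ne htI.2 htb⟩
    have h1 := ht (by rw [uIcc_of_le hab.le]; exact ⟨htI.1.le, htI.2⟩) a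
      (by rw [uIcc_of_le hab.le]; exact haI)
    refine (h1.congr_of_eventuallyEq ?_).deriv
    filter_upwards [Ioo_mem_nhds htI'.1 htI'.2] with s hs using hθI s ⟨hs.1.le, hs.2.le⟩
  have hdA : ∀ᵐ t : ℝ, t ∈ uIoc a b → deriv A t = g t := by
    filter_upwards [(hgi a b).ae_hasDerivAt_integral] with t ht htI
    exact (ht (uIoc_subset_uIcc htI) a left_mem_uIcc).deriv
  have hACθ := hθL.lipschitzOnWith (s := uIcc a b) |>.absolutelyContinuousOnInterval
  have hACA : AbsolutelyContinuousOnInterval A a b :=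
    (hgi a b).absolutelyContinuousOnInterval_intervalIntegral left_mem_uIcc
  have hparts := hACθ.integral_mul_deriv_eq_deriv_mul hACA
  rw [hθa, hθb, zero_mul, zero_mul, sub_zero, zero_sub] at hparts
  have e1 : ∫ t in a..b, θ t * deriv A t = ∫ t in a..b, θ t * g t :=
    intervalIntegral.integral_congr_ae (by filter_upwards [hdA] with t ht hI; rw [ht hI])
  have e2 : ∫ t in a..b, deriv θ t * A t = ∫ t in a..b, w t * A t :=
    intervalIntegral.integral_congr_ae (by filter_upwards [hdθ] with t ht hI; rw [ht hI])
  have e3 : ∫ t in a..b, (θ t * g t + deriv θ t * β t) = ∫ t in a..b, (θ t * g t + w t * β t) :=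
    intervalIntegral.integral_congr_ae (by filter_upwards [hdθ] with t ht hI; rw [ht hI])
  have i1 : IntervalIntegrable (fun t => θ t * g t) volume a b :=
    (hgi a b).continuousOn_mul hθL.continuous.continuousOn
  have i2 : IntervalIntegrable (fun t => w t * A t) volume a b :=
    (hwi a haI b hbI).mul_continuousOn hAc.continuousOn
  have i3 : IntervalIntegrable (fun t => w t * β t) volume a b := by
    refine LocalGeom.intervalIntegrable_of_bounded (C := (C + CA + |m|) * C) (hwm.mul hβ)
      fun t ht => ?_
    rw [uIcc_of_le hab.le] at ht
    rw [abs_mul]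
    exact mul_le_mul (hwC t ht) (hβC t) (abs_nonneg _) hC0
  have h0 := h θ _ _ hθL hθa hθb hθm
  rw [e3, intervalIntegral.integral_add i1 i3, ← e1, hparts, e2] at h0
  have i4 : IntervalIntegrable (fun t => m * w t) volume a b := (hwi a haI b hbI).const_mul m
  -- Integration by parts turned the hypothesis into `∫ w (β - A) = 0`, and the constant `m`
  -- contributes nothing because `∫ w = 0`.
  have hsq : ∫ t in a..b, w t ^ 2 = 0 := by
    have e4 : ∀ t, w t ^ 2 = w t * β t - w t * A t - m * w t := fun t => by
      simp only [hw]; ring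
    simp only [e4]
    rw [intervalIntegral.integral_sub (i3.sub i2) i4, intervalIntegral.integral_sub i3 i2,
      intervalIntegral.integral_const_mul, hw0]
    linarith
  have i5 : IntervalIntegrable (fun t => w t ^ 2) volume a b := by
    have := (i3.sub i2).sub i4
    exact this.congr fun t _ => by simp only [hw]; ring
  rw [intervalIntegral.integral_eq_zero_iff_of_nonneg_ae (Eventually.of_forall fun t => sq_nonneg _)
    i5, Filter.EventuallyEq, ae_restrict_iff' (measurableSet_Ioc.union measurableSet_Ioc)] at hsq
  refine ⟨m, ?_⟩
  filter_upwards [hsq] with t ht htI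
  have := ht (Or.inl htI)
  have : w t = 0 := by simpa using this
  simp only [hw] at this
  simp only [hA] at this
  linarith

namespace LocalGeom

/-- `c` is a unit speed geodesic in `U` on the interval `[a, b]`, with velocity `V`. -/
structure IsGeodesicOn (G : Plane → Matrix (Fin 2) (Fin 2) ℝ) (U : Set Plane) (c V : ℝ → Plane)
    (a b : ℝ) : Prop where
  mem : ∀ t ∈ Icc a b, c t ∈ U
  deriv : ∀ t ∈ Icc a b, HasDerivWithinAt c (V t) (Icc a b) t
  deriv_vel : ∀ t ∈ Icc a b, HasDerivWithinAt V (-conn G (c t) (V t) (V t)) (Icc a b) t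
  unit : ∀ t ∈ Icc a b, bil G (c t) (V t) (V t) = 1

namespace IsLocalDist

variable {G : Plane → Matrix (Fin 2) (Fin 2) ℝ} {U : Set Plane} {D : Plane → Plane → ℝ}
  (hD : IsLocalDist G U D)
include hD

/-- The first variation in the fixed direction `e` is the hypothesis of the lemma of du
Bois-Reymond. The momentum is thus almost everywhere an absolutely continuous function, although
`c'` is only measurable. -/
lemma exists_momentum {c : ℝ → Plane} {K : NNReal} (hc : LipschitzWith K c) {S : Set Plane}
    (hS : IsCompact S) (hSU : S ⊆ U) (hcS : ∀ t, c t ∈ S) {a b : ℝ} (hab : a < b)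
    (hgeo : ∀ s ∈ Icc a b, ∀ t ∈ Icc a b, D (c s) (c t) = |t - s|) (e : Plane) :
    ∃ m, ∀ᵐ t, t ∈ Ioc a b → 2 * bil G (c t) (deriv c t) e
      = m + ∫ s in a..t, fderiv ℝ (bil G) (c s) e (deriv c s) (deriv c s) := by
  have hG := hD.metric
  have hcU : ∀ t, c t ∈ U := fun t => hSU (hcS t)
  obtain ⟨C₀, hC₀⟩ := hS.exists_bound_of_continuousOn (hG.contDiffOn_bil.continuousOn.mono hSU)
  obtain ⟨C₁, hC₁⟩ := hS.exists_bound_of_continuousOn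
    ((hG.contDiffOn_bil.continuousOn_fderiv_of_isOpen hG.isOpen (by simp)).mono hSU)
  have hd := stronglyMeasurable_deriv c
  have hb1 : StronglyMeasurable fun t => fderiv ℝ (bil G) (c t) e :=
    ((hG.continuous_fderiv_bil_comp hc.continuous hcU).clm_apply
      continuous_const).stronglyMeasurable
  have hb2 := (hG.continuous_bil_comp hc.continuous hcU).stronglyMeasurable
  have p0 : 0 ≤ C₀ := (norm_nonneg _).trans (hC₀ _ (hcS a))
  have p1 : 0 ≤ C₁ := (norm_nonneg _).trans (hC₁ _ (hcS a))
  refine exists_ae_eq_const_add_integral hab (C := max (C₁ * ‖e‖ * K * K) (2 * (C₀ * K * ‖e‖)))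
    (hb1.bilin hd hd) ((hb2.bilin hd (stronglyMeasurable_const (b := e))).const_mul 2)
    (fun t => ?_) (fun t => ?_) fun θ K' m hθ ha hb hm => ?_
  · refine le_trans ?_ (le_max_left _ _)
    have h1 := hc.norm_deriv_le t
    have h2 := hC₁ _ (hcS t)
    refine (abs_apply₃_le _ _ _ _).trans ?_
    gcongr
  · refine le_trans ?_ (le_max_right _ _)
    have h1 := hc.norm_deriv_le t
    have h2 := hC₀ _ (hcS t)
    rw [abs_mul, abs_two]
    refine mul_le_mul_of_nonneg_left ((abs_apply₂_le _ _ _).trans ?_) zero_le_two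
    gcongr
  · rw [← (hD.first_variation hc hS hSU hcS hab hgeo hθ ha hb hm e).2]
    exact intervalIntegral.integral_congr fun t _ => by ring

/-- A bootstrap: continuous momenta give a continuous velocity `V` equal to `c'` almost everywhere,
so `c` is `C¹`; then the integrands of the momenta are continuous, so `V` is differentiable and the
Euler-Lagrange equation holds pointwise. -/
lemma isGeodesicOn_of_lipschitz {c : ℝ → Plane} {K : NNReal} (hc : LipschitzWith K c)
    {S : Set Plane}
    (hS : IsCompact S) (hSU : S ⊆ U) (hcS : ∀ t, c t ∈ S) {a b : ℝ} (hab : a < b)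
    (hgeo : ∀ s ∈ Icc a b, ∀ t ∈ Icc a b, D (c s) (c t) = |t - s|) :
    ∃ V, IsGeodesicOn G U c V a b := by
  have hG := hD.metric
  have hcU : ∀ t, c t ∈ U := fun t => hSU (hcS t)
  choose m hm using fun i => hD.exists_momentum hc hS hSU hcS hab hgeo (bv i)
  set g : Fin 2 → ℝ → ℝ := fun i s => fderiv ℝ (bil G) (c s) (bv i) (deriv c s) (deriv c s) with hg
  have hdc := stronglyMeasurable_deriv c
  obtain ⟨C₁, hC₁⟩ := hS.exists_bound_of_continuousOn
    ((hG.contDiffOn_bil.continuousOn_fderiv_of_isOpen hG.isOpen (by simp)).mono hSU)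
  have hgi : ∀ i x y, IntervalIntegrable (g i) volume x y := by
    intro i x y
    have hb1 : StronglyMeasurable fun t => fderiv ℝ (bil G) (c t) (bv i) :=
      ((hG.continuous_fderiv_bil_comp hc.continuous hcU).clm_apply
        continuous_const).stronglyMeasurable
    refine intervalIntegrable_of_bounded (C := C₁ * ‖bv i‖ * K * K) (hb1.bilin hdc hdc) fun t _ => ?_
    have h1 := hc.norm_deriv_le t
    have h2 := hC₁ _ (hcS t)
    have p1 : 0 ≤ C₁ := (norm_nonneg _).trans h2
    refine (abs_apply₃_le _ _ _ _).trans ?_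
    gcongr
  set q : Fin 2 → ℝ → ℝ := fun i t => 1 / 2 * (m i + ∫ s in a..t, g i s) with hq
  have hqc : ∀ i, Continuous (q i) := fun i =>
    continuous_const.mul (continuous_const.add (intervalIntegral.continuous_primitive (hgi i) a))
  -- The vector dual to the covector with components the halved momenta.
  set V : ℝ → Plane := fun t => raise G (c t) (q 0 t • cf 0 + q 1 t • cf 1) with hV
  have hVq : ∀ t e, bil G (c t) (V t) e = q 0 t * e 0 + q 1 t * e 1 := by
    intro t e
    rw [hV, hG.bil_raise (hcU t)]
    simp
  have hVeq : V = fun t => ∑ k, (∑ i, (G (c t))⁻¹ k i * q i t) • bv k := by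
    funext t
    simp [hV, raise, Fin.sum_univ_two]
  have hinv : ∀ i j, Continuous fun t => (G (c t))⁻¹ i j := fun i j =>
    (hG.contDiffOn_inv i j).continuousOn.comp_continuous hc.continuous hcU
  have hVc : Continuous V := by
    rw [hVeq]
    exact continuous_finsetSum _ fun k _ =>
      (continuous_finsetSum _ fun i _ => (hinv k i).mul (hqc i)).smul continuous_const
  have hVae : ∀ᵐ t, t ∈ Ioc a b → deriv c t = V t := by
    filter_upwards [hm 0, hm 1] with t h0 h1 ht
    refine hG.eq_of_bil_eq (hcU t) fun e => ?_
    rw [hVq]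
    conv_lhs => rw [eq_sum_bv e]
    simp only [map_add, map_smul, smul_eq_mul]
    have h0' := h0 ht
    have h1' := h1 ht
    simp only [hq, hg]
    linear_combination (e 0) * (1 / 2) * h0' + (e 1) * (1 / 2) * h1'
  have hcint : ∀ t ∈ Icc a b, c t = c a + ∫ s in a..t, V s := by
    intro t ht
    ext i
    have hci : LipschitzWith (‖cf i‖₊ * K) fun t => cf i (c t) := (cf i).lipschitz.comp hc
    have h1 := hci.integral_deriv_eq a t
    have h2 : ∫ s in a..t, deriv (fun t => cf i (c t)) s = ∫ s in a..t, cf i (V s) := by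
      refine intervalIntegral.integral_congr_ae ?_
      filter_upwards [hVae, hc.ae_differentiableAt_real] with s hs1 hs2 hs
      rw [uIoc_of_le ht.1] at hs
      rw [← hs1 ⟨hs.1, hs.2.trans ht.2⟩]
      exact ((cf i).hasFDerivAt.comp_hasDerivAt s hs2.hasDerivAt).deriv
    rw [h2, (cf i).intervalIntegral_comp_comm (hVc.intervalIntegrable _ _)] at h1
    simp only [cf_apply] at h1
    simp only [PiLp.add_apply]
    linarith
  have hderiv : ∀ t ∈ Icc a b, HasDerivWithinAt c (V t) (Icc a b) t := by
    intro t ht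
    have h1 : HasDerivAt (fun t => c a + ∫ s in a..t, V s) (V t) t :=
      (intervalIntegral.integral_hasDerivAt_right (hVc.intervalIntegrable _ _)
        (hVc.stronglyMeasurableAtFilter _ _) hVc.continuousAt).const_add (c a)
    exact h1.hasDerivWithinAt.congr hcint (hcint t ht)
  have hqd : ∀ i, ∀ t ∈ Icc a b, HasDerivWithinAt (q i)
      (1 / 2 * fderiv ℝ (bil G) (c t) (bv i) (V t) (V t)) (Icc a b) t := by
    intro i t ht
    have hcont : Continuous fun s => fderiv ℝ (bil G) (c s) (bv i) (V s) (V s) :=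
      (((hG.continuous_fderiv_bil_comp hc.continuous hcU).clm_apply
        continuous_const).clm_apply hVc).clm_apply hVc
    have h1 : HasDerivAt (fun t => 1 / 2 * (m i + ∫ s in a..t,
        fderiv ℝ (bil G) (c s) (bv i) (V s) (V s)))
        (1 / 2 * fderiv ℝ (bil G) (c t) (bv i) (V t) (V t)) t :=
      ((intervalIntegral.integral_hasDerivAt_right (hcont.intervalIntegrable _ _)
        (hcont.stronglyMeasurableAtFilter _ _) hcont.continuousAt).const_add (m i)).const_mul _
    have h2 : ∀ t ∈ Icc a b, q i t = 1 / 2 * (m i + ∫ s in a..t,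
        fderiv ℝ (bil G) (c s) (bv i) (V s) (V s)) := by
      intro t ht
      simp only [hq]
      congr 2
      refine intervalIntegral.integral_congr_ae ?_
      filter_upwards [hVae] with s hs hsI
      rw [uIoc_of_le ht.1] at hsI
      simp only [hg]
      rw [hs ⟨hsI.1, hsI.2.trans ht.2⟩]
    exact h1.hasDerivWithinAt.congr h2 (h2 t ht)
  have hVd : ∀ t ∈ Icc a b, DifferentiableWithinAt ℝ V (Icc a b) t := by
    intro t ht
    rw [hVeq]
    have hi : ∀ i j, DifferentiableWithinAt ℝ (fun t => (G (c t))⁻¹ i j) (Icc a b) t := fun i j =>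
      (((hG.contDiffOn_inv i j).contDiffAt (hG.isOpen.mem_nhds (hcU t))).differentiableAt
        (by simp)).comp_differentiableWithinAt (f := c) t (hderiv t ht).differentiableWithinAt
    exact DifferentiableWithinAt.fun_sum fun k _ => (DifferentiableWithinAt.fun_sum fun i _ =>
      (hi k i).mul (hqd i t ht).differentiableWithinAt).smul_const _
  refine ⟨V, fun t _ => hcU t, hderiv, fun t ht => ?_, ?_⟩
  · have hud : UniqueDiffWithinAt ℝ (Icc a b) t := uniqueDiffOn_Icc hab t ht
    set W := derivWithin V (Icc a b) t with hW
    have hVW : HasDerivWithinAt V W (Icc a b) t := (hVd t ht).hasDerivWithinAt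
    -- By `compat` the derivative of the metric on both sides of the Euler-Lagrange equation is
    -- expressed through `conn`; the terms containing `conn V (bv i)` cancel.
    have key : ∀ i, bil G (c t) (W + conn G (c t) (V t) (V t)) (bv i) = 0 := by
      intro i
      have h1 := hasDerivWithinAt_bilin (hG.differentiableAt_bil (hcU t)) (hderiv t ht) hVW
        (hasDerivWithinAt_const t (Icc a b) (bv i))
      have h2 : (fun t => bil G (c t) (V t) (bv i)) = q i := by
        funext t
        rw [hVq]
        fin_cases i <;> simp
      rw [h2] at h1
      have h3 := hud.eq_deriv _ h1 (hqd i t ht)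
      rw [hG.compat (hcU t), hG.compat (hcU t), hG.conn_symm (hcU t) (bv i),
        hG.bil_symm (hcU t) (conn G (c t) (V t) (bv i)), map_zero] at h3
      rw [map_add, add_apply]
      linarith
    have h0 : W + conn G (c t) (V t) (V t) = 0 := hG.eq_of_bil_eq (hcU t) fun e => by
      conv_lhs => rw [eq_sum_bv e, map_add, map_smul, map_smul, key, key]
      simp
    rw [eq_neg_of_add_eq_zero_left h0] at hVW
    exact hVW
  · have hcont : Continuous fun t => bil G (c t) (V t) (V t) :=
      ((hG.continuous_bil_comp hc.continuous hcU).clm_apply hVc).clm_apply hVc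
    have hIoo : EqOn (fun t => bil G (c t) (V t) (V t)) (fun _ => 1) (Ioo a b) := fun t ht =>
      hD.bil_deriv_eq_one ht (hcU t)
        ((hderiv t ⟨ht.1.le, ht.2.le⟩).hasDerivAt (Icc_mem_nhds ht.1 ht.2)) hgeo
    have := hIoo.closure hcont continuous_const
    rw [closure_Ioo hab.ne] at this
    exact fun t ht => this ht

/-- A curve realizing the distances is a geodesic. -/
theorem exists_isGeodesicOn {c : ℝ → Plane} {a b : ℝ} (hab : a < b) (hcU : ∀ t ∈ Icc a b, c t ∈ U)
    (hgeo : ∀ s ∈ Icc a b, ∀ t ∈ Icc a b, D (c s) (c t) = |t - s|) :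
    ∃ V, IsGeodesicOn G U c V a b := by
  obtain ⟨C, hC0, hC⟩ := hD.exists_bound
  -- The curve is kept constant outside `[a, b]`; the comparison of `D` with the norm makes it
  -- globally Lipschitz.
  set c' : ℝ → Plane := fun t => c (projIcc a b hab.le t) with hc'
  have heq : ∀ t ∈ Icc a b, c' t = c t := fun t ht => by simp only [hc', projIcc_of_mem hab.le ht]
  have hL : LipschitzWith (Real.toNNReal C) c' := by
    refine LipschitzWith.of_dist_le_mul fun s t => ?_
    rw [Real.coe_toNNReal _ hC0.le, dist_eq_norm]
    have hs := (projIcc a b hab.le s).2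
    have ht := (projIcc a b hab.le t).2
    refine (hC _ (hcU _ ht) _ (hcU _ hs)).2.trans (mul_le_mul_of_nonneg_left ?_ hC0.le)
    rw [hgeo _ ht _ hs, Real.dist_eq]
    exact abs_projIcc_sub_projIcc hab.le
  have hrange : ∀ t, c' t ∈ c' '' Icc a b := fun t =>
    ⟨projIcc a b hab.le t, (projIcc a b hab.le t).2, by simp only [hc', projIcc_val]⟩
  obtain ⟨V, hV⟩ := hD.isGeodesicOn_of_lipschitz hL
    (isCompact_Icc.image hL.continuous) (by rintro _ ⟨t, ht, rfl⟩; exact heq t ht ▸ hcU t ht)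
    hrange hab (fun s hs t ht => by rw [heq s hs, heq t ht, hgeo s hs t ht])
  refine ⟨V, hcU, fun t ht => ?_, fun t ht => ?_, fun t ht => ?_⟩
  · exact (hV.deriv t ht).congr (fun s hs => (heq s hs).symm) (heq t ht).symm
  · rw [← heq t ht]; exact hV.deriv_vel t ht
  · rw [← heq t ht]; exact hV.unit t ht

end IsLocalDist

end LocalGeom

/-- A bound of the symmetric second difference by the second derivative. -/
lemma add_neg_le_of_deriv2_le {f f₁ f₂ : ℝ → ℝ} {r M : ℝ}
    (h₁ : ∀ s, |s| < r → HasDerivAt f (f₁ s) s) (h₂ : ∀ s, |s| < r → HasDerivAt f₁ (f₂ s) s)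
    (hM : ∀ s, |s| < r → f₂ s ≤ M) {τ : ℝ} (hτ : |τ| < r) :
    f τ + f (-τ) ≤ 2 * f 0 + M * τ ^ 2 := by
  wlog h0 : 0 ≤ τ generalizing τ
  · have := this (τ := -τ) (by rwa [abs_neg]) (by linarith)
    simp only [neg_neg, neg_sq] at this
    linarith
  rw [abs_of_nonneg h0] at hτ
  have hs : ∀ s ∈ Icc 0 τ, |s| < r := fun s hs => by
    rw [abs_of_nonneg hs.1]; exact hs.2.trans_lt hτ
  have hs' : ∀ s ∈ Icc 0 τ, |-s| < r := fun s h => by rw [abs_neg]; exact hs s h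
  have hneg : ∀ s : ℝ, HasDerivAt (fun s : ℝ => -s) (-1) s := fun s => hasDerivAt_neg s
  have d1 : ∀ s ∈ Icc 0 τ, HasDerivAt (fun s => f s + f (-s) - M * s ^ 2)
      (f₁ s - f₁ (-s) - 2 * M * s) s := by
    intro s h
    have e1 := (h₁ (-s) (hs' s h)).comp s (hneg s)
    have e2 := ((hasDerivAt_id s).pow 2).const_mul M
    refine (((h₁ s (hs s h)).add e1).sub e2).congr_deriv ?_
    simp; ring
  have d2 : ∀ s ∈ Icc 0 τ, HasDerivAt (fun s => f₁ s - f₁ (-s) - 2 * M * s)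
      (f₂ s + f₂ (-s) - 2 * M) s := by
    intro s h
    have e1 := (h₂ (-s) (hs' s h)).comp s (hneg s)
    have e2 := (hasDerivAt_id s).const_mul (2 * M)
    refine (((h₂ s (hs s h)).sub e1).sub e2).congr_deriv ?_
    simp
  have a2 : AntitoneOn (fun s => f₁ s - f₁ (-s) - 2 * M * s) (Icc 0 τ) := by
    refine antitoneOn_of_hasDerivWithinAt_nonpos (convex_Icc 0 τ)
      (fun s h => (d2 s h).continuousAt.continuousWithinAt)
      (fun s h => (d2 s (interior_subset h)).hasDerivWithinAt) fun s h => ?_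
    have h := interior_subset h
    linarith [hM s (hs s h), hM (-s) (hs' s h)]
  have a1 : AntitoneOn (fun s => f s + f (-s) - M * s ^ 2) (Icc 0 τ) := by
    refine antitoneOn_of_hasDerivWithinAt_nonpos (convex_Icc 0 τ)
      (fun s h => (d1 s h).continuousAt.continuousWithinAt)
      (fun s h => (d1 s (interior_subset h)).hasDerivWithinAt) fun s h => ?_
    have h := interior_subset h
    have := a2 (left_mem_Icc.2 h0) h h.1
    simpa using this
  have := a1 (left_mem_Icc.2 h0) (right_mem_Icc.2 h0) h0
  simp at this
  linarith

/-! ### Second variation of the energy in a chart -/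

namespace LocalGeom

/-- The second derivative of `B(σ)(β, β)` in terms of the derivatives of `σ` and `β`. -/
def energySnd (B : Plane → Plane →L[ℝ] Plane →L[ℝ] ℝ) (σ σ' σ'' β β' β'' : Plane) : ℝ :=
  fderiv ℝ (fderiv ℝ B) σ σ' σ' β β + fderiv ℝ B σ σ'' β β
    + 2 * (fderiv ℝ B σ σ' β' β + fderiv ℝ B σ σ' β β')
    + B σ β'' β + 2 * B σ β' β' + B σ β β''

lemma hasDerivAt_comp_of_differentiableAt {E F : Type*} [NormedAddCommGroup E] [NormedSpace ℝ E]
    [NormedAddCommGroup F] [NormedSpace ℝ F] {f : E → F} {σ : ℝ → E} {σ' : E} {t : ℝ}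
    (hf : DifferentiableAt ℝ f (σ t)) (hσ : HasDerivAt σ σ' t) :
    HasDerivAt (fun t => f (σ t)) (fderiv ℝ f (σ t) σ') t :=
  hf.hasFDerivAt.comp_hasDerivAt t hσ

lemma hasDerivAt_energy_snd {B : Plane → Plane →L[ℝ] Plane →L[ℝ] ℝ} {σ σ' β β' : ℝ → Plane}
    {σ'' β'' : Plane} {t : ℝ} (hB : DifferentiableAt ℝ B (σ t))
    (hB' : DifferentiableAt ℝ (fderiv ℝ B) (σ t)) (hσ : HasDerivAt σ (σ' t) t)
    (hσ' : HasDerivAt σ' σ'' t) (hβ : HasDerivAt β (β' t) t) (hβ' : HasDerivAt β' β'' t) :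
    HasDerivAt (fun t => fderiv ℝ B (σ t) (σ' t) (β t) (β t) + B (σ t) (β' t) (β t)
      + B (σ t) (β t) (β' t))
      (energySnd B (σ t) (σ' t) σ'' (β t) (β' t) β'') t := by
  have h0 : HasDerivAt (fun t => fderiv ℝ B (σ t)) (fderiv ℝ (fderiv ℝ B) (σ t) (σ' t)) t :=
    hasDerivAt_comp_of_differentiableAt hB' hσ
  have h1 := ((h0.clm_apply hσ').clm_apply hβ).clm_apply hβ
  have h2 := hasDerivAt_bilin hB hσ hβ' hβ
  have h3 := hasDerivAt_bilin hB hσ hβ hβ'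
  refine ((h1.add h2).add h3).congr_deriv ?_
  simp only [energySnd, add_apply]
  ring

/-- The parabola which approximates to second order the geodesic with initial velocity `ξ`. -/
def parab (G : Plane → Matrix (Fin 2) (Fin 2) ℝ) (y ξ : Plane) (τ : ℝ) : Plane :=
  y + τ • ξ + τ ^ 2 • (-(1 / 2 : ℝ)) • conn G y ξ ξ

namespace IsMetricOn

variable {G : Plane → Matrix (Fin 2) (Fin 2) ℝ} {U : Set Plane} (hG : IsMetricOn G U) {y : Plane}
include hG

lemma fderiv_conn_symm (hy : y ∈ U) (d a b : Plane) :
    fderiv ℝ (conn G) y d a b = fderiv ℝ (conn G) y d b a := by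
  have h : ∀ a b, HasDerivAt (fun t : ℝ => conn G (y + t • d) a b) (fderiv ℝ (conn G) y d a b) 0 :=
    fun a b => hasDerivAt_apply_const (hasDerivAt_apply_const
      (hasDerivAt_comp_line (hG.differentiableAt_conn hy) d) a) b
  refine (h a b).unique ((h b a).congr_of_eventuallyEq ?_)
  filter_upwards [eventually_line_mem hG.isOpen hy d] with t ht using hG.conn_symm ht a b

/-- The integrand of the second variation of the energy. -/
lemma energySnd_eq (hy : y ∈ U) (N T W : Plane) :
    energySnd (bil G) y N ((2 : ℝ) • (-(1 / 2 : ℝ)) • conn G y N N) T W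
      ((2 : ℝ) • (-(1 / 2 : ℝ)) • (fderiv ℝ (conn G) y T N N + conn G y W N + conn G y N W))
      = 2 * (bil G y (W + conn G y T N) (W + conn G y T N)
        + bil G y (curv (conn G) y N T N) T) := by
  have s1 := hG.bil_symm hy
  have s2 := hG.conn_symm hy
  -- All derivatives of the metric are expressed through `conn`. The quadratic coefficient `-(1/2)
  -- conn N N` makes the transversal curves have zero covariant acceleration, so no boundary term
  -- appears.
  simp only [energySnd, hG.snd_fderiv_bil hy, hG.compat hy, map_smul, smul_apply, smul_eq_mul,
    map_add, add_apply, curv, map_sub, sub_apply]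
  rw [s2 T N, s2 W N, hG.fderiv_conn_symm hy N N T, s2 (conn G y N N) T]
  rw [s1 (conn G y N W) T, s1 T (conn G y N (conn G y N T)),
    s1 T (fderiv ℝ (conn G) y N T N), s1 T (fderiv ℝ (conn G) y T N N),
    s1 T (conn G y T (conn G y N N)), s1 W (conn G y N T)]
  ring

end IsMetricOn

namespace IsLocalDist

variable {G : Plane → Matrix (Fin 2) (Fin 2) ℝ} {U : Set Plane} {D : Plane → Plane → ℝ}
  (hD : IsLocalDist G U D)
include hD

lemma le_energy_of_hasDerivWithinAt {x x' : ℝ → Plane} {a b : ℝ} (hab : a ≤ b)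
    (hU : ∀ t ∈ Icc a b, x t ∈ U) (hx : ∀ t ∈ Icc a b, HasDerivWithinAt x (x' t) (Icc a b) t)
    (hx' : ContinuousOn x' (Icc a b)) :
    D (x a) (x b) ≤ 1 / 2 * ((∫ t in a..b, bil G (x t) (x' t) (x' t)) + (b - a)) := by
  obtain ⟨C, hC⟩ := isCompact_Icc.exists_bound_of_continuousOn hx'
  have hC0 : 0 ≤ C := (norm_nonneg _).trans (hC a ⟨le_rfl, hab⟩)
  have hL : LipschitzWith (Real.toNNReal C) fun t => x (projIcc a b hab t) := by
    refine LipschitzWith.of_dist_le_mul fun s t => ?_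
    rw [Real.coe_toNNReal _ hC0, dist_eq_norm]
    refine ((convex_Icc a b).norm_image_sub_le_of_norm_hasDerivWithin_le hx hC
      (projIcc a b hab t).2 (projIcc a b hab s).2).trans (mul_le_mul_of_nonneg_left ?_ hC0)
    rw [Real.norm_eq_abs, Real.dist_eq]
    exact abs_projIcc_sub_projIcc hab
  have h1 := hD.le_energy hL (fun t => hU _ (projIcc a b hab t).2) hab
  have ha : projIcc a b hab a = ⟨a, left_mem_Icc.2 hab⟩ := projIcc_left hab
  have hb : projIcc a b hab b = ⟨b, right_mem_Icc.2 hab⟩ := projIcc_right hab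
  simp only [ha, hb] at h1
  refine h1.trans_eq ?_
  congr 2
  refine intervalIntegral.integral_congr_ae ?_
  have hne : ∀ᵐ t : ℝ, t ≠ b := by simp [ae_iff, measure_singleton]
  filter_upwards [hne] with t htb ht
  rw [uIoc_of_le hab] at ht
  have ht' : t ∈ Ioo a b := ⟨ht.1, lt_of_le_of_ne ht.2 htb⟩
  have htI : t ∈ Icc a b := ⟨ht.1.le, ht.2⟩
  have h2 : HasDerivAt (fun t => x (projIcc a b hab t)) (x' t) t := by
    refine ((hx t htI).hasDerivAt (Icc_mem_nhds ht'.1 ht'.2)).congr_of_eventuallyEq ?_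
    filter_upwards [Ioo_mem_nhds ht'.1 ht'.2] with s hs
    rw [projIcc_of_mem hab ⟨hs.1.le, hs.2.le⟩]
  rw [h2.deriv, projIcc_of_mem hab htI]

end IsLocalDist

namespace IsGeodesicOn

variable {G : Plane → Matrix (Fin 2) (Fin 2) ℝ} {U : Set Plane} {c V : ℝ → Plane} {a b : ℝ}
  (hc : IsGeodesicOn G U c V a b)
include hc

lemma continuousOn : ContinuousOn c (Icc a b) := fun t ht => (hc.deriv t ht).continuousWithinAt

lemma continuousOn_vel : ContinuousOn V (Icc a b) :=
  fun t ht => (hc.deriv_vel t ht).continuousWithinAt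

/-- The unit normal is parallel along a geodesic. -/
lemma hasDerivWithinAt_rot (hG : IsMetricOn G U) (hab : a < b) {t : ℝ} (ht : t ∈ Icc a b) :
    HasDerivWithinAt (fun t => rot G (c t) (V t))
      (-conn G (c t) (V t) (rot G (c t) (V t))) (Icc a b) t := by
  have hU := hc.mem t ht
  have hud : UniqueDiffWithinAt ℝ (Icc a b) t := uniqueDiffOn_Icc hab t ht
  have hGd : ∀ i j, DifferentiableWithinAt ℝ (fun t => G (c t) i j) (Icc a b) t := fun i j =>
    (((hG.smooth i j).contDiffAt (hG.isOpen.mem_nhds hU)).differentiableAt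
      (by simp)).comp_differentiableWithinAt (f := c) t (hc.deriv t ht).differentiableWithinAt
  have hVd : ∀ i, DifferentiableWithinAt ℝ (fun t => V t i) (Icc a b) t := fun i =>
    (cf i).differentiableAt.comp_differentiableWithinAt (f := V) t
      (hc.deriv_vel t ht).differentiableWithinAt
  have hdet : DifferentiableWithinAt ℝ (fun t => (Real.sqrt (G (c t)).det)⁻¹) (Icc a b) t := by
    have h1 : DifferentiableWithinAt ℝ (fun t => (G (c t)).det) (Icc a b) t := by
      simp only [Matrix.det_fin_two]
      exact ((hGd 0 0).mul (hGd 1 1)).sub ((hGd 0 1).mul (hGd 1 0))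
    exact (h1.sqrt (hG.det_pos hU).ne').inv (Real.sqrt_pos.2 (hG.det_pos hU)).ne'
  have hd : DifferentiableWithinAt ℝ (fun t => rot G (c t) (V t)) (Icc a b) t := by
    unfold rot
    exact hdet.smul ((((((hGd 0 1).mul (hVd 0)).add ((hGd 1 1).mul (hVd 1))).neg).smul_const _).add
      ((((hGd 0 0).mul (hVd 0)).add ((hGd 0 1).mul (hVd 1))).smul_const _))
  set n := rot G (c t) (V t) with hn
  set W := derivWithin (fun t => rot G (c t) (V t)) (Icc a b) t with hW
  have hnW : HasDerivWithinAt (fun t => rot G (c t) (V t)) W (Icc a b) t := hd.hasDerivWithinAt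
  have h1 := hasDerivWithinAt_bilin (hG.differentiableAt_bil hU) (hc.deriv t ht) hnW hnW
  have h2 := hasDerivWithinAt_bilin (hG.differentiableAt_bil hU) (hc.deriv t ht) hnW
    (hc.deriv_vel t ht)
  have h1' : HasDerivWithinAt (fun t => bil G (c t) (rot G (c t) (V t)) (rot G (c t) (V t))) 0
      (Icc a b) t := (hasDerivWithinAt_const t (Icc a b) (1 : ℝ)).congr
    (fun s hs => by rw [hG.bil_rot_rot (hc.mem s hs), hc.unit s hs])
    (by rw [hG.bil_rot_rot hU, hc.unit t ht])
  have h2' : HasDerivWithinAt (fun t => bil G (c t) (rot G (c t) (V t)) (V t)) 0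
      (Icc a b) t := (hasDerivWithinAt_const t (Icc a b) (0 : ℝ)).congr
    (fun s hs => hG.bil_rot_left (hc.mem s hs) _) (hG.bil_rot_left hU _)
  have e1 := hud.eq_deriv _ h1 h1'
  have e2 := hud.eq_deriv _ h2 h2'
  rw [hG.compat hU] at e1 e2
  simp only [← hn] at e1 e2
  have hnn : bil G (c t) n n = 1 := by rw [hG.bil_rot_rot hU, hc.unit t ht]
  have hnV : bil G (c t) n (V t) = 0 := hG.bil_rot_left hU _
  -- `Z` is the covariant derivative of the normal `n`. It is orthogonal to `n` since `n` has
  -- constant length, and to `V` since `n` is orthogonal to the parallel field `V`.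
  set Z := W + conn G (c t) (V t) n with hZ
  have f1 : bil G (c t) Z n = 0 := by
    rw [hZ, map_add, add_apply]
    rw [hG.bil_symm hU n (conn G (c t) (V t) n), hG.bil_symm hU n W] at e1
    linarith
  have f2 : bil G (c t) Z (V t) = 0 := by
    rw [hZ, map_add, add_apply]
    rw [map_neg] at e2
    linarith
  clear_value Z
  have hZ0 : Z = 0 := by
    have hd := hG.det_mul hU n (V t)
    rw [hnn, hnV, hc.unit t ht] at hd
    have hdet0 : n 0 * V t 1 - n 1 * V t 0 ≠ 0 := fun h => by rw [h] at hd; norm_num at hd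
    refine hG.eq_of_bil_eq hU fun e => ?_
    have he : (n 0 * V t 1 - n 1 * V t 0) • e
        = (e 0 * V t 1 - e 1 * V t 0) • n + (n 0 * e 1 - n 1 * e 0) • V t := by
      ext i; fin_cases i <;> simp <;> ring
    have := congrArg (bil G (c t) Z) he
    rw [map_add, map_smul, map_smul, map_smul, f1, f2] at this
    simp only [smul_eq_mul, mul_zero, add_zero] at this
    rw [(mul_eq_zero.1 this).resolve_left hdet0]
    simp
  rw [hZ] at hZ0
  rw [eq_neg_of_add_eq_zero_left hZ0] at hnW
  exact hnW

end IsGeodesicOn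

end LocalGeom

namespace LocalGeom

variable {G : Plane → Matrix (Fin 2) (Fin 2) ℝ} {U : Set Plane}

set_option maxHeartbeats 1000000 in
lemma IsMetricOn.continuousAt_energySnd (hG : IsMetricOn G U) {X : Type*} [TopologicalSpace X]
    {σ σ' σ'' β β' β'' : X → Plane} {x : X} (hU : σ x ∈ U) (hσ : ContinuousAt σ x)
    (hσ' : ContinuousAt σ' x) (hσ'' : ContinuousAt σ'' x) (hβ : ContinuousAt β x)
    (hβ' : ContinuousAt β' x) (hβ'' : ContinuousAt β'' x) :
    ContinuousAt (fun x => energySnd (bil G) (σ x) (σ' x) (σ'' x) (β x) (β' x) (β'' x)) x := by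
  have hB : ContDiffAt ℝ ∞ (bil G) (σ x) := hG.contDiffOn_bil.contDiffAt (hG.isOpen.mem_nhds hU)
  have hB1 : ContDiffAt ℝ ∞ (fderiv ℝ (bil G)) (σ x) := hB.fderiv_right (by simp)
  have hB2 : ContDiffAt ℝ ∞ (fderiv ℝ (fderiv ℝ (bil G))) (σ x) := hB1.fderiv_right (by simp)
  have c0 : ContinuousAt (fun x => bil G (σ x)) x := hB.continuousAt.comp hσ
  have c1 : ContinuousAt (fun x => fderiv ℝ (bil G) (σ x)) x :=
    ContinuousAt.comp (f := σ) hB1.continuousAt hσ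
  have c2 : ContinuousAt (fun x => fderiv ℝ (fderiv ℝ (bil G)) (σ x)) x :=
    ContinuousAt.comp (f := σ) hB2.continuousAt hσ
  have d1 : ContinuousAt (fun x => fderiv ℝ (bil G) (σ x) (σ' x)) x := c1.clm_apply hσ'
  have d2 : ContinuousAt (fun x => fderiv ℝ (fderiv ℝ (bil G)) (σ x) (σ' x) (σ' x)) x :=
    (c2.clm_apply hσ').clm_apply hσ'
  have t1 : ContinuousAt (fun x => fderiv ℝ (fderiv ℝ (bil G)) (σ x) (σ' x) (σ' x) (β x) (β x)) x :=
    (d2.clm_apply hβ).clm_apply hβ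
  have d3 : ContinuousAt (fun x => fderiv ℝ (bil G) (σ x) (σ'' x)) x := c1.clm_apply hσ''
  have t2 : ContinuousAt (fun x => fderiv ℝ (bil G) (σ x) (σ'' x) (β x) (β x)) x :=
    (d3.clm_apply hβ).clm_apply hβ
  have t3 : ContinuousAt (fun x => 2 * (fderiv ℝ (bil G) (σ x) (σ' x) (β' x) (β x)
      + fderiv ℝ (bil G) (σ x) (σ' x) (β x) (β' x))) x :=
    (((d1.clm_apply hβ').clm_apply hβ).add ((d1.clm_apply hβ).clm_apply hβ')).const_mul 2
  have t4 : ContinuousAt (fun x => bil G (σ x) (β'' x) (β x)) x := (c0.clm_apply hβ'').clm_apply hβ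
  have t5 : ContinuousAt (fun x => 2 * bil G (σ x) (β' x) (β' x)) x :=
    ((c0.clm_apply hβ').clm_apply hβ').const_mul 2
  have t6 : ContinuousAt (fun x => bil G (σ x) (β x) (β'' x)) x := (c0.clm_apply hβ).clm_apply hβ''
  exact ((((t1.add t2).add t3).add t4).add t5).add t6

/-- The parabola `X + τN + τ²Q`. -/
def quad (X N Q : Plane) (τ : ℝ) : Plane := X + τ • N + τ ^ 2 • Q

@[simp] lemma quad_zero (X N Q : Plane) : quad X N Q 0 = X := by simp [quad]

lemma hasDerivAt_quad (X N Q : Plane) (τ : ℝ) :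
    HasDerivAt (quad X N Q) (N + (2 * τ) • Q) τ := by
  have h1 := ((hasDerivAt_id τ).smul_const N).const_add X
  have h2 := ((hasDerivAt_id τ).pow 2).smul_const Q
  refine (h1.add h2).congr_deriv ?_
  simp

lemma hasDerivAt_line' (N Q : Plane) (τ : ℝ) :
    HasDerivAt (fun τ : ℝ => N + (2 * τ) • Q) ((2 : ℝ) • Q) τ := by
  refine ((((hasDerivAt_id τ).const_mul 2).smul_const Q).const_add N).congr_deriv ?_
  simp

lemma _root_.HasDerivWithinAt.quad {X N Q : ℝ → Plane} {X' N' Q' : Plane} {s : Set ℝ} {t : ℝ}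
    (hX : HasDerivWithinAt X X' s t) (hN : HasDerivWithinAt N N' s t)
    (hQ : HasDerivWithinAt Q Q' s t) (τ : ℝ) :
    HasDerivWithinAt (fun t => quad (X t) (N t) (Q t) τ) (quad X' N' Q' τ) s t :=
  (hX.add (hN.const_smul τ)).add (hQ.const_smul (τ ^ 2))

lemma _root_.ContinuousOn.quad {X N Q : ℝ → Plane} {s : Set ℝ}
    (hX : ContinuousOn X s) (hN : ContinuousOn N s) (hQ : ContinuousOn Q s) (τ : ℝ) :
    ContinuousOn (fun t => quad (X t) (N t) (Q t) τ) s :=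
  (hX.add (hN.const_smul τ)).add (hQ.const_smul (τ ^ 2))

lemma continuous_quad {X N Q : ℝ → Plane} {a b : ℝ} (hX : ContinuousOn X (Icc a b))
    (hN : ContinuousOn N (Icc a b)) (hQ : ContinuousOn Q (Icc a b)) :
    Continuous fun p : ℝ × Icc a b => quad (X p.2) (N p.2) (Q p.2) p.1 := by
  have r : ∀ {f : ℝ → Plane}, ContinuousOn f (Icc a b) →
      Continuous fun p : ℝ × Icc a b => f p.2 := fun hf =>
    (continuousOn_iff_continuous_domRestrict.1 hf).comp continuous_snd
  exact ((r hX).add (continuous_fst.smul (r hN))).add ((continuous_fst.pow 2).smul (r hQ))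

lemma continuous_linear {N Q : ℝ → Plane} {a b : ℝ}
    (hN : ContinuousOn N (Icc a b)) (hQ : ContinuousOn Q (Icc a b)) :
    Continuous fun p : ℝ × Icc a b => N p.2 + (2 * p.1) • Q p.2 := by
  have r : ∀ {f : ℝ → Plane}, ContinuousOn f (Icc a b) →
      Continuous fun p : ℝ × Icc a b => f p.2 := fun hf =>
    (continuousOn_iff_continuous_domRestrict.1 hf).comp continuous_snd
  exact (r hN).add ((continuous_const.mul continuous_fst).smul (r hQ))

/-- The second derivative at parameter `τ` of the energy density of the variation with
coefficients `X, N, Q` and derivatives `V, W, Q'`. -/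
def quadSnd (G : Plane → Matrix (Fin 2) (Fin 2) ℝ) (X N Q V W Q' : Plane) (τ : ℝ) : ℝ :=
  energySnd (bil G) (quad X N Q τ) (N + (2 * τ) • Q) ((2 : ℝ) • Q) (quad V W Q' τ)
    (W + (2 * τ) • Q') ((2 : ℝ) • Q')

/-- Joint continuity in `(τ, t)` near `τ = 0` is made uniform in `t` by compactness of `[a, b]`. -/
lemma IsMetricOn.eventually_quadSnd_le (hG : IsMetricOn G U) {X N Q V W Q' : ℝ → Plane} {a b : ℝ}
    (hU : ∀ t ∈ Icc a b, X t ∈ U) (hX : ContinuousOn X (Icc a b)) (hN : ContinuousOn N (Icc a b))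
    (hQ : ContinuousOn Q (Icc a b)) (hV : ContinuousOn V (Icc a b)) (hW : ContinuousOn W (Icc a b))
    (hQ' : ContinuousOn Q' (Icc a b)) {η : ℝ} (hη : 0 < η) :
    ∀ᶠ τ in 𝓝 (0 : ℝ), ∀ t ∈ Icc a b, quad (X t) (N t) (Q t) τ ∈ U ∧
      quadSnd G (X t) (N t) (Q t) (V t) (W t) (Q' t) τ
        ≤ quadSnd G (X t) (N t) (Q t) (V t) (W t) (Q' t) 0 + η := by
  have r : ∀ {f : ℝ → Plane}, ContinuousOn f (Icc a b) →
      Continuous fun p : ℝ × Icc a b => (2 : ℝ) • f p.2 := fun hf =>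
    ((continuousOn_iff_continuous_domRestrict.1 hf).comp continuous_snd).const_smul (2 : ℝ)
  have hcont : ∀ t : Icc a b, ContinuousAt (fun p : ℝ × Icc a b =>
      quadSnd G (X p.2) (N p.2) (Q p.2) (V p.2) (W p.2) (Q' p.2) p.1) (0, t) := fun t =>
    hG.continuousAt_energySnd (by simpa using hU t t.2) (continuous_quad hX hN hQ).continuousAt
      (continuous_linear hN hQ).continuousAt (r hQ).continuousAt
      (continuous_quad hV hW hQ').continuousAt (continuous_linear hW hQ').continuousAt
      (r hQ').continuousAt
  have hev : ∀ᶠ τ in 𝓝 (0 : ℝ), ∀ t : Icc a b, t ∈ (univ : Set (Icc a b)) →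
      (quad (X t) (N t) (Q t) τ ∈ U ∧ quadSnd G (X t) (N t) (Q t) (V t) (W t) (Q' t) τ
        ≤ quadSnd G (X t) (N t) (Q t) (V t) (W t) (Q' t) 0 + η) := by
    refine isCompact_univ.eventually_forall_of_forall_eventually fun t _ => ?_
    have h0 : ContinuousAt (fun p : ℝ × Icc a b => ((0 : ℝ), p.2)) (0, t) :=
      continuousAt_const.prodMk continuousAt_snd
    have hcont0 := ContinuousAt.comp (f := fun p : ℝ × Icc a b => ((0 : ℝ), p.2)) (hcont t) h0
    have h1 := (hcont t).sub hcont0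
    have h2 := h1.eventually (gt_mem_nhds (show _ < η by simpa using hη))
    have h3 : ∀ᶠ p : ℝ × Icc a b in 𝓝 (0, t), quad (X p.2) (N p.2) (Q p.2) p.1 ∈ U :=
      (continuous_quad hX hN hQ).continuousAt.preimage_mem_nhds
        (hG.isOpen.mem_nhds (by simpa using hU t t.2))
    filter_upwards [h2, h3] with p h2 h3
    exact ⟨h3, (sub_lt_iff_lt_add'.1 h2).le⟩
  filter_upwards [hev] with τ h t ht using h ⟨t, ht⟩ (mem_univ _)

lemma IsMetricOn.energy_add_neg_le (hG : IsMetricOn G U) {X N Q V W Q' : Plane} {r M : ℝ}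
    (hU : ∀ s, |s| < r → quad X N Q s ∈ U) (hM : ∀ s, |s| < r → quadSnd G X N Q V W Q' s ≤ M)
    {τ : ℝ} (hτ : |τ| < r) :
    bil G (quad X N Q τ) (quad V W Q' τ) (quad V W Q' τ)
      + bil G (quad X N Q (-τ)) (quad V W Q' (-τ)) (quad V W Q' (-τ))
      ≤ 2 * bil G X V V + M * τ ^ 2 := by
  have := add_neg_le_of_deriv2_le
    (f := fun τ => bil G (quad X N Q τ) (quad V W Q' τ) (quad V W Q' τ))
    (fun s hs => hasDerivAt_bilin (hG.differentiableAt_bil (hU s hs))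
      (hasDerivAt_quad X N Q s) (hasDerivAt_quad V W Q' s) (hasDerivAt_quad V W Q' s))
    (fun s hs => hasDerivAt_energy_snd (hG.differentiableAt_bil (hU s hs))
      (hG.differentiableAt_fderiv_bil (hU s hs)) (hasDerivAt_quad X N Q s)
      (hasDerivAt_line' N Q s) (hasDerivAt_quad V W Q' s) (hasDerivAt_line' W Q' s)) hM hτ
  simpa using this

namespace IsLocalDist

variable {D : Plane → Plane → ℝ} (hD : IsLocalDist G U D)
include hD

/-- The second variation of the energy. -/
lemma dist_add_dist_le {X N Q V W Q' : ℝ → Plane} {a b : ℝ} (hab : a < b)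
    (hU : ∀ t ∈ Icc a b, X t ∈ U) (hunit : ∀ t ∈ Icc a b, bil G (X t) (V t) (V t) = 1)
    (hX : ∀ t ∈ Icc a b, HasDerivWithinAt X (V t) (Icc a b) t)
    (hN : ∀ t ∈ Icc a b, HasDerivWithinAt N (W t) (Icc a b) t)
    (hQ : ∀ t ∈ Icc a b, HasDerivWithinAt Q (Q' t) (Icc a b) t)
    (hV : ContinuousOn V (Icc a b)) (hW : ContinuousOn W (Icc a b))
    (hQ' : ContinuousOn Q' (Icc a b)) {k : ℝ → ℝ} (hk : ContinuousOn k (Icc a b))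
    (hle : ∀ t ∈ Icc a b, quadSnd G (X t) (N t) (Q t) (V t) (W t) (Q' t) 0 ≤ 2 * k t)
    {ε : ℝ} (hε : 0 < ε) :
    ∀ᶠ τ in 𝓝 (0 : ℝ),
      D (quad (X a) (N a) (Q a) τ) (quad (X b) (N b) (Q b) τ)
      + D (quad (X a) (N a) (Q a) (-τ)) (quad (X b) (N b) (Q b) (-τ))
      ≤ 2 * (b - a) + τ ^ 2 * ((∫ t in a..b, k t) + ε) := by
  have hG := hD.metric
  have hXc : ContinuousOn X (Icc a b) := fun t ht => (hX t ht).continuousWithinAt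
  have hNc : ContinuousOn N (Icc a b) := fun t ht => (hN t ht).continuousWithinAt
  have hQc : ContinuousOn Q (Icc a b) := fun t ht => (hQ t ht).continuousWithinAt
  have hη0 : 0 < ε / (b - a) := div_pos hε (sub_pos.2 hab)
  obtain ⟨r, hr, hball⟩ := Metric.eventually_nhds_iff_ball.1
    (hG.eventually_quadSnd_le hU hXc hNc hQc hV hW hQ' hη0)
  have hball' : ∀ τ, |τ| < r → ∀ t ∈ Icc a b, _ := fun τ hτ t ht =>
    hball τ (by rwa [mem_ball_zero_iff, Real.norm_eq_abs]) t ht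
  filter_upwards [Metric.ball_mem_nhds (0 : ℝ) hr] with τ hτ
  rw [mem_ball_zero_iff, Real.norm_eq_abs] at hτ
  have hτ' : |-τ| < r := by rwa [abs_neg]
  have l : ∀ τ, |τ| < r → _ := fun τ hτ => hD.le_energy_of_hasDerivWithinAt hab.le
    (fun t ht => (hball' τ hτ t ht).1) (fun t ht => (hX t ht).quad (hN t ht) (hQ t ht) τ)
    (hV.quad hW hQ' τ)
  have l1 := l τ hτ
  have l2 := l (-τ) hτ'
  have hEi : ∀ τ, |τ| < r → IntervalIntegrable (fun t => bil G (quad (X t) (N t) (Q t) τ)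
      (quad (V t) (W t) (Q' t) τ) (quad (V t) (W t) (Q' t) τ)) volume a b := fun τ hτ =>
    (((hG.contDiffOn_bil.continuousOn.comp (hXc.quad hNc hQc τ)
      (fun t ht => (hball' τ hτ t ht).1)).clm_apply (hV.quad hW hQ' τ)).clm_apply
        (hV.quad hW hQ' τ)).intervalIntegrable_of_Icc hab.le
  have hki : IntervalIntegrable k volume a b := hk.intervalIntegrable_of_Icc hab.le
  -- Adding the parameters `τ` and `-τ` removes the first-order term, and the uniform bound on the
  -- second derivative controls the rest.
  have hpt : ∀ t ∈ Icc a b, bil G (quad (X t) (N t) (Q t) τ) (quad (V t) (W t) (Q' t) τ)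
      (quad (V t) (W t) (Q' t) τ) + bil G (quad (X t) (N t) (Q t) (-τ))
        (quad (V t) (W t) (Q' t) (-τ)) (quad (V t) (W t) (Q' t) (-τ))
      ≤ 2 + 2 * τ ^ 2 * k t + τ ^ 2 * (ε / (b - a)) := by
    intro t ht
    have h1 := hG.energy_add_neg_le (fun s hs => (hball' s hs t ht).1)
      (fun s hs => (hball' s hs t ht).2) hτ
    rw [hunit t ht] at h1
    refine h1.trans ?_
    nlinarith [mul_le_mul_of_nonneg_right (hle t ht) (sq_nonneg τ)]
  have hint := intervalIntegral.integral_mono_on hab.le ((hEi τ hτ).add (hEi (-τ) hτ'))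
      ((intervalIntegrable_const.add (hki.const_mul _)).add intervalIntegrable_const) hpt
  rw [intervalIntegral.integral_add (hEi τ hτ) (hEi (-τ) hτ'),
    intervalIntegral.integral_add (intervalIntegrable_const.add (hki.const_mul _))
    intervalIntegrable_const, intervalIntegral.integral_add intervalIntegrable_const
    (hki.const_mul _), intervalIntegral.integral_const_mul, intervalIntegral.integral_const,
    intervalIntegral.integral_const, smul_eq_mul, smul_eq_mul] at hint
  have hηab : (b - a) * (τ ^ 2 * (ε / (b - a))) = τ ^ 2 * ε := by
    field_simp [(sub_pos.2 hab).ne']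
  rw [hηab] at hint
  have hτε : 0 ≤ τ ^ 2 * ε := by positivity
  linarith

/-- The second variation of the length of a geodesic in a normal direction. -/
theorem second_variation_le {c V : ℝ → Plane} {a b : ℝ} (hc : IsGeodesicOn G U c V a b)
    (hab : a < b) {ψ ψ' κ : ℝ → ℝ} (hψ : ∀ t ∈ Icc a b, HasDerivWithinAt ψ (ψ' t) (Icc a b) t)
    (hψ' : ContinuousOn ψ' (Icc a b)) (hκ : ContinuousOn κ (Icc a b))
    (hle : ∀ t ∈ Icc a b, κ t ≤ curvature G (c t)) {ε : ℝ} (hε : 0 < ε) :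
    ∀ᶠ τ in 𝓝 (0 : ℝ),
      D (parab G (c a) (ψ a • rot G (c a) (V a)) τ) (parab G (c b) (ψ b • rot G (c b) (V b)) τ)
      + D (parab G (c a) (ψ a • rot G (c a) (V a)) (-τ))
          (parab G (c b) (ψ b • rot G (c b) (V b)) (-τ))
      ≤ 2 * (b - a) + τ ^ 2 * ((∫ t in a..b, (ψ' t ^ 2 - κ t * ψ t ^ 2)) + ε) := by
  have hG := hD.metric
  obtain ⟨n, hn⟩ : ∃ n : ℝ → Plane, n = fun t => rot G (c t) (V t) := ⟨_, rfl⟩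
  obtain ⟨N, hN⟩ : ∃ N : ℝ → Plane, N = fun t => ψ t • n t := ⟨_, rfl⟩
  obtain ⟨W, hW⟩ : ∃ W : ℝ → Plane, W = fun t => ψ' t • n t - ψ t • conn G (c t) (V t) (n t) :=
    ⟨_, rfl⟩
  obtain ⟨Q, hQ⟩ : ∃ Q : ℝ → Plane, Q = fun t => (-(1 / 2 : ℝ)) • conn G (c t) (N t) (N t) :=
    ⟨_, rfl⟩
  obtain ⟨Q', hQ'⟩ : ∃ Q' : ℝ → Plane, Q' = fun t => (-(1 / 2 : ℝ)) •
      (fderiv ℝ (conn G) (c t) (V t) (N t) (N t) + conn G (c t) (W t) (N t)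
        + conn G (c t) (N t) (W t)) := ⟨_, rfl⟩
  have hcc := hc.continuousOn
  have hVc := hc.continuousOn_vel
  have hnd : ∀ t ∈ Icc a b, HasDerivWithinAt n (-conn G (c t) (V t) (n t)) (Icc a b) t := by
    rw [hn]
    exact fun t ht => hc.hasDerivWithinAt_rot hG hab ht
  have hNd : ∀ t ∈ Icc a b, HasDerivWithinAt N (W t) (Icc a b) t := fun t ht => by
    rw [hN]
    refine ((hψ t ht).smul (hnd t ht)).congr_deriv ?_
    simp only [hW, smul_neg]
    abel
  have hQd : ∀ t ∈ Icc a b, HasDerivWithinAt Q (Q' t) (Icc a b) t := fun t ht => by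
    have h1 := hasDerivWithinAt_bilin (hG.differentiableAt_conn (hc.mem t ht)) (hc.deriv t ht)
      (hNd t ht) (hNd t ht)
    rw [hQ, hQ']
    exact h1.const_smul (-(1 / 2 : ℝ))
  have hnc : ContinuousOn n (Icc a b) := fun t ht => (hnd t ht).continuousWithinAt
  have hNc : ContinuousOn N (Icc a b) := fun t ht => (hNd t ht).continuousWithinAt
  have hψc : ContinuousOn ψ (Icc a b) := fun t ht => (hψ t ht).continuousWithinAt
  have hΓ : ContinuousOn (fun t => conn G (c t)) (Icc a b) :=
    hG.contDiffOn_conn.continuousOn.comp hcc hc.mem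
  have hΓ' : ContinuousOn (fun t => fderiv ℝ (conn G) (c t)) (Icc a b) :=
    (hG.contDiffOn_conn.continuousOn_fderiv_of_isOpen hG.isOpen (by simp)).comp hcc hc.mem
  have hWc : ContinuousOn W (Icc a b) := by
    rw [hW]
    exact (hψ'.smul hnc).sub (hψc.smul ((hΓ.clm_apply hVc).clm_apply hnc))
  have hQ'c : ContinuousOn Q' (Icc a b) := by
    rw [hQ']
    exact (((((hΓ'.clm_apply hVc).clm_apply hNc).clm_apply hNc).add
      ((hΓ.clm_apply hWc).clm_apply hNc)).add ((hΓ.clm_apply hNc).clm_apply hWc)).const_smul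
        (-(1 / 2 : ℝ))
  have hsnd : ∀ t ∈ Icc a b, quadSnd G (c t) (N t) (Q t) (V t) (W t) (Q' t) 0
      ≤ 2 * (ψ' t ^ 2 - κ t * ψ t ^ 2) := by
    intro t ht
    have hU := hc.mem t ht
    have h1 : quadSnd G (c t) (N t) (Q t) (V t) (W t) (Q' t) 0
        = 2 * (bil G (c t) (W t + conn G (c t) (V t) (N t)) (W t + conn G (c t) (V t) (N t))
        + bil G (c t) (curv (conn G) (c t) (N t) (V t) (N t)) (V t)) := by
      rw [← hG.energySnd_eq hU]
      simp [quadSnd, hQ, hQ']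
    have hnn : bil G (c t) (n t) (n t) = 1 := by rw [hn, hG.bil_rot_rot hU, hc.unit t ht]
    have hnV : bil G (c t) (n t) (V t) = 0 := by rw [hn]; exact hG.bil_rot_left hU _
    -- As `n` is parallel, the covariant derivative of `ψ n` is `ψ' n`; this gives the term `ψ'²`.
    have h2 : W t + conn G (c t) (V t) (N t) = ψ' t • n t := by
      simp only [hW, hN, map_smul, sub_add_cancel]
    rw [h1, h2, hG.bil_curv_skew hU, hG.bil_curv_eq hU, hc.unit t ht]
    simp only [hN, map_smul, smul_apply, hnn, hnV, smul_eq_mul]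
    nlinarith [mul_le_mul_of_nonneg_right (hle t ht) (sq_nonneg (ψ t))]
  have key := hD.dist_add_dist_le hab hc.mem hc.unit hc.deriv hNd hQd hVc hWc hQ'c
    (k := fun t => ψ' t ^ 2 - κ t * ψ t ^ 2) ((hψ'.pow 2).sub (hκ.mul (hψc.pow 2))) hsnd hε
  have hpar : ∀ t τ, parab G (c t) (ψ t • rot G (c t) (V t)) τ = quad (c t) (N t) (Q t) τ :=
    fun t τ => by rw [hQ, hN, hn]; rfl
  simpa only [hpar] using key

end IsLocalDist

end LocalGeom

/-- A function with vanishing second order jet is of third order. -/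
lemma eventually_norm_le_mul_sq {f f₁ : ℝ → Plane} (h₁ : ∀ᶠ s in 𝓝 (0 : ℝ), HasDerivAt f (f₁ s) s)
    (h₂ : HasDerivAt f₁ 0 0) (hf : f 0 = 0) (hf₁ : f₁ 0 = 0) {ε : ℝ} (hε : 0 < ε) :
    ∀ᶠ τ in 𝓝 (0 : ℝ), ‖f τ‖ ≤ ε * τ ^ 2 := by
  have h3 : ∀ᶠ s in 𝓝 (0 : ℝ), ‖f₁ s‖ ≤ ε * |s| := by
    have := (hasDerivAt_iff_isLittleO.1 h₂).def hε
    simpa [hf₁] using this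
  obtain ⟨r, hr, hball⟩ := Metric.eventually_nhds_iff_ball.1 (h₁.and h3)
  filter_upwards [Metric.ball_mem_nhds (0 : ℝ) hr] with τ hτ
  rw [mem_ball_zero_iff, Real.norm_eq_abs] at hτ
  have hmem : ∀ s ∈ Icc (-|τ|) |τ|, |s| ≤ |τ| ∧ s ∈ Metric.ball (0 : ℝ) r := fun s hs => by
    have : |s| ≤ |τ| := abs_le.2 hs
    exact ⟨this, by rw [mem_ball_zero_iff, Real.norm_eq_abs]; exact this.trans_lt hτ⟩
  have h4 := (convex_Icc (-|τ|) |τ|).norm_image_sub_le_of_norm_hasDerivWithin_le (f := f)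
    (f' := f₁) (C := ε * |τ|) (x := 0) (y := τ)
    (fun s hs => (hball s (hmem s hs).2).1.hasDerivWithinAt)
    (fun s hs => ((hball s (hmem s hs).2).2).trans (mul_le_mul_of_nonneg_left (hmem s hs).1 hε.le))
    ⟨by simp, by simp⟩ ⟨neg_abs_le τ, le_abs_self τ⟩
  rw [hf, sub_zero, sub_zero, Real.norm_eq_abs, mul_assoc, abs_mul_abs_self, ← sq] at h4
  exact h4

/-! ### Second-order germs of geodesics under change of chart -/

namespace LocalGeom

lemma continuous_parab (G : Plane → Matrix (Fin 2) (Fin 2) ℝ) (y ξ : Plane) :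
    Continuous (parab G y ξ) :=
  continuous_iff_continuousAt.2 fun τ => (hasDerivAt_quad y ξ _ τ).continuousAt

@[simp] lemma parab_zero (G : Plane → Matrix (Fin 2) (Fin 2) ℝ) (y ξ : Plane) :
    parab G y ξ 0 = y := by simp [parab]

@[simp] lemma parab_zero_vec (G : Plane → Matrix (Fin 2) (Fin 2) ℝ) (y : Plane) (τ : ℝ) :
    parab G y 0 τ = y := by simp [parab]

lemma parab_neg (G : Plane → Matrix (Fin 2) (Fin 2) ℝ) (y ξ : Plane) (τ : ℝ) :
    parab G y (-ξ) τ = parab G y ξ (-τ) := by simp [parab]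

/-- Local isometries preserve the germs `parab` up to second order. -/
lemma IsLocalIsometry.eventually_parab {G₁ G₂ : Plane → Matrix (Fin 2) (Fin 2) ℝ} {U₁ U₂ : Set Plane}
    {Φ : Plane → Plane} (h : IsLocalIsometry G₁ G₂ U₁ U₂ Φ) {y : Plane} (hy : y ∈ U₁) (ξ : Plane)
    {ε : ℝ} (hε : 0 < ε) : ∀ᶠ τ in 𝓝 (0 : ℝ),
      ‖Φ (parab G₁ y ξ τ) - parab G₂ (Φ y) (fderiv ℝ Φ y ξ) τ‖ ≤ ε * τ ^ 2 := by
  set Q := (-(1 / 2 : ℝ)) • conn G₁ y ξ ξ with hQ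
  set Q₂ := (-(1 / 2 : ℝ)) • conn G₂ (Φ y) (fderiv ℝ Φ y ξ) (fderiv ℝ Φ y ξ) with hQ₂
  have hmem : ∀ᶠ s in 𝓝 (0 : ℝ), quad y ξ Q s ∈ U₁ :=
    (hasDerivAt_quad y ξ Q 0).continuousAt.preimage_mem_nhds
      (h.metric₁.isOpen.mem_nhds (by simpa using hy))
  refine eventually_norm_le_mul_sq
    (f := fun τ => Φ (quad y ξ Q τ) - quad (Φ y) (fderiv ℝ Φ y ξ) Q₂ τ)
    (f₁ := fun τ => fderiv ℝ Φ (quad y ξ Q τ) (ξ + (2 * τ) • Q)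
      - (fderiv ℝ Φ y ξ + (2 * τ) • Q₂)) ?_ ?_ (by simp) (by simp) hε
  · filter_upwards [hmem] with s hs
    exact (hasDerivAt_comp_of_differentiableAt ((h.contDiffAt hs).differentiableAt (by simp))
      (hasDerivAt_quad y ξ Q s)).sub (hasDerivAt_quad _ _ _ s)
  · have h0 : quad y ξ Q 0 ∈ U₁ := by simpa using hy
    have h1 := hasDerivAt_comp_of_differentiableAt (f := fderiv ℝ Φ)
      ((h.contDiffAt_fderiv h0).differentiableAt (by simp)) (hasDerivAt_quad y ξ Q 0)
    -- The second derivatives at `0` agree by the transformation law `map_conn` of the connection.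
    refine ((h1.clm_apply (hasDerivAt_line' ξ Q 0)).sub (hasDerivAt_line' _ Q₂ 0)).congr_deriv ?_
    simp only [quad_zero, mul_zero, zero_smul, add_zero, hQ, hQ₂, map_smul, h.map_conn hy]
    module

lemma IsMetricOn.mono {G : Plane → Matrix (Fin 2) (Fin 2) ℝ} {U U' : Set Plane}
    (hG : IsMetricOn G U) (hU' : IsOpen U') (h : U' ⊆ U) : IsMetricOn G U' where
  isOpen := hU'
  smooth i j := (hG.smooth i j).mono h
  symm y hy := hG.symm y (h hy)
  pos y hy := hG.pos y (h hy)

/-- A vector orthogonal to a unit vector is a multiple of its rotation. -/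
lemma IsMetricOn.eq_smul_rot {G : Plane → Matrix (Fin 2) (Fin 2) ℝ} {U : Set Plane}
    (hG : IsMetricOn G U) {y : Plane} (hy : y ∈ U) {v ξ : Plane} (hv : bil G y v v = 1)
    (hξ : bil G y ξ v = 0) {r : ℝ} (hr : bil G y ξ ξ = r ^ 2) :
    ξ = r • rot G y v ∨ ξ = -(r • rot G y v) := by
  set n := rot G y v with hn
  have hnn : bil G y n n = 1 := by rw [hG.bil_rot_rot hy, hv]
  have hnv : bil G y n v = 0 := hG.bil_rot_left hy v
  clear_value n
  have hd := hG.det_mul hy n v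
  rw [hnn, hnv, hv] at hd
  have hdet0 : n 0 * v 1 - n 1 * v 0 ≠ 0 := fun h => by rw [h] at hd; norm_num at hd
  have hdec : ∃ α β : ℝ, ξ = α • n + β • v := by
    refine ⟨(n 0 * v 1 - n 1 * v 0)⁻¹ * (ξ 0 * v 1 - ξ 1 * v 0),
      (n 0 * v 1 - n 1 * v 0)⁻¹ * (n 0 * ξ 1 - n 1 * ξ 0), ?_⟩
    have : (n 0 * v 1 - n 1 * v 0) • ξ
        = (ξ 0 * v 1 - ξ 1 * v 0) • n + (n 0 * ξ 1 - n 1 * ξ 0) • v := by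
      ext i; fin_cases i <;> simp <;> ring
    rw [mul_smul, mul_smul, ← smul_add, ← this, smul_smul, inv_mul_cancel₀ hdet0, one_smul]
  obtain ⟨α, β, rfl⟩ := hdec
  simp only [map_add, map_smul, add_apply, smul_apply, smul_eq_mul, hnn, hnv, hv,
    hG.bil_symm hy v n] at hξ hr
  have hβ : β = 0 := by linarith
  subst hβ
  have : α ^ 2 = r ^ 2 := by linarith
  rcases sq_eq_sq_iff_eq_or_eq_neg.1 this with h | h
  · left; simp [h]
  · right; simp [h]

end LocalGeom

namespace SurfaceMetric

open LocalGeom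

variable {M : Type*} [TopologicalSpace M] [ChartedSpace Plane M] [IsManifold (𝓡 2) ∞ M]
  [ConnectedSpace M] (g : SurfaceMetric M)

/-- The two comparisons at `y` with `ε = 1`, combined with the equivalence of the metric at `y` and
the norm, make the distance bi-Lipschitz to the norm near `y`. -/
lemma exists_isLocalDist [RegularSpace M] (x : M) {y : Plane}
    (hy : y ∈ (extChartAt (𝓡 2) x).target) : ∃ r > 0,
      Metric.ball y r ⊆ (extChartAt (𝓡 2) x).target ∧
      IsLocalDist (g.coeff x) (Metric.ball y r) (g.chartDist x) := by
  have hG := g.isMetricOn_coeff x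
  obtain ⟨δ₁, hδ₁, h₁⟩ := g.exists_chartDist_le x hy one_pos
  obtain ⟨δ₂, hδ₂, h₂⟩ := g.exists_le_chartDist x hy one_pos
  obtain ⟨δ₃, hδ₃, h₃⟩ := Metric.isOpen_iff.1 hG.isOpen y hy
  obtain ⟨m, hm, hlow⟩ := hG.exists_lower hy
  refine ⟨min (min δ₁ δ₂) δ₃, lt_min (lt_min hδ₁ hδ₂) hδ₃,
    (Metric.ball_subset_ball (min_le_right _ _)).trans h₃, ?_⟩
  have hsub := (Metric.ball_subset_ball (min_le_right (min δ₁ δ₂) δ₃)).trans h₃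
  refine ⟨hG.mono Metric.isOpen_ball hsub, fun z z' => g.rdist_comm _ _,
    fun z z' z'' => g.rdist_triangle _ _ _,
    fun z hz ε hε => g.exists_chartDist_le x (hsub hz) hε,
    fun z hz ε hε => g.exists_le_chartDist x (hsub hz) hε,
    2 * Real.sqrt ‖bil (g.coeff x) y‖ + 2 * (Real.sqrt m)⁻¹, by positivity,
    fun z hz z' hz' => ⟨?_, ?_⟩⟩
  · have e1 := h₁ z (Metric.ball_subset_ball ((min_le_left _ _).trans (min_le_left _ _)) hz) z'
      (Metric.ball_subset_ball ((min_le_left _ _).trans (min_le_left _ _)) hz')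
    have e2 : Real.sqrt (bil (g.coeff x) y (z' - z) (z' - z))
        ≤ Real.sqrt ‖bil (g.coeff x) y‖ * ‖z' - z‖ := by
      rw [Real.sqrt_le_left (by positivity), mul_pow, Real.sq_sqrt (norm_nonneg _)]
      have := (le_abs_self _).trans (abs_apply₂_le (bil (g.coeff x) y) (z' - z) (z' - z))
      rwa [mul_assoc, ← sq] at this
    have e3 : 0 ≤ (Real.sqrt m)⁻¹ * ‖z' - z‖ := by positivity
    rw [add_mul]
    linarith
  · have e1 := h₂ z (Metric.ball_subset_ball ((min_le_left _ _).trans (min_le_right _ _)) hz) z'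
      (Metric.ball_subset_ball ((min_le_left _ _).trans (min_le_right _ _)) hz')
    have hsm : 0 < Real.sqrt m := Real.sqrt_pos.2 hm
    have e2 : Real.sqrt m * ‖z' - z‖ ≤ Real.sqrt (bil (g.coeff x) y (z' - z) (z' - z)) := by
      apply Real.le_sqrt_of_sq_le
      rw [mul_pow, Real.sq_sqrt hm.le]
      exact hlow _
    have e0 : 0 ≤ g.chartDist x z z' := g.rdist_nonneg _ _
    have e3 : ‖z' - z‖ ≤ (Real.sqrt m)⁻¹ * (2 * g.chartDist x z z') := by
      rw [inv_mul_eq_div, le_div_iff₀ hsm, mul_comm]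
      linarith
    have e4 : 0 ≤ 2 * Real.sqrt ‖bil (g.coeff x) y‖ * g.chartDist x z z' := by positivity
    rw [add_mul]
    linarith

/-- The germs `parab` in two charts are second order close. -/
lemma eventually_rdist_parab_le [RegularSpace M] (x x' : M) {y : Plane} (hy : y ∈ overlap x x')
    (ξ : Plane) {ε : ℝ} (hε : 0 < ε) : ∀ᶠ τ in 𝓝 (0 : ℝ),
      g.rdist ((extChartAt (𝓡 2) x).symm (parab (g.coeff x) y ξ τ))
        ((extChartAt (𝓡 2) x').symm (parab (g.coeff x') (transition x x' y)
          (fderiv ℝ (transition x x') y ξ) τ)) ≤ ε * τ ^ 2 := by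
  have hiso := g.isLocalIsometry_transition x x'
  have hy' := mapsTo_transition x x' hy
  obtain ⟨r, hr, -, hD⟩ := g.exists_isLocalDist x' hy'
  obtain ⟨C, hC0, hC⟩ := hD.exists_bound
  have h1 := hiso.eventually_parab hy ξ (div_pos hε hC0)
  have h2 : ∀ᶠ τ in 𝓝 (0 : ℝ), parab (g.coeff x) y ξ τ ∈ overlap x x' :=
    (continuous_parab _ _ _).continuousAt.preimage_mem_nhds
      ((isOpen_overlap x x').mem_nhds (by simpa using hy))
  have h3 : ∀ᶠ τ in 𝓝 (0 : ℝ), parab (g.coeff x') (transition x x' y)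
      (fderiv ℝ (transition x x') y ξ) τ ∈ Metric.ball (transition x x' y) r :=
    (continuous_parab _ _ _).continuousAt.preimage_mem_nhds
      (Metric.isOpen_ball.mem_nhds (by simpa using hr))
  have h4 : ∀ᶠ τ in 𝓝 (0 : ℝ), transition x x' (parab (g.coeff x) y ξ τ)
      ∈ Metric.ball (transition x x' y) r := by
    have : ContinuousAt (fun τ => transition x x' (parab (g.coeff x) y ξ τ)) 0 :=
      ContinuousAt.comp (g := transition x x') (f := parab (g.coeff x) y ξ) (x := 0)
        (by simpa using (hiso.contDiffAt hy).continuousAt)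
        (continuous_parab _ _ _).continuousAt
    exact this.preimage_mem_nhds (Metric.isOpen_ball.mem_nhds (by simpa using hr))
  filter_upwards [h1, h2, h3, h4] with τ h1 h2 h3 h4
  rw [← symm_transition h2]
  refine ((hC _ h4 _ h3).1).trans ?_
  rw [norm_sub_rev]
  refine (mul_le_mul_of_nonneg_left h1 hC0.le).trans_eq ?_
  field_simp

end SurfaceMetric

/-! ### The index form along a minimizing curve -/

/-- Induction along a compact interval. -/
lemma Icc_induction {P : ℝ → Prop} {ℓ : ℝ} (hℓ : 0 ≤ ℓ) (h0 : P 0)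
    (hstep : ∀ t ∈ Icc 0 ℓ, ∃ δ > 0, ∀ a ∈ Icc 0 ℓ, ∀ b ∈ Icc 0 ℓ, |a - t| < δ → |b - t| < δ →
      a < b → P a → P b) : P ℓ := by
  set S := {s | s ∈ Icc 0 ℓ ∧ P s} with hS
  have hne : S.Nonempty := ⟨0, ⟨le_rfl, hℓ⟩, h0⟩
  have hbdd : BddAbove S := ⟨ℓ, fun s hs => hs.1.2⟩
  have hσ0 : 0 ≤ sSup S := le_csSup hbdd ⟨⟨le_rfl, hℓ⟩, h0⟩
  have hσℓ : sSup S ≤ ℓ := csSup_le hne fun s hs => hs.1.2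
  -- The step is taken around the supremum, from a point of `S` just before it to `ℓ` or to a point
  -- beyond it. No closedness of `P` is needed.
  obtain ⟨δ, hδ, h⟩ := hstep _ ⟨hσ0, hσℓ⟩
  obtain ⟨a, haS, ha⟩ := exists_lt_of_lt_csSup hne (sub_lt_self (sSup S) hδ)
  have haσ := le_csSup hbdd haS
  have ha' : |a - sSup S| < δ := by rw [abs_lt]; constructor <;> linarith
  by_contra hP
  have haℓ : a < ℓ := lt_of_le_of_ne haS.1.2 fun h => hP (h ▸ haS.2)
  have hlt : a < min ℓ (sSup S + δ / 2) := lt_min haℓ (by linarith)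
  have hb : min ℓ (sSup S + δ / 2) ∈ Icc 0 ℓ := ⟨haS.1.1.trans hlt.le, min_le_left _ _⟩
  have hbσ : sSup S ≤ min ℓ (sSup S + δ / 2) := le_min hσℓ (by linarith)
  have hb2 := min_le_right ℓ (sSup S + δ / 2)
  have hPb := h a haS.1 _ hb ha' (by rw [abs_lt]; constructor <;> linarith) hlt haS.2
  have hle := le_csSup hbdd ⟨hb, hPb⟩
  rcases le_total ℓ (sSup S + δ / 2) with h1 | h1
  · rw [min_eq_left h1] at hPb
    exact hP hPb
  · rw [min_eq_right h1] at hle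
    linarith

namespace LocalGeom

lemma IsGeodesicOn.mono {G : Plane → Matrix (Fin 2) (Fin 2) ℝ} {U : Set Plane} {c V : ℝ → Plane}
    {a b a' b' : ℝ} (hc : IsGeodesicOn G U c V a b) (h : Icc a' b' ⊆ Icc a b) :
    IsGeodesicOn G U c V a' b' where
  mem t ht := hc.mem t (h ht)
  deriv t ht := (hc.deriv t (h ht)).mono h
  deriv_vel t ht := (hc.deriv_vel t (h ht)).mono h
  unit t ht := hc.unit t (h ht)

end LocalGeom

namespace SurfaceMetric

open LocalGeom

variable {M : Type*} [TopologicalSpace M] [ChartedSpace Plane M] [IsManifold (𝓡 2) ∞ M]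
  [ConnectedSpace M] [RegularSpace M] {g : SurfaceMetric M}

/-- `γ` is a curve on `[0, ℓ]` which realizes the distances between its points. -/
def IsMinimizing (g : SurfaceMetric M) (γ : ℝ → M) (ℓ : ℝ) : Prop :=
  ∀ s ∈ Icc 0 ℓ, ∀ t ∈ Icc 0 ℓ, g.rdist (γ s) (γ t) = |t - s|

namespace IsMinimizing

variable {γ : ℝ → M} {ℓ : ℝ} (hγ : g.IsMinimizing γ ℓ)
include hγ

lemma continuousOn : ContinuousOn γ (Icc 0 ℓ) := by
  intro t ht S hS
  obtain ⟨c, hc, hcS⟩ := g.exists_dist_lt_subset hS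
  have h1 : Tendsto (fun s => ENNReal.ofReal |s - t|) (𝓝 t) (𝓝 0) := by
    have : Continuous fun s : ℝ => ENNReal.ofReal |s - t| :=
      ENNReal.continuous_ofReal.comp (by fun_prop)
    simpa using this.tendsto t
  have h2 : ∀ᶠ s in 𝓝[Icc 0 ℓ] t, ENNReal.ofReal |s - t| < c :=
    (h1.eventually (gt_mem_nhds hc)).filter_mono nhdsWithin_le_nhds
  rw [mem_map]
  filter_upwards [h2, self_mem_nhdsWithin] with s hs hsI
  apply hcS
  change g.dist (γ t) (γ s) < c
  rwa [← g.ofReal_rdist, hγ t ht s hsI]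

/-- A minimizing curve is locally a geodesic in a chart. -/
lemma exists_isGeodesicOn (hℓ : 0 < ℓ) {t₀ : ℝ} (ht₀ : t₀ ∈ Icc 0 ℓ) :
    ∃ δ > 0, ∃ U V, U ⊆ (extChartAt (𝓡 2) (γ t₀)).target ∧
      IsLocalDist (g.coeff (γ t₀)) U (g.chartDist (γ t₀)) ∧
      (∀ s ∈ Icc (max 0 (t₀ - δ)) (min ℓ (t₀ + δ)), γ s ∈ (extChartAt (𝓡 2) (γ t₀)).source) ∧
      IsGeodesicOn (g.coeff (γ t₀)) U (fun s => extChartAt (𝓡 2) (γ t₀) (γ s)) V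
        (max 0 (t₀ - δ)) (min ℓ (t₀ + δ)) := by
  set φ := extChartAt (𝓡 2) (γ t₀) with hφ
  have hsrc : γ t₀ ∈ φ.source := mem_extChartAt_source _
  obtain ⟨r, hr, hsub, hD⟩ := g.exists_isLocalDist (γ t₀) (φ.map_source hsrc)
  have hev : ∀ᶠ s in 𝓝[Icc 0 ℓ] t₀, γ s ∈ φ.source ∩ φ ⁻¹' Metric.ball (φ (γ t₀)) r :=
    hγ.continuousOn t₀ ht₀ (((continuousOn_extChartAt (γ t₀)).isOpen_inter_preimage
      (isOpen_extChartAt_source (γ t₀)) Metric.isOpen_ball).mem_nhds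
        ⟨hsrc, Metric.mem_ball_self hr⟩)
  obtain ⟨δ, hδ, hball⟩ := Metric.mem_nhdsWithin_iff.1 hev
  have hsubI : Icc (max 0 (t₀ - δ / 2)) (min ℓ (t₀ + δ / 2)) ⊆ Icc 0 ℓ := fun s hs =>
    ⟨(le_max_left _ _).trans hs.1, hs.2.trans (min_le_left _ _)⟩
  have hmem : ∀ s ∈ Icc (max 0 (t₀ - δ / 2)) (min ℓ (t₀ + δ / 2)),
      γ s ∈ φ.source ∩ φ ⁻¹' Metric.ball (φ (γ t₀)) r := fun s hs => by
    refine hball ⟨?_, hsubI hs⟩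
    rw [Metric.mem_ball, Real.dist_eq, abs_lt]
    have h1 := (le_max_right _ _).trans hs.1
    have h2 := hs.2.trans (min_le_right _ _)
    constructor <;> linarith
  have hlt : max 0 (t₀ - δ / 2) < min ℓ (t₀ + δ / 2) :=
    max_lt (lt_min hℓ (by linarith [ht₀.1])) (lt_min (by linarith [ht₀.2]) (by linarith))
  obtain ⟨V, hV⟩ := hD.exists_isGeodesicOn (c := fun s => φ (γ s)) hlt (fun s hs => (hmem s hs).2)
    (fun s hs t ht => by
      rw [chartDist, ← hφ, φ.left_inv (hmem s hs).1, φ.left_inv (hmem t ht).1,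
        hγ s (hsubI hs) t (hsubI ht)])
  exact ⟨δ / 2, by positivity, _, V, hsub, hD, fun s hs => (hmem s hs).1, hV⟩

omit [IsManifold (𝓡 2) ∞ M] [ConnectedSpace M] [RegularSpace M] g hγ in
lemma _root_.Icc_max_min_mem_nhdsWithin {t₀ δ s ℓ : ℝ} (hs : |s - t₀| < δ) :
    Icc (max 0 (t₀ - δ)) (min ℓ (t₀ + δ)) ∈ 𝓝[Icc 0 ℓ] s := by
  rw [abs_lt] at hs
  filter_upwards [self_mem_nhdsWithin, mem_nhdsWithin_of_mem_nhds
    (Ioo_mem_nhds (show t₀ - δ < s by linarith) (show s < t₀ + δ by linarith))] with u hu hu'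
  exact ⟨max_le hu.1 hu'.1.le, le_min hu.2 hu'.2.le⟩

end IsMinimizing

/-- The second variation bound for the distance from `γ 0` to the endpoints of the curves close to
`γ` on `[0, s]`, whose endpoints are given by the germ `parab` with velocity `ξ`. -/
def VariationBound (g : SurfaceMetric M) (γ : ℝ → M) (s I : ℝ) (x : M) (ξ : Plane) : Prop :=
  ∀ ε > 0, ∀ᶠ τ in 𝓝 (0 : ℝ),
    g.rdist (γ 0) ((extChartAt (𝓡 2) x).symm
        (parab (g.coeff x) (extChartAt (𝓡 2) x (γ s)) ξ τ))
      + g.rdist (γ 0) ((extChartAt (𝓡 2) x).symm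
        (parab (g.coeff x) (extChartAt (𝓡 2) x (γ s)) ξ (-τ)))
      ≤ 2 * s + τ ^ 2 * (I + ε)

-- The sum over `τ` and `-τ` is insensitive to the sign of `ξ`. This matters because a change of
-- chart may reverse the orientation, and with it the normal `rot`.
omit [ConnectedSpace M] [RegularSpace M] in
lemma VariationBound.neg {γ : ℝ → M} {s I : ℝ} {x : M} {ξ : Plane}
    (h : g.VariationBound γ s I x ξ) : g.VariationBound γ s I x (-ξ) := by
  intro ε hε
  filter_upwards [h ε hε] with τ hτ
  simpa only [parab_neg, neg_neg, add_comm] using hτ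

/-- The end points move by at most `(ε/4) τ²` each when the germ is rewritten in the other chart,
and the triangle inequality absorbs this. -/
lemma VariationBound.change_chart {γ : ℝ → M} {s I : ℝ} {x x' : M} {ξ : Plane}
    (h : g.VariationBound γ s I x ξ) (hx : γ s ∈ (extChartAt (𝓡 2) x).source)
    (hx' : γ s ∈ (extChartAt (𝓡 2) x').source) :
    g.VariationBound γ s I x'
      (fderiv ℝ (transition x x') (extChartAt (𝓡 2) x (γ s)) ξ) := by
  intro ε hε
  have hy : extChartAt (𝓡 2) x (γ s) ∈ overlap x x' := by
    refine ⟨(extChartAt (𝓡 2) x).map_source hx, ?_⟩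
    rwa [mem_preimage, (extChartAt (𝓡 2) x).left_inv hx]
  have ht : transition x x' (extChartAt (𝓡 2) x (γ s)) = extChartAt (𝓡 2) x' (γ s) := by
    rw [SurfaceMetric.transition, (extChartAt (𝓡 2) x).left_inv hx]
  have h1 := g.eventually_rdist_parab_le x x' hy ξ (ε := ε / 4) (by positivity)
  rw [ht] at h1
  have hneg : Tendsto (fun τ : ℝ => -τ) (𝓝 0) (𝓝 0) := continuous_neg.tendsto' 0 0 neg_zero
  filter_upwards [h (ε / 2) (by positivity), h1, hneg.eventually h1] with τ e0 e1 e2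
  have t1 := g.rdist_triangle (γ 0) ((extChartAt (𝓡 2) x).symm
    (parab (g.coeff x) (extChartAt (𝓡 2) x (γ s)) ξ τ)) ((extChartAt (𝓡 2) x').symm
    (parab (g.coeff x') (extChartAt (𝓡 2) x' (γ s))
      (fderiv ℝ (SurfaceMetric.transition x x') (extChartAt (𝓡 2) x (γ s)) ξ) τ))
  have t2 := g.rdist_triangle (γ 0) ((extChartAt (𝓡 2) x).symm
    (parab (g.coeff x) (extChartAt (𝓡 2) x (γ s)) ξ (-τ))) ((extChartAt (𝓡 2) x').symm
    (parab (g.coeff x') (extChartAt (𝓡 2) x' (γ s))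
      (fderiv ℝ (SurfaceMetric.transition x x') (extChartAt (𝓡 2) x (γ s)) ξ) (-τ)))
  rw [neg_sq] at e2
  nlinarith

/-- `VariationBound` for some chart and for some normal vector of length `|r|`. -/
def HasVariationBound (g : SurfaceMetric M) (γ : ℝ → M) (ℓ s r I : ℝ) : Prop :=
  ∃ x ξ v, γ s ∈ (extChartAt (𝓡 2) x).source ∧
    HasDerivWithinAt (fun s => extChartAt (𝓡 2) x (γ s)) v (Icc 0 ℓ) s ∧
    bil (g.coeff x) (extChartAt (𝓡 2) x (γ s)) ξ v = 0 ∧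
    bil (g.coeff x) (extChartAt (𝓡 2) x (γ s)) ξ ξ = r ^ 2 ∧
    g.VariationBound γ s I x ξ

namespace IsMinimizing

variable {γ : ℝ → M} {ℓ : ℝ} (hγ : g.IsMinimizing γ ℓ)
include hγ

/-- The index form of a minimizing curve is non-negative. -/
theorem index_form_nonneg (hℓ : 0 < ℓ) {ψ ψ' κ : ℝ → ℝ}
    (hψ : ∀ t ∈ Icc 0 ℓ, HasDerivWithinAt ψ (ψ' t) (Icc 0 ℓ) t) (hψ' : ContinuousOn ψ' (Icc 0 ℓ))
    (hκ : ContinuousOn κ (Icc 0 ℓ)) (hle : ∀ t ∈ Icc 0 ℓ, κ t ≤ g.curvature (γ t))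
    (hψ0 : ψ 0 = 0) (hψℓ : ψ ℓ = 0) : 0 ≤ ∫ t in (0 : ℝ)..ℓ, (ψ' t ^ 2 - κ t * ψ t ^ 2) := by
  have hψc : ContinuousOn ψ (Icc 0 ℓ) := fun t ht => (hψ t ht).continuousWithinAt
  have hIc : ContinuousOn (fun t => ψ' t ^ 2 - κ t * ψ t ^ 2) (Icc 0 ℓ) :=
    (hψ'.pow 2).sub (hκ.mul (hψc.pow 2))
  have hIi : ∀ a ∈ Icc 0 ℓ, ∀ b ∈ Icc 0 ℓ,
      IntervalIntegrable (fun t => ψ' t ^ 2 - κ t * ψ t ^ 2) volume a b := fun a ha b hb =>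
    (hIc.mono (uIcc_subset_Icc ha hb)).intervalIntegrable
  have h0I : (0 : ℝ) ∈ Icc 0 ℓ := ⟨le_rfl, hℓ.le⟩
  set I : ℝ → ℝ := fun s => ∫ t in (0 : ℝ)..s, (ψ' t ^ 2 - κ t * ψ t ^ 2) with hI
  -- The second variation bound is carried from `0` to `ℓ` by crossing one chart at a time. It
  -- starts trivially, since `ψ 0 = 0` means that the initial point does not move.
  have main : g.HasVariationBound γ ℓ ℓ (ψ ℓ) (I ℓ) := by
    refine Icc_induction (P := fun s => g.HasVariationBound γ ℓ s (ψ s) (I s)) hℓ.le ?_ ?_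
    · obtain ⟨δ, hδ, U, V, hU, hD, hsrc, hc⟩ := hγ.exists_isGeodesicOn hℓ h0I
      have hnear : |(0 : ℝ) - 0| < δ := by simpa using hδ
      have hnhd : Icc (max 0 (0 - δ)) (min ℓ (0 + δ)) ∈ 𝓝[Icc 0 ℓ] 0 :=
        Icc_max_min_mem_nhdsWithin hnear
      have h0 : (0 : ℝ) ∈ Icc (max 0 (0 - δ)) (min ℓ (0 + δ)) := mem_of_mem_nhdsWithin h0I hnhd
      refine ⟨γ 0, 0, V 0, hsrc 0 h0, (hc.deriv 0 h0).mono_of_mem_nhdsWithin hnhd, by simp,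
        by simp [hψ0], fun ε hε => Eventually.of_forall fun τ => ?_⟩
      simp only [parab_zero_vec, (extChartAt (𝓡 2) (γ 0)).left_inv (mem_extChartAt_source _),
        g.rdist_self, hI, intervalIntegral.integral_same]
      have := mul_nonneg (sq_nonneg τ) hε.le
      linarith
    · intro t₀ ht₀
      obtain ⟨δ, hδ, U, V, hU, hD, hsrc, hc⟩ := hγ.exists_isGeodesicOn hℓ ht₀
      refine ⟨δ, hδ, fun a ha b hb haδ hbδ hab hPa => ?_⟩
      set x := γ t₀ with hx
      have hna : Icc (max 0 (t₀ - δ)) (min ℓ (t₀ + δ)) ∈ 𝓝[Icc 0 ℓ] a :=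
        Icc_max_min_mem_nhdsWithin haδ
      have hnb : Icc (max 0 (t₀ - δ)) (min ℓ (t₀ + δ)) ∈ 𝓝[Icc 0 ℓ] b :=
        Icc_max_min_mem_nhdsWithin hbδ
      have haJ := mem_of_mem_nhdsWithin ha hna
      have hbJ := mem_of_mem_nhdsWithin hb hnb
      have hda := (hc.deriv a haJ).mono_of_mem_nhdsWithin hna
      have hdb := (hc.deriv b hbJ).mono_of_mem_nhdsWithin hnb
      have hsub : Icc a b ⊆ Icc (max 0 (t₀ - δ)) (min ℓ (t₀ + δ)) := Icc_subset_Icc haJ.1 hbJ.2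
      have hsub' : Icc a b ⊆ Icc 0 ℓ := Icc_subset_Icc ha.1 hb.2
      have hG := hD.metric
      have hUb := hc.mem b hbJ
      have hUa := hc.mem a haJ
      refine ⟨x, ψ b • rot (g.coeff x) (extChartAt (𝓡 2) x (γ b)) (V b), V b, hsrc b hbJ, hdb, ?_,
        ?_, ?_⟩
      · rw [map_smul, smul_apply, hG.bil_rot_left hUb, smul_zero]
      · simp only [map_smul, smul_apply, smul_eq_mul]
        rw [hG.bil_rot_rot hUb, hc.unit b hbJ]
        ring
      · obtain ⟨x', ξ', v', hsrc', hdv, h1, h2, hvb⟩ := hPa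
        have hy : extChartAt (𝓡 2) x' (γ a) ∈ overlap x' x := by
          refine ⟨(extChartAt (𝓡 2) x').map_source hsrc', ?_⟩
          rw [mem_preimage, (extChartAt (𝓡 2) x').left_inv hsrc']
          exact hsrc a haJ
        have ht : transition x' x (extChartAt (𝓡 2) x' (γ a)) = extChartAt (𝓡 2) x (γ a) := by
          rw [transition, (extChartAt (𝓡 2) x').left_inv hsrc']
        have hiso := g.isLocalIsometry_transition x' x
        -- the velocities correspond
        have hv : fderiv ℝ (transition x' x) (extChartAt (𝓡 2) x' (γ a)) v' = V a := by
          have e1 : HasDerivWithinAt (fun s => transition x' x (extChartAt (𝓡 2) x' (γ s)))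
              (fderiv ℝ (transition x' x) (extChartAt (𝓡 2) x' (γ a)) v') (Icc 0 ℓ) a :=
            ((hiso.contDiffAt hy).differentiableAt
              (by simp)).hasFDerivAt.comp_hasDerivWithinAt
                (f := fun s => extChartAt (𝓡 2) x' (γ s)) a hdv
          have e2 : ∀ᶠ s in 𝓝[Icc 0 ℓ] a, extChartAt (𝓡 2) x (γ s)
              = transition x' x (extChartAt (𝓡 2) x' (γ s)) := by
            filter_upwards [hγ.continuousOn a ha ((isOpen_extChartAt_source x').mem_nhds hsrc')]
              with s hs
            rw [transition, (extChartAt (𝓡 2) x').left_inv hs]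
          exact (uniqueDiffOn_Icc hℓ a ha).eq_deriv _
            (e1.congr_of_eventuallyEq e2 ht.symm) hda
        have hvb' := hvb.change_chart hsrc' (hsrc a haJ)
        have b1 := hiso.bil_eq _ hy ξ' v'
        have b2 := hiso.bil_eq _ hy ξ' ξ'
        rw [h1, hv, ht] at b1
        rw [h2, ht] at b2
        have hvb2 : g.VariationBound γ a (I a) x
            (ψ a • rot (g.coeff x) (extChartAt (𝓡 2) x (γ a)) (V a)) := by
          -- In the new chart the transported vector is still normal to `γ` and of length `|ψ a|`,
          -- hence equal to the new normal up to sign.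
          rcases hG.eq_smul_rot hUa (hc.unit a haJ) b1.symm b2.symm with e | e
          · rwa [e] at hvb'
          · rw [e] at hvb'
            simpa using hvb'.neg
        have hloc := fun ε : ℝ => hD.second_variation_le (hc.mono hsub) hab (ψ := ψ) (ψ' := ψ') (κ := κ)
          (ε := ε)
          (fun t ht => (hψ t (hsub' ht)).mono hsub') (hψ'.mono hsub') (hκ.mono hsub')
          (fun t ht => by
            have hs := hsrc t (hsub ht)
            rw [← g.curvature_eq x ((extChartAt (𝓡 2) x).map_source hs),
              (extChartAt (𝓡 2) x).left_inv hs]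
            exact hle t (hsub' ht))
        intro ε hε
        filter_upwards [hvb2 (ε / 2) (by positivity), hloc (ε / 2) (by positivity)]
          with τ e1 e2
        have hIab : I b = I a + ∫ t in a..b, (ψ' t ^ 2 - κ t * ψ t ^ 2) :=
          (intervalIntegral.integral_add_adjacent_intervals (hIi 0 h0I a ha) (hIi a ha b hb)).symm
        have t1 := g.rdist_triangle (γ 0) ((extChartAt (𝓡 2) x).symm
          (parab (g.coeff x) (extChartAt (𝓡 2) x (γ a))
            (ψ a • rot (g.coeff x) (extChartAt (𝓡 2) x (γ a)) (V a)) τ))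
          ((extChartAt (𝓡 2) x).symm (parab (g.coeff x) (extChartAt (𝓡 2) x (γ b))
            (ψ b • rot (g.coeff x) (extChartAt (𝓡 2) x (γ b)) (V b)) τ))
        have t2 := g.rdist_triangle (γ 0) ((extChartAt (𝓡 2) x).symm
          (parab (g.coeff x) (extChartAt (𝓡 2) x (γ a))
            (ψ a • rot (g.coeff x) (extChartAt (𝓡 2) x (γ a)) (V a)) (-τ)))
          ((extChartAt (𝓡 2) x).symm (parab (g.coeff x) (extChartAt (𝓡 2) x (γ b))
            (ψ b • rot (g.coeff x) (extChartAt (𝓡 2) x (γ b)) (V b)) (-τ)))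
        rw [hIab]
        simp only [chartDist] at e2
        linarith
  obtain ⟨x, ξ, v, hsrc, -, -, h2, hvb⟩ := main
  have hξ : ξ = 0 := by
    by_contra hne
    have := (g.isMetricOn_coeff x).pos _ ((extChartAt (𝓡 2) x).map_source hsrc) ξ hne
    rw [h2, hψℓ] at this
    norm_num at this
  subst hξ
  have hdist : g.rdist (γ 0) (γ ℓ) = ℓ := by
    rw [hγ 0 h0I ℓ ⟨hℓ.le, le_rfl⟩, sub_zero, abs_of_pos hℓ]
  refine le_of_forall_pos_le_add fun ε hε => ?_
  obtain ⟨r, hr, hball⟩ := Metric.eventually_nhds_iff_ball.1 (hvb ε hε)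
  have h3 := hball (r / 2) (by
    rw [mem_ball_zero_iff, Real.norm_eq_abs, abs_of_pos (by positivity)]; linarith)
  simp only [parab_zero_vec, (extChartAt (𝓡 2) x).left_inv hsrc, hdist] at h3
  -- At `ℓ` the end point does not move either, so both distances are exactly `ℓ` and the bound
  -- reads `2ℓ ≤ 2ℓ + τ² (I ℓ + ε)`.
  have h4 : 0 ≤ (r / 2) ^ 2 * (I ℓ + ε) := by linarith
  exact nonneg_of_mul_nonneg_right h4 (by positivity)

/-- The derivative of a smooth function along a minimizing curve. -/
lemma exists_hasDerivWithinAt (hℓ : 0 < ℓ) {f : M → ℝ} (hf : ContMDiff (𝓡 2) 𝓘(ℝ, ℝ) ∞ f) :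
    ∃ f' : ℝ → ℝ, ContinuousOn f' (Icc 0 ℓ) ∧ ∀ t ∈ Icc 0 ℓ,
      HasDerivWithinAt (f ∘ γ) (f' t) (Icc 0 ℓ) t ∧
      ∃ v, bil (g.coeff (γ t)) (extChartAt (𝓡 2) (γ t) (γ t)) v v = 1 ∧
        f' t = fderiv ℝ (f ∘ (extChartAt (𝓡 2) (γ t)).symm) (extChartAt (𝓡 2) (γ t) (γ t)) v := by
  have hloc : ∀ t₀ ∈ Icc 0 ℓ, ∃ δ > 0, ∃ V : ℝ → Plane,
      ContinuousOn V (Icc (max 0 (t₀ - δ)) (min ℓ (t₀ + δ))) ∧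
      ContinuousOn (fun s => extChartAt (𝓡 2) (γ t₀) (γ s))
        (Icc (max 0 (t₀ - δ)) (min ℓ (t₀ + δ))) ∧
      ∀ s ∈ Icc 0 ℓ, |s - t₀| < δ → γ s ∈ (extChartAt (𝓡 2) (γ t₀)).source ∧
        bil (g.coeff (γ t₀)) (extChartAt (𝓡 2) (γ t₀) (γ s)) (V s) (V s) = 1 ∧
        HasDerivWithinAt (f ∘ γ) (fderiv ℝ (f ∘ (extChartAt (𝓡 2) (γ t₀)).symm)
          (extChartAt (𝓡 2) (γ t₀) (γ s)) (V s)) (Icc 0 ℓ) s := by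
    intro t₀ ht₀
    obtain ⟨δ, hδ, U, V, hU, hD, hsrc, hc⟩ := hγ.exists_isGeodesicOn hℓ ht₀
    refine ⟨δ, hδ, V, hc.continuousOn_vel, hc.continuousOn, fun s hs hsδ => ?_⟩
    have hn : Icc (max 0 (t₀ - δ)) (min ℓ (t₀ + δ)) ∈ 𝓝[Icc 0 ℓ] s :=
      Icc_max_min_mem_nhdsWithin hsδ
    have hsJ := mem_of_mem_nhdsWithin hs hn
    refine ⟨hsrc s hsJ, hc.unit s hsJ, ?_⟩
    have hd := (hc.deriv s hsJ).mono_of_mem_nhdsWithin hn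
    have hfd := ((contDiffOn_comp_symm hf (γ t₀)).contDiffAt
      ((isOpen_target (γ t₀)).mem_nhds (hU (hc.mem s hsJ)))).differentiableAt (by simp)
    refine (hfd.hasFDerivAt.comp_hasDerivWithinAt
      (f := fun s => extChartAt (𝓡 2) (γ t₀) (γ s)) s hd).congr_of_eventuallyEq ?_ ?_
    · filter_upwards [hn] with u hu
      simp only [Function.comp, (extChartAt (𝓡 2) (γ t₀)).left_inv (hsrc u hu)]
    · simp only [Function.comp, (extChartAt (𝓡 2) (γ t₀)).left_inv (hsrc s hsJ)]
  -- Being intrinsic, this derivative agrees near each point with the formula in a chart, and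
  -- continuity is read off there.
  refine ⟨fun t => derivWithin (f ∘ γ) (Icc 0 ℓ) t, fun t ht => ?_, fun t ht => ?_⟩
  · obtain ⟨δ, hδ, V, hV, hc, h⟩ := hloc t ht
    have htδ : |t - t| < δ := by simpa using hδ
    have hn : Icc (max 0 (t - δ)) (min ℓ (t + δ)) ∈ 𝓝[Icc 0 ℓ] t := Icc_max_min_mem_nhdsWithin htδ
    have htJ := mem_of_mem_nhdsWithin ht hn
    have hfd : ContinuousAt (fderiv ℝ (f ∘ (extChartAt (𝓡 2) (γ t)).symm))
        (extChartAt (𝓡 2) (γ t) (γ t)) :=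
      (((contDiffOn_comp_symm hf (γ t)).contDiffAt ((isOpen_target (γ t)).mem_nhds
        ((extChartAt (𝓡 2) (γ t)).map_source (mem_extChartAt_source _)))).fderiv_right (m := ∞)
          (by simp)).continuousAt
    have h1 : ContinuousWithinAt (fun s => fderiv ℝ (f ∘ (extChartAt (𝓡 2) (γ t)).symm)
        (extChartAt (𝓡 2) (γ t) (γ s)) (V s)) (Icc 0 ℓ) t :=
      (hfd.comp_continuousWithinAt (f := fun s => extChartAt (𝓡 2) (γ t) (γ s))
        ((hc t htJ).mono_of_mem_nhdsWithin hn)).clm_apply ((hV t htJ).mono_of_mem_nhdsWithin hn)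
    refine h1.congr_of_eventuallyEq ?_
      ((h t ht htδ).2.2.derivWithin (uniqueDiffOn_Icc hℓ t ht))
    have hev : ∀ᶠ s in 𝓝[Icc 0 ℓ] t, |s - t| < δ :=
      mem_nhdsWithin_of_mem_nhds (Metric.ball_mem_nhds t hδ)
    filter_upwards [hev, self_mem_nhdsWithin] with s hs hsI
    exact (h s hsI hs).2.2.derivWithin (uniqueDiffOn_Icc hℓ s hsI)
  · obtain ⟨δ, hδ, V, hV, hc, h⟩ := hloc t ht
    obtain ⟨-, h1, h2⟩ := h t ht (by simpa using hδ)
    have h3 := h2.derivWithin (uniqueDiffOn_Icc hℓ t ht)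
    refine ⟨?_, V t, h1, h3⟩
    change HasDerivWithinAt _ (derivWithin (f ∘ γ) (Icc 0 ℓ) t) _ _
    rw [h3]
    exact h2

end IsMinimizing

end SurfaceMetric

/-! ### Existence of minimizing curves on compact surfaces -/

namespace SurfaceMetric

variable {M : Type*} [TopologicalSpace M] [ChartedSpace Plane M] [IsManifold (𝓡 2) ∞ M]
  [ConnectedSpace M] (g : SurfaceMetric M)

lemma eq_of_rdist_eq_zero [T2Space M] [RegularSpace M] {x y : M} (h : g.rdist x y = 0) : x = y := by
  by_contra hne
  obtain ⟨c, hc, hcS⟩ := g.exists_dist_lt_subset (isOpen_compl_singleton.mem_nhds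
    (show x ∈ ({y} : Set M)ᶜ from hne))
  have : y ∈ ({y} : Set M)ᶜ := hcS (by
    change g.dist x y < c
    rw [← g.ofReal_rdist, h, ENNReal.ofReal_zero]
    exact hc)
  exact this rfl

variable [CompactSpace M]

/-- The distance to `y` is minimized on the compact sphere of radius `r` around `x`; near-optimal
points are supplied by `exists_intermediate`. -/
lemma exists_rdist_eq {x y : M} {r : ℝ} (hr : 0 ≤ r) (hr' : r ≤ g.rdist x y) :
    ∃ z, g.rdist x z = r ∧ g.rdist z y = g.rdist x y - r := by
  have hcl : IsClosed {z | g.rdist x z = r} :=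
    isClosed_eq (g.continuous_rdist.comp (continuous_const.prodMk continuous_id)) continuous_const
  obtain ⟨z₀, hz₀, -⟩ := g.exists_intermediate hr hr' one_pos
  obtain ⟨z, hz, hmin⟩ := hcl.isCompact.exists_isMinOn ⟨z₀, hz₀⟩
    (g.continuous_rdist.comp (continuous_id.prodMk continuous_const)).continuousOn
      (f := fun z => g.rdist z y)
  refine ⟨z, hz, le_antisymm (le_of_forall_pos_le_add fun ε hε => ?_) ?_⟩
  · obtain ⟨w, hw, hw'⟩ := g.exists_intermediate hr hr' hε
    exact (hmin hw).trans hw'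
  · have := g.rdist_triangle x z y
    rw [hz] at this
    linarith

/-- The point for the largest parameter is placed first, between `p` and `q`, and the smaller
parameters are then treated between `p` and that point. Equality in the triangle inequalities
propagates to `q`. -/
lemma exists_finite_minimizing (p : M) (F : Finset ℝ) : ∀ q : M,
    (∀ s ∈ F, s ∈ Icc 0 (g.rdist p q)) →
    ∃ γ : ℝ → M, (∀ s ∈ F, g.rdist p (γ s) = s ∧ g.rdist (γ s) q = g.rdist p q - s) ∧
      ∀ s ∈ F, ∀ t ∈ F, g.rdist (γ s) (γ t) = |t - s| := by
  induction F using Finset.induction_on_max with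
  | empty => exact fun q _ => ⟨fun _ => p, by simp, by simp⟩
  | insert m F hm ih =>
    intro q hF
    have hmI := hF m (Finset.mem_insert_self m F)
    obtain ⟨z, hz1, hz2⟩ := g.exists_rdist_eq hmI.1 hmI.2
    obtain ⟨γ, h1, h2⟩ := ih z fun s hs =>
      ⟨(hF s (Finset.mem_insert_of_mem hs)).1, by rw [hz1]; exact (hm s hs).le⟩
    rw [hz1] at h1
    have hne : ∀ s ∈ F, Function.update γ m z s = γ s := fun s hs =>
      Function.update_of_ne (hm s hs).ne _ _
    refine ⟨Function.update γ m z, fun s hs => ?_, fun s hs t ht => ?_⟩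
    · rcases Finset.mem_insert.1 hs with rfl | hs
      · simp [hz1, hz2]
      · rw [hne s hs]
        refine ⟨(h1 s hs).1, le_antisymm ?_ ?_⟩
        · have := g.rdist_triangle (γ s) z q
          rw [(h1 s hs).2, hz2] at this
          linarith
        · have := g.rdist_triangle p (γ s) q
          rw [(h1 s hs).1] at this
          linarith
    · rcases Finset.mem_insert.1 hs with hsm | hs' <;> rcases Finset.mem_insert.1 ht with htm | ht'
      · simp [hsm, htm, g.rdist_self]
      · rw [hsm, hne t ht', Function.update_self, g.rdist_comm, (h1 t ht').2, abs_sub_comm,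
          abs_of_pos (by linarith [hm t ht'])]
      · rw [htm, hne s hs', Function.update_self, (h1 s hs').2, abs_of_pos (by linarith [hm s hs'])]
      · rw [hne s hs', hne t ht', h2 s hs' t ht']

/-- Any two points of a compact surface are joined by a minimizing curve. -/
theorem exists_isMinimizing [T2Space M] (p q : M) :
    ∃ γ, g.IsMinimizing γ (g.rdist p q) ∧ γ 0 = p ∧ γ (g.rdist p q) = q := by
  set ℓ := g.rdist p q with hℓ
  have hℓ0 : 0 ≤ ℓ := g.rdist_nonneg p q
  -- Each finite set of parameters imposes closed conditions in the product `ℝ → M`, which is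
  -- compact by Tychonoff's theorem. Finitely many such conditions can be met, so all can be met at
  -- once, and a map obeying them is automatically continuous on `[0, ℓ]`.
  set C : Finset (Icc 0 ℓ) → Set (ℝ → M) := fun F =>
    {γ | ∀ s ∈ F, (g.rdist p (γ s) = s ∧ g.rdist (γ s) q = ℓ - s) ∧
      ∀ t ∈ F, g.rdist (γ s) (γ t) = |(t : ℝ) - s|} with hC
  have hclosed : ∀ F, IsClosed (C F) := by
    intro F
    have ev : ∀ s : ℝ, Continuous fun γ : ℝ → M => γ s := fun s => continuous_apply s
    simp only [hC, Set.ofPred_forall, Set.ofPred_and]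
    refine isClosed_iInter fun s => isClosed_iInter fun _ => (IsClosed.inter ?_ ?_).inter
      (isClosed_iInter fun t => isClosed_iInter fun _ => ?_)
    · exact isClosed_eq (g.continuous_rdist.comp (continuous_const.prodMk (ev s))) continuous_const
    · exact isClosed_eq (g.continuous_rdist.comp ((ev s).prodMk continuous_const)) continuous_const
    · exact isClosed_eq (g.continuous_rdist.comp ((ev s).prodMk (ev t))) continuous_const
  have hne : ∀ F, (C F).Nonempty := by
    intro F
    obtain ⟨γ, h1, h2⟩ := g.exists_finite_minimizing p (F.map (Function.Embedding.subtype _)) q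
      (fun s hs => by
        obtain ⟨t, -, rfl⟩ := Finset.mem_map.1 hs
        exact t.2)
    exact ⟨γ, fun s hs => ⟨h1 s (Finset.mem_map_of_mem _ hs), fun t ht =>
      h2 s (Finset.mem_map_of_mem _ hs) t (Finset.mem_map_of_mem _ ht)⟩⟩
  have hdir : Directed (· ⊇ ·) C := by
    classical
    intro F F'
    refine ⟨F ∪ F', fun γ hγ s hs => ?_, fun γ hγ s hs => ?_⟩
    · exact ⟨(hγ s (Finset.mem_union_left _ hs)).1, fun t ht =>
        (hγ s (Finset.mem_union_left _ hs)).2 t (Finset.mem_union_left _ ht)⟩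
    · exact ⟨(hγ s (Finset.mem_union_right _ hs)).1, fun t ht =>
        (hγ s (Finset.mem_union_right _ hs)).2 t (Finset.mem_union_right _ ht)⟩
  obtain ⟨γ, hγ⟩ := IsCompact.nonempty_iInter_of_directed_nonempty_isCompact_isClosed C hdir hne
    (fun F => (hclosed F).isCompact) hclosed
  rw [mem_iInter] at hγ
  classical
  refine ⟨γ, fun s hs t ht => ?_, ?_, ?_⟩
  · exact (hγ {⟨s, hs⟩, ⟨t, ht⟩} ⟨s, hs⟩ (by simp)).2 ⟨t, ht⟩ (by simp)
  · have := (hγ {⟨0, le_rfl, hℓ0⟩} ⟨0, le_rfl, hℓ0⟩ (by simp)).1.1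
    exact (g.eq_of_rdist_eq_zero this).symm
  · have := (hγ {⟨ℓ, hℓ0, le_rfl⟩} ⟨ℓ, hℓ0, le_rfl⟩ (by simp)).1.2
    exact g.eq_of_rdist_eq_zero (by simpa using this)

lemma exists_diam_eq : ∃ p q, g.diam = g.dist p q := by
  have : Nonempty M := inferInstance
  obtain ⟨⟨p, q⟩, -, hmax⟩ := isCompact_univ.exists_isMaxOn (univ_nonempty (α := M × M))
    g.continuous_rdist.continuousOn
  refine ⟨p, q, le_antisymm (iSup₂_le fun x y => ?_) (le_iSup₂ (f := fun x y => g.dist x y) p q)⟩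
  rw [← g.ofReal_rdist, ← g.ofReal_rdist]
  exact ENNReal.ofReal_le_ofReal (hmax (mem_univ (x, y)))

end SurfaceMetric

/-! ### The one-dimensional inequality and the diameter bound -/

/-- The one-dimensional inequality behind the diameter bound: the index form with potential
`(1/2) e^(-2w) + (1/2) w'^2` is not non-negative on an interval for which `∫ e^(-w) ≥ 2π`. -/
lemma exists_index_form_neg {ℓ : ℝ} (hℓ : 0 < ℓ) {w w' : ℝ → ℝ}
    (hw : ∀ t ∈ Icc 0 ℓ, HasDerivWithinAt w (w' t) (Icc 0 ℓ) t) (hw' : ContinuousOn w' (Icc 0 ℓ))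
    {A : ℝ → ℝ} (hA : Continuous A) (hAw : ∀ t ∈ Icc 0 ℓ, A t = Real.exp (-w t))
    (hL : 2 * Real.pi ≤ ∫ t in (0 : ℝ)..ℓ, A t) :
    ∃ ψ ψ' : ℝ → ℝ, (∀ t ∈ Icc 0 ℓ, HasDerivWithinAt ψ (ψ' t) (Icc 0 ℓ) t) ∧
      ContinuousOn ψ' (Icc 0 ℓ) ∧ ψ 0 = 0 ∧ ψ ℓ = 0 ∧
      ∫ t in (0 : ℝ)..ℓ, (ψ' t ^ 2 - (1 / 2 * A t ^ 2 + 1 / 2 * w' t ^ 2) * ψ t ^ 2) < 0 := by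
  have hπ := Real.pi_pos
  set L := ∫ t in (0 : ℝ)..ℓ, A t with hLdef
  have hL0 : 0 < L := by linarith
  set S : ℝ → ℝ := fun t => ∫ s in (0 : ℝ)..t, A s with hS
  have hSd : ∀ t, HasDerivAt S (A t) t := fun t =>
    intervalIntegral.integral_hasDerivAt_right (hA.intervalIntegrable _ _)
      (hA.stronglyMeasurableAtFilter _ _) hA.continuousAt
  have hS0 : S 0 = 0 := by simp [hS]
  have hSℓ : S ℓ = L := rfl
  -- With this frequency `sin (k S)` vanishes at both ends, and `L ≥ 2π` becomes `k ≤ 1/2`.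
  set k := Real.pi / L with hk
  have hk0 : 0 < k := by positivity
  have hkL : k * L = Real.pi := by rw [hk]; field_simp
  have hk2 : k ≤ 1 / 2 := by rw [hk, div_le_iff₀ hL0]; linarith
  have hSc : Continuous S := continuous_iff_continuousAt.2 fun t => (hSd t).continuousAt
  have hwc : ContinuousOn w (Icc 0 ℓ) := fun t ht => (hw t ht).continuousWithinAt
  set ψ : ℝ → ℝ := fun t => Real.exp (w t / 2) * Real.sin (k * S t) with hψ
  set ψ' : ℝ → ℝ := fun t => Real.exp (w t / 2) *
    (w' t / 2 * Real.sin (k * S t) + k * A t * Real.cos (k * S t)) with hψ'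
  have hψ'c : ContinuousOn ψ' (Icc 0 ℓ) := by
    have h1 : ContinuousOn (fun t => Real.exp (w t / 2)) (Icc 0 ℓ) :=
      Real.continuous_exp.comp_continuousOn (hwc.div_const 2)
    have h2 : Continuous fun t => Real.sin (k * S t) := by fun_prop
    have h3 : Continuous fun t => k * A t * Real.cos (k * S t) := by fun_prop
    exact h1.mul (((hw'.div_const 2).mul h2.continuousOn).add h3.continuousOn)
  have hψc : ContinuousOn ψ (Icc 0 ℓ) := by
    have h1 : ContinuousOn (fun t => Real.exp (w t / 2)) (Icc 0 ℓ) :=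
      Real.continuous_exp.comp_continuousOn (hwc.div_const 2)
    have h2 : Continuous fun t => Real.sin (k * S t) := by fun_prop
    exact h1.mul h2.continuousOn
  refine ⟨ψ, ψ', fun t ht => ?_, hψ'c, by simp [hψ, hS0], by simp [hψ, hSℓ, hkL], ?_⟩
  · have h1 := ((hw t ht).div_const 2).exp
    have h2 := (((hSd t).const_mul k).sin).hasDerivWithinAt (s := Icc 0 ℓ)
    refine (h1.mul h2).congr_deriv ?_
    simp only [hψ']
    ring
  · have hid : ∀ t ∈ Icc 0 ℓ, ψ' t ^ 2 - (1 / 2 * A t ^ 2 + 1 / 2 * w' t ^ 2) * ψ t ^ 2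
        = A t * (2 * k ^ 2 * Real.cos (k * S t) ^ 2 - 1 / 2 * Real.sin (k * S t) ^ 2
          - (1 / 2 * (Real.exp (w t) * w' t) * Real.sin (k * S t)
            - k * Real.cos (k * S t)) ^ 2) := by
      intro t ht
      have hE : Real.exp (w t / 2) ^ 2 = Real.exp (w t) := by
        rw [← Real.exp_nat_mul]; congr 1; push_cast; ring
      have hEA : Real.exp (w t) * A t = 1 := by
        rw [hAw t ht, ← Real.exp_add]; simp
      simp only [hψ, hψ', mul_pow, hE]
      set E := Real.exp (w t)
      set s := Real.sin (k * S t)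
      set c := Real.cos (k * S t)
      linear_combination (k ^ 2 * A t * c ^ 2 - 1 / 2 * A t * s ^ 2 + 1 / 4 * w' t ^ 2 * s ^ 2 * E)
        * hEA
    have hpos : ∀ t ∈ Icc 0 ℓ, 0 < A t := fun t ht => by rw [hAw t ht]; exact Real.exp_pos _
    have hlt : ∫ t in (0 : ℝ)..ℓ, (ψ' t ^ 2 - (1 / 2 * A t ^ 2 + 1 / 2 * w' t ^ 2) * ψ t ^ 2)
        < ∫ t in (0 : ℝ)..ℓ, k * (Real.cos (2 * (k * S t)) * (2 * (k * A t))) := by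
      refine intervalIntegral.integral_lt_integral_of_continuousOn_of_le_of_exists_lt hℓ ?_ ?_ ?_ ?_
      · exact (hψ'c.pow 2).sub (((((hA.continuousOn).pow 2).const_mul _).add
          ((hw'.pow 2).const_mul _)).mul (hψc.pow 2))
      · have : Continuous fun t => k * (Real.cos (2 * (k * S t)) * (2 * (k * A t))) := by fun_prop
        exact this.continuousOn
      · intro t ht
        have ht' : t ∈ Icc 0 ℓ := ⟨ht.1.le, ht.2⟩
        rw [hid t ht', Real.cos_two_mul, Real.cos_sq']
        have h1 := hpos t ht'
        have h2 : k ^ 2 ≤ 1 / 4 := by nlinarith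
        have h3 := mul_le_mul_of_nonneg_right h2 (sq_nonneg (Real.sin (k * S t)))
        have h4 := sq_nonneg (1 / 2 * (Real.exp (w t) * w' t) * Real.sin (k * S t)
          - k * Real.cos (k * S t))
        -- From `k² ≤ 1/4` one has `1/2 ≥ 2k²`, so dropping the square leaves at most `2k² cos
        -- (2kS)`, which times `A` is the derivative of `k sin (2kS)`.
        have h5 : 2 * k ^ 2 * (1 - Real.sin (k * S t) ^ 2) - 1 / 2 * Real.sin (k * S t) ^ 2
            - (1 / 2 * (Real.exp (w t) * w' t) * Real.sin (k * S t)
              - k * Real.cos (k * S t)) ^ 2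
            ≤ 2 * k ^ 2 * (2 * (1 - Real.sin (k * S t) ^ 2) - 1) := by nlinarith
        calc _ ≤ _ := mul_le_mul_of_nonneg_left h5 h1.le
          _ = _ := by ring
      -- Strictness at `t = 0`: the discarded square equals `k²` there, whatever `w'` is.
      · have h0 : (0 : ℝ) ∈ Icc 0 ℓ := ⟨le_rfl, hℓ.le⟩
        refine ⟨0, h0, ?_⟩
        rw [hid 0 h0]
        simp only [hS0, mul_zero, Real.sin_zero, Real.cos_zero]
        have := mul_pos (hpos 0 h0) (pow_pos hk0 2)
        nlinarith
    refine hlt.trans_eq ?_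
    have hint := intervalIntegral.integral_eq_sub_of_hasDerivAt (a := 0) (b := ℓ)
      (f := fun t => k * Real.sin (2 * (k * S t)))
      (f' := fun t => k * (Real.cos (2 * (k * S t)) * (2 * (k * A t))))
      (fun t _ => ((((hSd t).const_mul k).const_mul 2).sin).const_mul k)
      (by
        have : Continuous fun t => k * (Real.cos (2 * (k * S t)) * (2 * (k * A t))) := by fun_prop
        exact this.intervalIntegrable _ _)
    rw [hint, hSℓ, hkL, hS0]
    simp

namespace SurfaceMetric

open LocalGeom

variable {M : Type*} [TopologicalSpace M] [ChartedSpace Plane M] [IsManifold (𝓡 2) ∞ M]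
  {g : SurfaceMetric M} {u : M → ℝ}

namespace IsPosSupersolution

variable (hu : g.IsPosSupersolution u)
include hu

lemma smooth_sq : ContMDiff (𝓡 2) 𝓘(ℝ, ℝ) ∞ (u ^ 2) := hu.smooth.pow 2

lemma pos_sq (x : M) : 0 < (u ^ 2) x := pow_pos (hu.pos x) 2

lemma smooth_log : ContMDiff (𝓡 2) 𝓘(ℝ, ℝ) ∞ fun x => Real.log (u x) := fun x =>
  ((Real.contDiffAt_log.2 (hu.pos x).ne').contMDiffAt).comp x (hu.smooth x)

/-- The conformal metric `u² g`. -/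
def conformal : SurfaceMetric M := g.scale (u ^ 2) hu.smooth_sq hu.pos_sq

lemma bil_conformal (x : M) (y a b : Plane) : bil (hu.conformal.coeff x) y a b
    = u ((extChartAt (𝓡 2) x).symm y) ^ 2 * bil (g.coeff x) y a b := by
  rw [conformal, coeff_scale_sq, bil_conf]
  rfl

/-- The curvature of the conformal metric. -/
lemma le_curvature_conformal (x : M) {v : Plane}
    (hv : bil (hu.conformal.coeff x) (extChartAt (𝓡 2) x x) v v = 1) :
    1 / 2 * (u x)⁻¹ ^ 2 + 1 / 2 * fderiv ℝ ((fun x => Real.log (u x)) ∘ (extChartAt (𝓡 2) x).symm)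
      (extChartAt (𝓡 2) x x) v ^ 2 ≤ hu.conformal.curvature x := by
  have hx : (extChartAt (𝓡 2) x).symm (extChartAt (𝓡 2) x x) = x := extChartAt_to_inv x
  have hy : extChartAt (𝓡 2) x x ∈ (extChartAt (𝓡 2) x).target := mem_extChartAt_target x
  have hG := g.isMetricOn_coeff x
  have hpos := hu.pos x
  have hineq := hu.ineq x
  rw [SurfaceMetric.laplacian, SurfaceMetric.curvature, SurfaceMetric.gradSq] at hineq
  have h1 := hG.curvature_conf_ge (u := u ∘ (extChartAt (𝓡 2) x).symm)
    (contDiffOn_comp_symm hu.smooth x) (fun y _ => hu.pos _) hy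
    (by simpa only [Function.comp, hx] using hineq)
  rw [hu.bil_conformal, hx] at hv
  -- A unit vector `v` for `u² g` becomes a unit vector for `g` after multiplication by `u`; this
  -- accounts for the factor `u²` between the two gradient terms.
  have hv' : bil (g.coeff x) (extChartAt (𝓡 2) x x) (u x • v) (u x • v) = 1 := by
    simp only [map_smul, smul_apply, smul_eq_mul]
    rw [← hv]; ring
  have h2 := hG.sq_fderiv_le_gradSq hy hv'
    (fun z => Real.log ((u ∘ (extChartAt (𝓡 2) x).symm) z))
  have h3 : hu.conformal.curvature x = LocalGeom.curvature
      (conf (u ∘ (extChartAt (𝓡 2) x).symm) (g.coeff x)) (extChartAt (𝓡 2) x x) := by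
    rw [SurfaceMetric.curvature, conformal, coeff_scale_sq]
  rw [h3]
  rw [map_smul, smul_eq_mul] at h2
  have h4 : (u ∘ (extChartAt (𝓡 2) x).symm) (extChartAt (𝓡 2) x x) = u x := by
    simp only [Function.comp, hx]
  rw [h4] at h1
  have h5 : ((fun x => Real.log (u x)) ∘ (extChartAt (𝓡 2) x).symm)
      = fun z => Real.log ((u ∘ (extChartAt (𝓡 2) x).symm) z) := rfl
  rw [h5]
  have hu2 : 0 < u x ^ 2 := by positivity
  rw [← mul_le_mul_iff_of_pos_right hu2]
  refine le_trans ?_ h1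
  rw [add_mul, mul_assoc, ← mul_pow, inv_mul_cancel₀ hpos.ne']
  linarith

/-- Comparison of the distances of `g` and of `u² g`. -/
lemma rdist_le_integral [ConnectedSpace M] [RegularSpace M] {γ : ℝ → M} {ℓ : ℝ} (hℓ : 0 < ℓ)
    (hγ : hu.conformal.IsMinimizing γ ℓ) {A : ℝ → ℝ} (hA : Continuous A)
    (hAu : ∀ t ∈ Icc 0 ℓ, A t = (u (γ t))⁻¹) :
    g.rdist (γ 0) (γ ℓ) ≤ ∫ t in (0 : ℝ)..ℓ, A t := by
  have hcont : ContinuousOn (fun t => g.rdist (γ 0) (γ t)) (Icc 0 ℓ) :=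
    g.continuous_rdist.comp_continuousOn (continuousOn_const.prodMk hγ.continuousOn)
  -- Only an upper bound on right slopes is needed. It follows from the upper chart comparison for
  -- `g` and the lower one for `u² g`, as `γ` has unit speed for the latter.
  refine image_le_of_liminf_slope_right_le_deriv_boundary (f := fun t => g.rdist (γ 0) (γ t))
    (B := fun t => ∫ s in (0 : ℝ)..t, A s) (B' := A) hcont (by simp [g.rdist_self])
    (intervalIntegral.continuous_primitive (fun _ _ => hA.intervalIntegrable _ _) 0).continuousOn
    (fun t _ => (intervalIntegral.integral_hasDerivAt_right (hA.intervalIntegrable _ _)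
      (hA.stronglyMeasurableAtFilter _ _) hA.continuousAt).hasDerivWithinAt) ?_ ⟨hℓ.le, le_rfl⟩
  intro t ht r hr
  have htI : t ∈ Icc 0 ℓ := ⟨ht.1, ht.2.le⟩
  set x := γ t with hx
  set φ := extChartAt (𝓡 2) x with hφ
  have hsrc : γ t ∈ φ.source := mem_extChartAt_source _
  have hy : φ x ∈ φ.target := mem_extChartAt_target x
  have hux := hu.pos x
  have hAt : A t = (u x)⁻¹ := hAu t htI
  obtain ⟨ε, hε, hεr⟩ : ∃ ε > 0, (1 + ε) * ((1 + ε) * A t) < r := by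
    have hc : Continuous fun ε : ℝ => (1 + ε) * ((1 + ε) * A t) := by fun_prop
    have h1 : ∀ᶠ ε in 𝓝 (0 : ℝ), (1 + ε) * ((1 + ε) * A t) < r :=
      hc.continuousAt.eventually (gt_mem_nhds (by simpa using hr))
    obtain ⟨s, hs, hball⟩ := Metric.eventually_nhds_iff_ball.1 h1
    refine ⟨s / 2, by positivity, hball _ ?_⟩
    rw [mem_ball_zero_iff, Real.norm_eq_abs, abs_of_pos (by positivity)]
    linarith
  obtain ⟨δ₁, hδ₁, h₁⟩ := g.exists_chartDist_le x hy hε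
  obtain ⟨δ₂, hδ₂, h₂⟩ := hu.conformal.exists_le_chartDist x hy hε
  have hev : ∀ᶠ s in 𝓝[Icc 0 ℓ] t, γ s ∈ φ.source ∩ φ ⁻¹' Metric.ball (φ x) (min δ₁ δ₂) :=
    hγ.continuousOn t htI (((continuousOn_extChartAt x).isOpen_inter_preimage
      (isOpen_extChartAt_source x) Metric.isOpen_ball).mem_nhds
        ⟨hsrc, Metric.mem_ball_self (lt_min hδ₁ hδ₂)⟩)
  have hev' : ∀ᶠ s in 𝓝[>] t, γ s ∈ φ.source ∩ φ ⁻¹' Metric.ball (φ x) (min δ₁ δ₂) := by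
    have hle : 𝓝[>] t ≤ 𝓝[Icc 0 ℓ] t := by
      refine nhdsWithin_le_iff.2 ?_
      filter_upwards [Ioo_mem_nhdsGT ht.2] with s hs
      exact ⟨ht.1.trans hs.1.le, hs.2.le⟩
    exact hle hev
  have hfin : ∀ᶠ s in 𝓝[>] t, slope (fun t => g.rdist (γ 0) (γ t)) t s < r := by
    filter_upwards [hev', Ioo_mem_nhdsGT ht.2] with s hs hst
    have hpos : 0 < s - t := sub_pos.2 hst.1
    have hsI : s ∈ Icc 0 ℓ := ⟨ht.1.trans hst.1.le, hst.2.le⟩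
    rw [slope_def_field, div_lt_iff₀ hpos]
    have e1 := h₁ (φ x) (Metric.mem_ball_self hδ₁) (φ (γ s))
      (Metric.ball_subset_ball (min_le_left _ _) hs.2)
    have e2 := h₂ (φ x) (Metric.mem_ball_self hδ₂) (φ (γ s))
      (Metric.ball_subset_ball (min_le_right _ _) hs.2)
    rw [chartDist, ← hφ, φ.left_inv hsrc, φ.left_inv hs.1] at e1 e2
    rw [hγ t htI s hsI, abs_of_pos hpos, hu.bil_conformal, ← hφ, φ.left_inv hsrc,
      Real.sqrt_mul (by positivity), Real.sqrt_sq hux.le] at e2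
    have e3 := g.rdist_triangle (γ 0) (γ t) (γ s)
    set Y := Real.sqrt (bil (g.coeff x) (φ x) (φ (γ s) - φ x) (φ (γ s) - φ x))
    have e4 : Y ≤ A t * ((1 + ε) * (s - t)) := by
      rw [hAt, inv_mul_eq_div, le_div_iff₀ hux]
      linarith
    have e5 : (1 + ε) * Y ≤ (1 + ε) * (A t * ((1 + ε) * (s - t))) :=
      mul_le_mul_of_nonneg_left e4 (by positivity)
    have e6 := mul_lt_mul_of_pos_right hεr hpos
    linarith
  exact hfin.frequently

/-- Were the diameter at least `2π`, the curve minimizing for `u² g` between two points realizing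
the diameter of `g` would have `∫ e^(-w) ≥ 2π`, and the two statements on its index form would
contradict each other. -/
theorem diam_lt [T2Space M] [CompactSpace M] [ConnectedSpace M] :
    g.diam < ENNReal.ofReal (2 * Real.pi) := by
  by_contra hcon
  rw [not_lt] at hcon
  obtain ⟨p, q, hpq⟩ := g.exists_diam_eq
  have hπ := Real.pi_pos
  have hdist : 2 * Real.pi ≤ g.rdist p q := by
    rw [hpq, ← g.ofReal_rdist] at hcon
    exact (ENNReal.ofReal_le_ofReal_iff (g.rdist_nonneg p q)).1 hcon
  obtain ⟨γ, hγ, hγ0, hγℓ⟩ := hu.conformal.exists_isMinimizing p q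
  set ℓ := hu.conformal.rdist p q with hℓdef
  have hℓ : 0 < ℓ := by
    refine lt_of_le_of_ne (hu.conformal.rdist_nonneg p q) fun h => ?_
    have := hu.conformal.eq_of_rdist_eq_zero h.symm
    rw [this, g.rdist_self] at hdist
    linarith
  obtain ⟨w', hw'c, hw'⟩ := hγ.exists_hasDerivWithinAt hℓ hu.smooth_log
  set A : ℝ → ℝ := fun t => (u (γ (projIcc 0 ℓ hℓ.le t)))⁻¹ with hA
  have hAc : Continuous A := by
    have h1 : Continuous fun t => γ (projIcc 0 ℓ hℓ.le t) :=
      (continuousOn_iff_continuous_domRestrict.1 hγ.continuousOn).comp continuous_projIcc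
    exact (hu.smooth.continuous.comp h1).inv₀ fun t => (hu.pos _).ne'
  have hAu : ∀ t ∈ Icc 0 ℓ, A t = (u (γ t))⁻¹ := fun t ht => by
    simp only [hA, projIcc_of_mem hℓ.le ht]
  have hL := hu.rdist_le_integral hℓ hγ hAc hAu
  rw [hγ0, hγℓ] at hL
  obtain ⟨ψ, ψ', h1, h2, h3, h4, h5⟩ := exists_index_form_neg hℓ
    (w := (fun x => Real.log (u x)) ∘ γ) (fun t ht => (hw' t ht).1) hw'c hAc
    (fun t ht => by
      rw [hAu t ht, Function.comp, Real.exp_neg, Real.exp_log (hu.pos _)]) (hdist.trans hL)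
  refine absurd h5 (not_lt.2 (hγ.index_form_nonneg hℓ h1 h2
    (((hAc.continuousOn.pow 2).const_mul _).add ((hw'c.pow 2).const_mul _)) (fun t ht => ?_) h3 h4))
  obtain ⟨-, v, hv, hw'v⟩ := hw' t ht
  have := hu.le_curvature_conformal (γ t) hv
  rw [← hw'v, ← hAu t ht] at this
  exact this

end IsPosSupersolution

end SurfaceMetric

/-! ### Induced metrics and the round sphere -/

namespace SurfaceMetric

open LocalGeom

section Immersion

variable {M : Type*} [TopologicalSpace M] [ChartedSpace Plane M] [IsManifold (𝓡 2) ∞ M]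
variable {E : Type*} [NormedAddCommGroup E] [InnerProductSpace ℝ E]

/-- The differential of a map to a normed space. -/
def dmap (f : M → E) (p : M) : TangentSpace (𝓡 2) p →L[ℝ] E := mfderiv (𝓡 2) 𝓘(ℝ, E) f p

/-- The bilinear form induced by a linear map to an inner product space. -/
def pullInner : (Plane →L[ℝ] E) → (Plane →L[ℝ] Plane →L[ℝ] ℝ) :=
  fun A => (innerSL ℝ : E →L[ℝ] E →L[ℝ] ℝ).bilinearComp A A

lemma pullInner_apply (A : Plane →L[ℝ] E) (v w : Plane) : pullInner A v w = inner ℝ (A v) (A w) :=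
  rfl

lemma contDiff_pullInner [FiniteDimensional ℝ E] : ContDiff ℝ ∞ (pullInner : (Plane →L[ℝ] E) → _) := by
  rw [contDiff_clm_apply_iff]
  intro v
  rw [contDiff_clm_apply_iff]
  intro w
  simp only [pullInner_apply]
  exact (contDiff_id.clm_apply contDiff_const).inner ℝ (contDiff_id.clm_apply contDiff_const)

/-- The bilinear form that an immersion induces on a tangent space. -/
def inducedInner (f : M → E) (p : M) :
    TangentSpace (𝓡 2) p →L[ℝ] TangentSpace (𝓡 2) p →L[ℝ] ℝ := pullInner (dmap f p)

/-- The metric induced by an immersion in a Euclidean space. -/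
def induced [FiniteDimensional ℝ E] (f : M → E) (hf : ContMDiff (𝓡 2) 𝓘(ℝ, E) ∞ f)
    (hinj : ∀ p, ∀ v : TangentSpace (𝓡 2) p, dmap f p v = 0 → v = 0) : SurfaceMetric M where
  inner p := inducedInner f p
  symm p v w := real_inner_comm _ _
  pos p v hv := by
    have : dmap f p v ≠ 0 := fun h => hv (hinj p v h)
    exact real_inner_self_pos.2 this
  isVonNBounded p := isVonNBounded_of_pos (pullInner (dmap f p)) fun v hv =>
    real_inner_self_pos.2 fun h => hv (hinj p v h)
  contMDiff := by
    intro x₀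
    rw [contMDiffAt_hom_bundle]
    refine ⟨contMDiffAt_id, ?_⟩
    -- In a trivialization the differential of `f` is a smooth family of linear maps from the plane,
    -- and `pullInner` depends on the linear map quadratically.
    have h1 := (hf x₀).mfderiv_const (m := ∞) (by simp)
    have h2 := (contDiff_pullInner (E := E)).contMDiff.contMDiffAt.comp x₀ h1
    refine h2.congr_of_eventuallyEq ?_
    have hb : (trivializationAt Plane (TangentSpace (𝓡 2)) x₀).baseSet ∈ 𝓝 x₀ :=
      (trivializationAt Plane (TangentSpace (𝓡 2)) x₀).open_baseSet.mem_nhds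
        (mem_baseSet_trivializationAt _ _ _)
    filter_upwards [hb] with p hp
    ext v w
    have h3 : ∀ a : Plane, inTangentCoordinates (𝓡 2) 𝓘(ℝ, E) id f (fun p => dmap f p) x₀ p a
        = dmap f p ((trivializationAt Plane (TangentSpace (𝓡 2)) x₀).symm p a) := by
      intro a
      have := TangentBundle.continuousLinearMapAt_model_space (𝕜 := ℝ) (f x₀) (f p)
      change (trivializationAt E (TangentSpace 𝓘(ℝ, E)) (f x₀)).continuousLinearMapAt ℝ (f p)
        (dmap f p ((trivializationAt Plane (TangentSpace (𝓡 2)) x₀).symmL ℝ p a)) = _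
      rw [this]
      exact congrArg (dmap f p) (Trivialization.symmL_apply _ hp _)
    have h4 := inCoordinates_apply_eq₂ (𝕜 := ℝ) (E₁ := fun x : M => TangentSpace (𝓡 2) x) (E₂ := fun x : M => TangentSpace (𝓡 2) x)
      (F₁ := Plane) (F₂ := Plane) (F₃ := ℝ)
      (E₃ := Bundle.Trivial M ℝ) (ϕ := inducedInner f p) (v := v) (w := w) hp hp (Set.mem_univ _)
    have h5 : (trivializationAt ℝ (Trivial M ℝ) x₀).linearMapAt ℝ p = LinearMap.id :=
      Trivial.linearMapAt_trivialization ℝ M ℝ p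
    refine h4.trans ((LinearMap.congr_fun h5 _).trans ?_)
    change inner ℝ (dmap f p _) (dmap f p _) = inner ℝ _ _
    rw [← h3, ← h3]
    rfl

end Immersion

section Sphere

open RealInnerProductSpace

/-- The Euclidean space of dimension three. -/
abbrev Space : Type := EuclideanSpace ℝ (Fin 3)

/-- The parametrization of the tangent plane at `x` by which the chart around `x` is defined. -/
def tangentParam (x : UnitSphere) : Plane →ₗᵢ[ℝ] Space :=
  (ℝ ∙ (((-x : UnitSphere) : Space)))ᗮ.subtypeₗᵢ.comp
    (OrthonormalBasis.fromOrthogonalSpanSingleton 2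
      (ne_zero_of_mem_unit_sphere (-x))).repr.symm.toLinearIsometry

lemma inner_tangentParam (x : UnitSphere) (y : Plane) : ⟪(x : Space), tangentParam x y⟫ = 0 := by
  have h : (tangentParam x y) ∈ (ℝ ∙ (((-x : UnitSphere) : Space)))ᗮ :=
    Subtype.property _
  rw [Submodule.mem_orthogonal_singleton_iff_inner_right] at h
  simpa using h

lemma exists_tangentParam_eq (x : UnitSphere) {w : Space} (hw : ⟪(x : Space), w⟫ = 0) :
    ∃ y, tangentParam x y = w := by
  have h : w ∈ (ℝ ∙ (((-x : UnitSphere) : Space)))ᗮ := by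
    rw [Submodule.mem_orthogonal_singleton_iff_inner_right]
    simpa using hw
  refine ⟨(OrthonormalBasis.fromOrthogonalSpanSingleton 2
      (ne_zero_of_mem_unit_sphere (-x))).repr ⟨w, h⟩, ?_⟩
  exact congrArg Subtype.val (LinearIsometryEquiv.symm_apply_apply _ _)

/-- Stereographic projection is from `-x`. In this form an affine map is multiplied by the single
scalar `(‖y‖² + 4)⁻¹`, which is easy to differentiate. -/
lemma coe_symm_eq (x : UnitSphere) (y : Plane) :
    (((extChartAt (𝓡 2) x).symm y : UnitSphere) : Space)
      = -(x : Space) + (‖y‖ ^ 2 + 4)⁻¹ • ((4 : ℝ) • tangentParam x y + (8 : ℝ) • (x : Space)) := by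
  have h : (((extChartAt (𝓡 2) x).symm y : UnitSphere) : Space)
      = (‖tangentParam x y‖ ^ 2 + 4)⁻¹ • (4 : ℝ) • tangentParam x y +
        (‖tangentParam x y‖ ^ 2 + 4)⁻¹ • (‖tangentParam x y‖ ^ 2 - 4) •
          ((-x : UnitSphere) : Space) :=
    stereographic'_symm_apply (-x) y
  rw [h, LinearIsometry.norm_map]
  have : ‖y‖ ^ 2 + 4 ≠ 0 := by positivity
  rw [coe_neg_sphere]
  match_scalars <;> field_simp <;> ring

lemma target_sphere (x : UnitSphere) : (extChartAt (𝓡 2) x).target = univ := by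
  have : (extChartAt (𝓡 2) x) = (stereographic' 2 (-x)).extend (𝓡 2) := rfl
  rw [this]
  simp [OpenPartialHomeomorph.extend]

lemma symm_zero_sphere (x : UnitSphere) : (extChartAt (𝓡 2) x).symm 0 = x := by
  ext1
  rw [coe_symm_eq, map_zero]
  simp only [norm_zero, smul_zero, zero_add]
  module

lemma extChartAt_self_sphere (x : UnitSphere) : extChartAt (𝓡 2) x x = 0 := by
  have h := (extChartAt (𝓡 2) x).right_inv (x := 0) (by rw [target_sphere]; trivial)
  rwa [symm_zero_sphere] at h

lemma hasFDerivAt_coe_symm (x : UnitSphere) (y : Plane) :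
    HasFDerivAt (fun y => (((extChartAt (𝓡 2) x).symm y : UnitSphere) : Space))
      (dmap (Subtype.val : UnitSphere → Space) ((extChartAt (𝓡 2) x).symm y) ∘L dsymm x y) y := by
  have h := ((contMDiff_coe_sphere (E := Space) (n := 2) (m := ∞) ((extChartAt (𝓡 2) x).symm y)).mdifferentiableAt
    (by simp)).hasMFDerivAt
  exact (h.comp y (hasMFDerivAt_symm (by rw [target_sphere]; trivial))).hasFDerivAt

lemma dmap_coe_dsymm (x : UnitSphere) (y a : Plane) :
    dmap (Subtype.val : UnitSphere → Space) ((extChartAt (𝓡 2) x).symm y) (dsymm x y a)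
      = (‖y‖ ^ 2 + 4)⁻¹ • ((4 : ℝ) • tangentParam x a) - ((‖y‖ ^ 2 + 4)⁻¹ ^ 2 * (2 * ⟪y, a⟫)) •
        ((4 : ℝ) • tangentParam x y + (8 : ℝ) • (x : Space)) := by
  have h1 := hasFDerivAt_coe_symm x y
  simp only [coe_symm_eq] at h1
  have h2 : HasFDerivAt (fun y : Plane => (‖y‖ ^ 2 + 4)⁻¹) (-((‖y‖ ^ 2 + 4) ^ 2)⁻¹ • (2 • innerSL ℝ y)) y :=
    (hasDerivAt_inv (by positivity)).comp_hasFDerivAt y (((hasStrictFDerivAt_norm_sq y).hasFDerivAt).add_const 4)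
  have h3 : HasFDerivAt (fun y : Plane => (4 : ℝ) • tangentParam x y + (8 : ℝ) • (x : Space))
      ((4 : ℝ) • (tangentParam x).toContinuousLinearMap) y :=
    (((tangentParam x).toContinuousLinearMap.hasFDerivAt).const_smul (4 : ℝ)).add_const _
  have h4 := (h2.smul h3).const_add (-(x : Space))
  have h5 := DFunLike.congr_fun (h1.unique h4) a
  refine h5.trans ?_
  simp
  module

/-- Conformality of stereographic projection. The factor equals `1` at the origin, so at the centre
of a chart round and flat lengths agree. -/
lemma inner_dmap_coe_dsymm (x : UnitSphere) (y a b : Plane) :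
    ⟪dmap (Subtype.val : UnitSphere → Space) ((extChartAt (𝓡 2) x).symm y) (dsymm x y a),
     dmap (Subtype.val : UnitSphere → Space) ((extChartAt (𝓡 2) x).symm y) (dsymm x y b)⟫
      = (4 / (‖y‖ ^ 2 + 4)) ^ 2 * ⟪a, b⟫ := by
  have hx : ⟪(x : Space), (x : Space)⟫ = 1 := by simp
  have h2 : ∀ a, ⟪tangentParam x a, (x : Space)⟫ = 0 := fun a => by
    rw [real_inner_comm, inner_tangentParam]
  rw [dmap_coe_dsymm, dmap_coe_dsymm]
  simp only [inner_sub_left, inner_sub_right, inner_smul_left, inner_smul_right, inner_add_left,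
    inner_add_right, LinearIsometry.inner_map_map, inner_tangentParam, h2, hx]
  have hN : ‖y‖ ^ 2 + 4 ≠ 0 := by positivity
  rw [real_inner_self_eq_norm_sq, real_inner_comm y a]
  simp
  field_simp
  ring

lemma dmap_coe_injective (p : UnitSphere) (v : TangentSpace (𝓡 2) p)
    (hv : dmap (Subtype.val : UnitSphere → Space) p v = 0) : v = 0 := by
  have key : ∀ (q : UnitSphere) (y a : Plane), (extChartAt (𝓡 2) p).symm y = q →
      dmap (Subtype.val : UnitSphere → Space) ((extChartAt (𝓡 2) p).symm y) (dsymm p y a) = 0 →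
      a = 0 := by
    intro q y a _ h
    have h1 := inner_dmap_coe_dsymm p y a a
    rw [h, inner_zero_left] at h1
    have h2 : (4 / (‖y‖ ^ 2 + 4)) ^ 2 ≠ 0 := by positivity
    exact inner_self_eq_zero.1 ((mul_eq_zero.1 h1.symm).resolve_left h2)
  have h1 := dsymm_mfderiv (mem_extChartAt_source (I := 𝓡 2) p) v
  set a := mfderiv (𝓡 2) 𝓘(ℝ, Plane) (extChartAt (𝓡 2) p) p v
  have hq := extChartAt_to_inv (I := 𝓡 2) p
  have h2 : ∀ q : UnitSphere, q = p → ∀ w : Plane, w = v →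
      dmap (Subtype.val : UnitSphere → Space) q w = 0 := by
    rintro q rfl w rfl
    exact hv
  have h3 := key p _ a hq (h2 _ hq _ h1)
  rw [← h1, h3]
  exact map_zero _

/-- The round metric of the unit sphere. -/
def round : SurfaceMetric UnitSphere :=
  induced (Subtype.val : UnitSphere → Space) contMDiff_coe_sphere dmap_coe_injective

lemma round_inner_dsymm (x : UnitSphere) (y a b : Plane) :
    round.inner ((extChartAt (𝓡 2) x).symm y) (dsymm x y a) (dsymm x y b)
      = (4 / (‖y‖ ^ 2 + 4)) ^ 2 * ⟪a, b⟫ :=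
  inner_dmap_coe_dsymm x y a b

lemma coeff_round (x : UnitSphere) :
    round.coeff x = conf (fun y => 4 / (‖y‖ ^ 2 + 4)) (fun _ => 1) := by
  ext y i j
  refine (round_inner_dsymm x y (bv i) (bv j)).trans ?_
  simp only [conf, Matrix.smul_apply, smul_eq_mul, Matrix.one_apply]
  fin_cases i <;> fin_cases j <;> simp [bv, EuclideanSpace.inner_single_left]

end Sphere

end SurfaceMetric

/-! ### Conformally flat metrics and the height function in a stereographic chart -/

namespace LocalGeom

open RealInnerProductSpace

section Flat

variable {w f : Plane → ℝ} {y : Plane}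

lemma pd_eq_of_hasFDerivAt {L : Plane →L[ℝ] ℝ} (h : HasFDerivAt f L y) (i : Fin 2) :
    pd i f y = L (bv i) := by
  rw [pd, h.fderiv]; rfl

lemma bil_one_self (v : Plane) : bil (fun _ => 1) y v v = ‖v‖ ^ 2 := by
  rw [bil_apply, EuclideanSpace.norm_sq_eq]
  simp [Fin.sum_univ_two]; ring

lemma isMetricOn_one : IsMetricOn (fun _ => 1) univ where
  isOpen := isOpen_univ
  smooth i j := contDiffOn_const
  symm y _ := by simp
  pos y _ v hv := by
    rw [bil_one_self]
    exact pow_pos (norm_pos_iff.2 hv) 2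

lemma christoffel_one (k i j : Fin 2) : christoffel (fun _ => 1) k i j y = 0 := by
  simp [christoffel, pd]

lemma conn_one : conn (fun _ => 1) y = 0 := by
  simp only [conn, christoffel_one]
  refine Finset.sum_eq_zero fun k _ => Finset.sum_eq_zero fun i _ => Finset.sum_eq_zero fun j _ => ?_
  ext; simp

lemma curvature_one : curvature (fun _ => 1) y = 0 := by
  have h : ∀ k i j, christoffel (fun _ => 1) k i j = 0 := fun k i j =>
    funext fun y => christoffel_one k i j
  have h0 : ∀ i, pd i 0 y = 0 := fun i => by simp [pd]
  simp [curvature, riemann, h, h0]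

lemma laplacian_one : laplacian (fun _ => 1) f y = pd 0 (pd 0 f) y + pd 1 (pd 1 f) y := by
  simp [laplacian, Fin.sum_univ_two, christoffel_one]

lemma gradSq_one : gradSq (fun _ => 1) f y = pd 0 f y ^ 2 + pd 1 f y ^ 2 := by
  simp [gradSq, Fin.sum_univ_two]; ring

lemma inv_conf_one (i j : Fin 2) :
    (conf w (fun _ => 1) y)⁻¹ i j = (w y ^ 2)⁻¹ * (1 : Matrix (Fin 2) (Fin 2) ℝ) i j := by
  have h : (conf w (fun _ => 1) y)⁻¹ = (w y ^ 2)⁻¹ • 1 := by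
    -- At a zero of `w` both inverses are zero by convention.
    by_cases hw : w y = 0
    · simp [conf, hw]
    · exact Matrix.inv_eq_right_inv (by simp [conf, hw])
  rw [h, Matrix.smul_apply, smul_eq_mul]

lemma gradSq_conf_one : gradSq (conf w (fun _ => 1)) f y
    = (w y ^ 2)⁻¹ * gradSq (fun _ => 1) f y := by
  simp only [gradSq, inv_conf_one, Fin.sum_univ_two]
  simp; ring

variable (hw : ContDiff ℝ ∞ w) (hpos : ∀ y, 0 < w y)
include hw hpos

lemma christoffel_conf_one (k i j : Fin 2) : christoffel (conf w (fun _ => 1)) k i j y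
    = pd i (fun z => Real.log (w z)) y * (1 : Matrix (Fin 2) (Fin 2) ℝ) j k
      + pd j (fun z => Real.log (w z)) y * (1 : Matrix (Fin 2) (Fin 2) ℝ) i k
      - (1 : Matrix (Fin 2) (Fin 2) ℝ) i j * pd k (fun z => Real.log (w z)) y := by
  have h := congrArg (fun v : Plane => v k) (isMetricOn_one.conn_conf (u := w) hw.contDiffOn (fun y _ => hpos y)
    (mem_univ y) (bv i) (bv j))
  have h1 : conn (conf w (fun _ => 1)) y (bv i) (bv j) k
      = christoffel (conf w (fun _ => 1)) k i j y := by
    rw [conn_apply]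
    fin_cases i <;> fin_cases j <;> simp
  simp only [h1] at h
  rw [h, bil_bv, conn_one]
  fin_cases k <;> fin_cases i <;> fin_cases j <;> simp [raise, pd, bv]

/-- Conformal invariance of the Laplacian in dimension two: the Christoffel terms cancel in the
trace. -/
lemma laplacian_conf_one : laplacian (conf w (fun _ => 1)) f y
    = (w y ^ 2)⁻¹ * laplacian (fun _ => 1) f y := by
  rw [laplacian_one]
  simp only [laplacian, inv_conf_one, christoffel_conf_one hw hpos, Fin.sum_univ_two]
  simp; ring

lemma curvature_conf_one : curvature (conf w (fun _ => 1)) y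
    = -((w y ^ 2)⁻¹ * laplacian (fun _ => 1) (fun z => Real.log (w z)) y) := by
  have h := isMetricOn_one.curvature_conf (u := w) hw.contDiffOn (fun y _ => hpos y) (mem_univ y)
  rw [curvature_one] at h
  rw [zero_sub] at h
  rw [← mul_neg, ← h, mul_comm, mul_inv_cancel_right₀ (pow_pos (hpos y) 2).ne']

end Flat

section Height

/-- The height function of the unit sphere in the stereographic chart around a point of height `c`
at which the gradient of the height is `p`. -/
def height (c : ℝ) (p y : Plane) : ℝ := -c + (‖y‖ ^ 2 + 4)⁻¹ * (4 * ⟪p, y⟫ + 8 * c)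

variable {c : ℝ} {p : Plane}

lemma height_zero : height c p 0 = c := by
  simp [height]; ring

lemma hasFDerivAt_inv_norm_sq (y : Plane) : HasFDerivAt (fun y : Plane => (‖y‖ ^ 2 + 4)⁻¹)
    (-((‖y‖ ^ 2 + 4) ^ 2)⁻¹ • (2 • innerSL ℝ y)) y :=
  (hasDerivAt_inv (by positivity)).comp_hasFDerivAt y
    (((hasStrictFDerivAt_norm_sq y).hasFDerivAt).add_const 4)

lemma hasFDerivAt_height (y : Plane) : HasFDerivAt (height c p)
    ((‖y‖ ^ 2 + 4)⁻¹ • ((4 : ℝ) • innerSL ℝ p)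
      + (4 * ⟪p, y⟫ + 8 * c) • (-((‖y‖ ^ 2 + 4) ^ 2)⁻¹ • (2 • innerSL ℝ y))) y := by
  have h1 : HasFDerivAt (fun y : Plane => 4 * ⟪p, y⟫ + 8 * c) ((4 : ℝ) • innerSL ℝ p) y :=
    (((innerSL ℝ p).hasFDerivAt).const_mul 4).add_const _
  exact ((hasFDerivAt_inv_norm_sq y).mul h1).const_add (-c)

lemma pd_height (i : Fin 2) : pd i (height c p) = fun y =>
    (‖y‖ ^ 2 + 4)⁻¹ * (4 * p i) - (4 * ⟪p, y⟫ + 8 * c) * ((‖y‖ ^ 2 + 4)⁻¹ ^ 2 * (2 * y i)) := by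
  funext y
  rw [pd, (hasFDerivAt_height y).fderiv]
  simp [EuclideanSpace.inner_single_right]
  ring

/-- The height is a first spherical harmonic, whose Hessian is minus the height times the round
metric; at the origin the Christoffel symbols of the round metric vanish. -/
lemma pd_pd_height (i : Fin 2) : pd i (pd i (height c p)) 0 = -c := by
  have h0 := hasFDerivAt_inv_norm_sq 0
  have h1 : HasFDerivAt (fun y : Plane => 4 * ⟪p, y⟫ + 8 * c) ((4 : ℝ) • innerSL ℝ p) 0 :=
    (((innerSL ℝ p).hasFDerivAt).const_mul 4).add_const _
  have h2 : HasFDerivAt (fun y : Plane => 2 * y i) ((2 : ℝ) • cf i) 0 :=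
    ((cf i).hasFDerivAt).const_mul 2
  have h3 := (h0.mul_const (4 * p i)).sub (h1.mul ((h0.pow 2).mul h2))
  rw [pd_height]
  refine (pd_eq_of_hasFDerivAt h3 i).trans ?_
  simp
  ring

/-- Summed over `i` this says that the round metric has curvature `1`. -/
lemma pd_pd_log_norm_sq (i : Fin 2) :
    pd i (pd i fun y => Real.log (4 / (‖y‖ ^ 2 + 4))) 0 = -1 / 2 := by
  have h1 : pd i (fun y => Real.log (4 / (‖y‖ ^ 2 + 4)))
      = fun y => -((‖y‖ ^ 2 + 4)⁻¹ * (2 * y i)) := by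
    funext y
    have h : HasFDerivAt (fun y : Plane => Real.log (4 * (‖y‖ ^ 2 + 4)⁻¹)) _ y :=
      ((hasFDerivAt_inv_norm_sq y).const_mul 4).log (by positivity)
    simp only [div_eq_mul_inv]
    rw [pd, h.fderiv]
    have : ‖y‖ ^ 2 + 4 ≠ 0 := by positivity
    simp [EuclideanSpace.inner_single_right]
    field_simp
  have h2 : HasFDerivAt (fun y : Plane => 2 * y i) ((2 : ℝ) • cf i) 0 :=
    ((cf i).hasFDerivAt).const_mul 2
  rw [h1]
  refine (pd_eq_of_hasFDerivAt ((hasFDerivAt_inv_norm_sq 0).mul h2).neg i).trans ?_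
  simp
  norm_num

variable {F F₁ F₂ : ℝ → ℝ}

lemma pd_comp_height {y : Plane} (hF : HasDerivAt F (F₁ (height c p y)) (height c p y)) (i : Fin 2) :
    pd i (fun y => F (height c p y)) y = F₁ (height c p y) * pd i (height c p) y := by
  rw [pd_eq_of_hasFDerivAt (hasFDerivAt_height y)]
  exact pd_eq_of_hasFDerivAt (hF.comp_hasFDerivAt y (hasFDerivAt_height y)) i

lemma pd_pd_comp_height (hF : ∀ᶠ t in 𝓝 c, HasDerivAt F (F₁ t) t) (hF₁ : HasDerivAt F₁ (F₂ c) c)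
    (i : Fin 2) :
    pd i (pd i fun y => F (height c p y)) 0 = F₂ c * p i ^ 2 - F₁ c * c := by
  have hc : Tendsto (height c p) (𝓝 0) (𝓝 c) := by
    have := (hasFDerivAt_height (c := c) (p := p) 0).continuousAt.tendsto
    rwa [height_zero] at this
  have he : pd i (fun y => F (height c p y)) =ᶠ[𝓝 0]
      fun y => F₁ (height c p y) * pd i (height c p) y := by
    filter_upwards [hc.eventually hF] with y hy using pd_comp_height hy i
  have h1 : HasFDerivAt (fun y => F₁ (height c p y)) _ 0 :=
    HasDerivAt.comp_hasFDerivAt (h₂ := F₁) (h₂' := F₂ c) 0 (by rwa [height_zero])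
      (hasFDerivAt_height 0)
  have h2 : DifferentiableAt ℝ (pd i (height c p)) 0 := by
    rw [pd_height]
    have h0 := (hasFDerivAt_inv_norm_sq 0).differentiableAt
    have h1 : DifferentiableAt ℝ (fun y : Plane => 4 * ⟪p, y⟫ + 8 * c) 0 :=
      ((((innerSL ℝ p).hasFDerivAt).const_mul 4).add_const _).differentiableAt
    have h2 : DifferentiableAt ℝ (fun y : Plane => 2 * y i) 0 :=
      (((cf i).hasFDerivAt).const_mul 2).differentiableAt
    exact (h0.mul_const _).sub (h1.mul ((h0.pow 2).mul h2))
  have h3 : pd i (fun y => F₁ (height c p y) * pd i (height c p) y) 0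
      = F₁ (height c p 0) * pd i (pd i (height c p)) 0
        + pd i (height c p) 0 * pd i (fun y => F₁ (height c p y)) 0 := by
    rw [pd_eq_of_hasFDerivAt h1]
    exact pd_eq_of_hasFDerivAt (h1.mul h2.hasFDerivAt) i
  have h4 : pd i (fun y => F₁ (height c p y)) 0 = F₂ c * pd i (height c p) 0 := by
    rw [pd_eq_of_hasFDerivAt (hasFDerivAt_height 0)]
    exact pd_eq_of_hasFDerivAt h1 i
  have h5 : pd i (height c p) 0 = p i := by
    rw [pd_height]; simp
  have h6 : pd i (pd i fun y => F (height c p y)) 0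
      = pd i (fun y => F₁ (height c p y) * pd i (height c p) y) 0 := by
    rw [pd, he.fderiv_eq, pd]
  rw [h6, h3, h4, h5, pd_pd_height, height_zero]
  ring

end Height

end LocalGeom

namespace LocalGeom

lemma pd_pd_add {f h : Plane → ℝ} (hf : ContDiff ℝ ∞ f) (hh : ContDiff ℝ ∞ h) (i : Fin 2)
    (y : Plane) :
    pd i (pd i fun y => f y + h y) y = pd i (pd i f) y + pd i (pd i h) y := by
  have hd : ∀ {f : Plane → ℝ}, ContDiff ℝ ∞ f → Differentiable ℝ (pd i f) := fun hf =>
    ((hf.fderiv_right (m := ∞) (by simp)).clm_apply contDiff_const).differentiable (by simp)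
  have h1 : pd i (fun y => f y + h y) = fun y => pd i f y + pd i h y := by
    funext z
    exact pd_eq_of_hasFDerivAt (((hf.differentiable (by simp) z).hasFDerivAt).add
      ((hh.differentiable (by simp) z).hasFDerivAt)) i
  rw [h1]
  exact pd_eq_of_hasFDerivAt ((hd hf y).hasFDerivAt.add (hd hh y).hasFDerivAt) i

end LocalGeom

/-! ### Axially symmetric conformal metrics on the sphere -/

namespace SurfaceMetric

open LocalGeom RealInnerProductSpace

/-- The height of a point of the unit sphere. -/
def zc (x : UnitSphere) : ℝ := (x : Space) 2

lemma zc_mem (x : UnitSphere) : zc x ∈ Icc (-1 : ℝ) 1 := by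
  have h := EuclideanSpace.norm_sq_eq (x : Space)
  rw [norm_eq_of_mem_sphere x, Fin.sum_univ_three] at h
  simp only [Real.norm_eq_abs, sq_abs] at h
  refine abs_le.1 ((sq_le_one_iff_abs_le_one _).1 ?_)
  change (x : Space) 2 ^ 2 ≤ 1
  nlinarith [sq_nonneg ((x : Space) 0), sq_nonneg ((x : Space) 1)]

lemma contMDiff_zc : ContMDiff (𝓡 2) 𝓘(ℝ, ℝ) ∞ zc := by
  have h : ContDiff ℝ ∞ fun v : Space => v 2 := by fun_prop
  exact h.contMDiff.comp contMDiff_coe_sphere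

/-- The vector `p` represents the tangential part of the axis at `x`, whose squared length is `1 -
z²`. -/
lemma exists_zc_symm_eq (x : UnitSphere) : ∃ p : Plane, ‖p‖ ^ 2 = 1 - zc x ^ 2 ∧
    ∀ y, zc ((extChartAt (𝓡 2) x).symm y) = height (zc x) p y := by
  set e : Space := EuclideanSpace.single 2 1 with he
  have hx : ⟪(x : Space), (x : Space)⟫ = 1 := by simp
  have hxe : ⟪(x : Space), e⟫ = zc x := by
    rw [he, EuclideanSpace.inner_single_right]; simp [zc]
  have hex : ⟪e, (x : Space)⟫ = zc x := by rw [real_inner_comm, hxe]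
  have hee : ⟪e, e⟫ = 1 := by simp [he]
  obtain ⟨p, hp⟩ := exists_tangentParam_eq x (w := e - zc x • (x : Space))
    (by rw [inner_sub_right, inner_smul_right, hxe, hx]; ring)
  refine ⟨p, ?_, fun y => ?_⟩
  · rw [← (tangentParam x).norm_map p, ← real_inner_self_eq_norm_sq, hp]
    simp only [inner_sub_left, inner_sub_right, real_inner_smul_left, real_inner_smul_right, hx, hxe,
      hex, hee]
    ring
  · have h1 : ⟪p, y⟫ = tangentParam x y 2 := by
      rw [← (tangentParam x).inner_map_map p y, hp, inner_sub_left, real_inner_smul_left,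
        inner_tangentParam, he, EuclideanSpace.inner_single_left]
      simp
    rw [zc, coe_symm_eq, height, h1]
    simp [zc]
    ring

variable {V : Set ℝ} {R R₁ R₂ F F₁ F₂ : ℝ → ℝ}

lemma contMDiff_comp_zc (hV : IsOpen V) (hV' : Icc (-1) 1 ⊆ V) (hF : ContDiffOn ℝ ∞ F V) :
    ContMDiff (𝓡 2) 𝓘(ℝ, ℝ) ∞ fun x => F (zc x) := fun x =>
  (hF.contDiffAt (hV.mem_nhds (hV' (zc_mem x)))).contMDiffAt.comp x (contMDiff_zc x)

/-- The metric `e^(2R) g₀` on the unit sphere, where `g₀` is the round metric and `R` a function of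
the height. -/
def axial (R : ℝ → ℝ) (hR : ContMDiff (𝓡 2) 𝓘(ℝ, ℝ) ∞ fun x => R (zc x)) : SurfaceMetric UnitSphere :=
  round.scale ((fun x => Real.exp (R (zc x))) ^ 2)
    (((Real.contDiff_exp.contMDiff).comp hR).pow 2) (fun _ => pow_pos (Real.exp_pos _) 2)

variable (hR : ContMDiff (𝓡 2) 𝓘(ℝ, ℝ) ∞ fun x => R (zc x))

lemma coeff_axial (x : UnitSphere) : (axial R hR).coeff x
    = conf (fun y => Real.exp (R (zc ((extChartAt (𝓡 2) x).symm y))) * (4 / (‖y‖ ^ 2 + 4)))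
      (fun _ => 1) := by
  have h : (axial R hR).coeff x = conf _ (round.coeff x) := coeff_scale_sq _ _ _ x
  rw [h, coeff_round]
  funext y
  simp only [conf, smul_smul, mul_pow]
  rfl

lemma contDiff_comp_zc_symm (hF : ContMDiff (𝓡 2) 𝓘(ℝ, ℝ) ∞ fun x => F (zc x)) (x : UnitSphere) :
    ContDiff ℝ ∞ fun y => F (zc ((extChartAt (𝓡 2) x).symm y)) := by
  have h := contDiffOn_comp_symm hF x
  rw [target_sphere] at h
  exact contDiffOn_univ.1 h

lemma contDiff_norm_sq_factor : ContDiff ℝ ∞ fun y : Plane => 4 / (‖y‖ ^ 2 + 4) :=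
  contDiff_const.div ((contDiff_norm_sq ℝ).add contDiff_const) fun y => by positivity

lemma axial_factor_pos (x : UnitSphere) (y : Plane) :
    0 < Real.exp (R (zc ((extChartAt (𝓡 2) x).symm y))) * (4 / (‖y‖ ^ 2 + 4)) := by positivity

include hR in
lemma contDiff_axial_factor (x : UnitSphere) : ContDiff ℝ ∞ fun y =>
    Real.exp (R (zc ((extChartAt (𝓡 2) x).symm y))) * (4 / (‖y‖ ^ 2 + 4)) :=
  (Real.contDiff_exp.comp (contDiff_comp_zc_symm hR x)).mul contDiff_norm_sq_factor

/-- The origin suffices, because invariants at `x` are evaluated in the chart centred at `x`. There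
the flat Laplacian is the round one, which is the Legendre operator on functions of the height. -/
lemma laplacian_one_comp_zc (hF : ∀ t ∈ V, HasDerivAt F (F₁ t) t) (hF₁ : ∀ t ∈ V, HasDerivAt F₁ (F₂ t) t)
    (hV : IsOpen V) (hV' : Icc (-1) 1 ⊆ V) (x : UnitSphere) :
    LocalGeom.laplacian (fun _ => 1) (fun y => F (zc ((extChartAt (𝓡 2) x).symm y))) 0
      = (1 - zc x ^ 2) * F₂ (zc x) - 2 * zc x * F₁ (zc x) := by
  obtain ⟨p, hp, hz⟩ := exists_zc_symm_eq x
  have hc := hV' (zc_mem x)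
  simp only [hz]
  rw [laplacian_one, pd_pd_comp_height (Filter.eventually_of_mem (hV.mem_nhds hc) hF) (hF₁ _ hc),
    pd_pd_comp_height (Filter.eventually_of_mem (hV.mem_nhds hc) hF) (hF₁ _ hc), ← hp,
    EuclideanSpace.norm_sq_eq, Fin.sum_univ_two]
  simp only [Real.norm_eq_abs, sq_abs]
  ring

lemma gradSq_one_comp_zc (hF : ∀ t ∈ V, HasDerivAt F (F₁ t) t) (hV' : Icc (-1) 1 ⊆ V) (x : UnitSphere) :
    LocalGeom.gradSq (fun _ => 1) (fun y => F (zc ((extChartAt (𝓡 2) x).symm y))) 0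
      = (1 - zc x ^ 2) * F₁ (zc x) ^ 2 := by
  obtain ⟨p, hp, hz⟩ := exists_zc_symm_eq x
  have hc := hF _ (hV' (zc_mem x))
  simp only [hz]
  have h : ∀ i, pd i (fun y => F (height (zc x) p y)) 0 = F₁ (zc x) * p i := by
    intro i
    rw [pd_comp_height (F₁ := F₁) (by rwa [height_zero]), pd_height, height_zero]
    simp
  rw [gradSq_one, h, h, ← hp, EuclideanSpace.norm_sq_eq, Fin.sum_univ_two]
  simp only [Real.norm_eq_abs, sq_abs]
  ring

/-- The flat conformal factor is a product, so its logarithm splits into `R` and the round part; the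
latter contributes the curvature `1`. -/
lemma curvature_axial (hV : IsOpen V) (hV' : Icc (-1) 1 ⊆ V) (hR₁ : ∀ t ∈ V, HasDerivAt R (R₁ t) t)
    (hR₂ : ∀ t ∈ V, HasDerivAt R₁ (R₂ t) t) (x : UnitSphere) :
    (axial R hR).curvature x * Real.exp (R (zc x)) ^ 2
      = 1 - ((1 - zc x ^ 2) * R₂ (zc x) - 2 * zc x * R₁ (zc x)) := by
  have hlog : ∀ y : Plane, Real.log (Real.exp (R (zc ((extChartAt (𝓡 2) x).symm y))) * (4 / (‖y‖ ^ 2 + 4)))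
      = R (zc ((extChartAt (𝓡 2) x).symm y)) + Real.log (4 / (‖y‖ ^ 2 + 4)) := fun y => by
    rw [Real.log_mul (Real.exp_pos _).ne' (by positivity), Real.log_exp]
  have h := laplacian_one_comp_zc hR₁ hR₂ hV hV' x
  have hs := contDiff_norm_sq_factor.log fun y => by positivity
  rw [laplacian_one] at h
  rw [SurfaceMetric.curvature, coeff_axial, extChartAt_self_sphere,
    curvature_conf_one (contDiff_axial_factor hR x) (axial_factor_pos x), laplacian_one]
  simp only [hlog]
  rw [pd_pd_add (contDiff_comp_zc_symm hR x) hs, pd_pd_add (contDiff_comp_zc_symm hR x) hs,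
    pd_pd_log_norm_sq, pd_pd_log_norm_sq, symm_zero_sphere]
  have he := (Real.exp_pos (R (zc x))).ne'
  simp only [norm_zero]
  field_simp
  linarith

lemma cancel_factor {a : ℝ} (ha : a ≠ 0) (b : ℝ) :
    ((a * (4 / (‖(0 : Plane)‖ ^ 2 + 4))) ^ 2)⁻¹ * b * a ^ 2 = b := by
  simp only [norm_zero]
  field_simp
  norm_num

lemma laplacian_axial (hV : IsOpen V) (hV' : Icc (-1) 1 ⊆ V) (hF₁ : ∀ t ∈ V, HasDerivAt F (F₁ t) t)
    (hF₂ : ∀ t ∈ V, HasDerivAt F₁ (F₂ t) t) (x : UnitSphere) :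
    (axial R hR).laplacian (fun x => F (zc x)) x * Real.exp (R (zc x)) ^ 2
      = (1 - zc x ^ 2) * F₂ (zc x) - 2 * zc x * F₁ (zc x) := by
  rw [← laplacian_one_comp_zc hF₁ hF₂ hV hV' x, SurfaceMetric.laplacian, coeff_axial,
    extChartAt_self_sphere, laplacian_conf_one (contDiff_axial_factor hR x) (axial_factor_pos x),
    symm_zero_sphere]
  exact cancel_factor (Real.exp_pos (R (zc x))).ne' _

lemma gradSq_axial (hV' : Icc (-1) 1 ⊆ V) (hF₁ : ∀ t ∈ V, HasDerivAt F (F₁ t) t) (x : UnitSphere) :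
    (axial R hR).gradSq (fun x => F (zc x)) x * Real.exp (R (zc x)) ^ 2
      = (1 - zc x ^ 2) * F₁ (zc x) ^ 2 := by
  rw [← gradSq_one_comp_zc hF₁ hV' x, SurfaceMetric.gradSq, coeff_axial,
    extChartAt_self_sphere, gradSq_conf_one, symm_zero_sphere]
  exact cancel_factor (Real.exp_pos (R (zc x))).ne' _

/-- For `u = e^F` the inequality is `ΔF + |∇F|²/2 ≤ K - 1/2`. Multiplication by `e^(2R)` makes it
the ordinary differential inequality `hle` in the height. -/
theorem isPosSupersolution_axial (hV : IsOpen V) (hV' : Icc (-1) 1 ⊆ V)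
    (hR₁ : ∀ t ∈ V, HasDerivAt R (R₁ t) t) (hR₂ : ∀ t ∈ V, HasDerivAt R₁ (R₂ t) t)
    (hF : ContDiffOn ℝ ∞ F V)
    (hF₁ : ∀ t ∈ V, HasDerivAt F (F₁ t) t) (hF₂ : ∀ t ∈ V, HasDerivAt F₁ (F₂ t) t)
    (hle : ∀ t ∈ Icc (-1 : ℝ) 1, (1 - t ^ 2) * F₂ t - 2 * t * F₁ t + 1 / 2 * ((1 - t ^ 2) * F₁ t ^ 2)
      ≤ 1 - ((1 - t ^ 2) * R₂ t - 2 * t * R₁ t) - 1 / 2 * Real.exp (R t) ^ 2) :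
    (axial R hR).IsPosSupersolution fun x => Real.exp (F (zc x)) where
  smooth := Real.contDiff_exp.contMDiff.comp (contMDiff_comp_zc hV hV' hF)
  pos x := Real.exp_pos _
  ineq x := by
    have hm := (axial R hR).isMetricOn_coeff x
    have hu := contDiffOn_comp_symm (Real.contDiff_exp.contMDiff.comp (contMDiff_comp_zc hV hV' hF)) x
    have hy : extChartAt (𝓡 2) x x ∈ (extChartAt (𝓡 2) x).target := mem_extChartAt_target x
    have hpos : ∀ y ∈ (extChartAt (𝓡 2) x).target,
      0 < ((Real.exp ∘ fun x => F (zc x)) ∘ (extChartAt (𝓡 2) x).symm) y := fun y _ => Real.exp_pos _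
    have h1 := hm.laplacian_log hu hpos hy
    have h2 := hm.gradSq_log hu hpos hy
    have hlog : (fun z => Real.log (((Real.exp ∘ fun x => F (zc x)) ∘ (extChartAt (𝓡 2) x).symm) z))
        = (fun x => F (zc x)) ∘ (extChartAt (𝓡 2) x).symm := by
      funext z; simp
    rw [hlog] at h1 h2
    have h3 := curvature_axial hR hV hV' hR₁ hR₂ x
    have h4 := laplacian_axial hR hV hV' hF₁ hF₂ x
    have h5 := gradSq_axial hR hV' hF₁ x
    have h6 := hle _ (zc_mem x)
    have hx : ((Real.exp ∘ fun x => F (zc x)) ∘ (extChartAt (𝓡 2) x).symm) (extChartAt (𝓡 2) x x)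
        = Real.exp (F (zc x)) := by
      simp
    rw [hx] at h1 h2
    have h1' : (axial R hR).laplacian (fun x => F (zc x)) x
      = (axial R hR).laplacian (fun x => Real.exp (F (zc x))) x / Real.exp (F (zc x))
        - (axial R hR).gradSq (fun x => Real.exp (F (zc x))) x / Real.exp (F (zc x)) ^ 2 := h1
    have h2' : (axial R hR).gradSq (fun x => F (zc x)) x
      = (axial R hR).gradSq (fun x => Real.exp (F (zc x))) x / Real.exp (F (zc x)) ^ 2 := h2
    rw [← h2'] at h1' ⊢
    have he := pow_pos (Real.exp_pos (R (zc x))) 2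
    have h7 : (axial R hR).laplacian (fun x => F (zc x)) x + 1 / 2 * (axial R hR).gradSq (fun x => F (zc x)) x
        ≤ (axial R hR).curvature x - 1 / 2 := by
      refine le_of_mul_le_mul_right ?_ he
      linarith
    linarith

section Diameter

variable {S S₁ : ℝ → ℝ}

lemma dfun_comp_dsymm {f : UnitSphere → ℝ} (hf : ContMDiff (𝓡 2) 𝓘(ℝ, ℝ) ∞ f) (x : UnitSphere)
    (y a : Plane) :
    dfun f ((extChartAt (𝓡 2) x).symm y) (dsymm x y a)
      = fderiv ℝ (fun y => f ((extChartAt (𝓡 2) x).symm y)) y a := by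
  have h : HasFDerivAt (fun y => f ((extChartAt (𝓡 2) x).symm y))
      (dfun f ((extChartAt (𝓡 2) x).symm y) ∘L dsymm x y) y :=
    (((hf _).mdifferentiableAt (by simp)).hasMFDerivAt.comp y
      (hasMFDerivAt_symm (x := x) (by rw [target_sphere]; trivial))).hasFDerivAt
  rw [h.fderiv]
  rfl

lemma abs_dfun_dsymm_le (hV' : Icc (-1) 1 ⊆ V)
    (hS : ContMDiff (𝓡 2) 𝓘(ℝ, ℝ) ∞ fun x => S (zc x)) (hS₁ : ∀ t ∈ V, HasDerivAt S (S₁ t) t)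
    (hle : ∀ t ∈ Icc (-1 : ℝ) 1, (1 - t ^ 2) * S₁ t ^ 2 ≤ Real.exp (R t) ^ 2) (x : UnitSphere)
    (a : Plane) :
    |dfun (fun x => S (zc x)) ((extChartAt (𝓡 2) x).symm 0) (dsymm x 0 a)|
      ≤ (axial R hR).len (dsymm x 0 a) := by
  have h1 : (axial R hR).len (dsymm x 0 a) = Real.exp (R (zc x)) * ‖a‖ := by
    have h : (axial R hR).inner ((extChartAt (𝓡 2) x).symm 0) (dsymm x 0 a) (dsymm x 0 a)
        = (Real.exp (R (zc x)) * ‖a‖) ^ 2 := by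
      refine (congrArg₂ (· * ·) (rfl : _ = Real.exp (R (zc ((extChartAt (𝓡 2) x).symm 0))) ^ 2)
        (round_inner_dsymm x 0 a a)).trans ?_
      rw [symm_zero_sphere, real_inner_self_eq_norm_sq, norm_zero]
      norm_num
      ring
    rw [len, h, Real.sqrt_sq (by positivity)]
  have h2 := gradSq_one_comp_zc hS₁ hV' x
  have h3 := isMetricOn_one.sq_fderiv_le_gradSq (mem_univ (0 : Plane))
    (f := fun y => S (zc ((extChartAt (𝓡 2) x).symm y))) (v := ‖a‖⁻¹ • a)
  rw [dfun_comp_dsymm hS, h1]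
  by_cases ha : a = 0
  · simp [ha]
  have hn : 0 < ‖a‖ := norm_pos_iff.2 ha
  have h4 := h3 (by rw [bil_one_self, norm_smul, norm_inv, norm_norm, inv_mul_cancel₀ hn.ne', one_pow])
  rw [h2] at h4
  have h5 := abs_le_of_sq_le_sq (h4.trans (hle _ (zc_mem x))) (Real.exp_pos _).le
  rw [map_smul, smul_eq_mul, abs_mul, abs_inv, abs_norm, inv_mul_le_iff₀ hn] at h5
  rwa [mul_comm]

/-- By `hle` the function `S(z)` has gradient at most `1`, so every path joining the poles has
length at least the difference of its values there. -/
theorem ofReal_le_diam_axial (hV : IsOpen V) (hV' : Icc (-1) 1 ⊆ V) (hS : ContDiffOn ℝ ∞ S V)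
    (hS₁ : ∀ t ∈ V, HasDerivAt S (S₁ t) t)
    (hle : ∀ t ∈ Icc (-1 : ℝ) 1, (1 - t ^ 2) * S₁ t ^ 2 ≤ Real.exp (R t) ^ 2) :
    ENNReal.ofReal |S 1 - S (-1)| ≤ (axial R hR).diam := by
  have hSm := contMDiff_comp_zc hV hV' hS
  have hd : ∀ p ∈ (univ : Set UnitSphere), ∀ v : TangentSpace (𝓡 2) p,
      |dfun (fun x => S (zc x)) p v| ≤ 1 * (axial R hR).len v := by
    intro p _ v
    rw [one_mul]
    have h1 := dsymm_mfderiv (mem_extChartAt_source (I := 𝓡 2) p) v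
    set a := mfderiv (𝓡 2) 𝓘(ℝ, Plane) (extChartAt (𝓡 2) p) p v
    have h2 : ∀ q : UnitSphere, q = p → ∀ w : Plane, w = v →
        |dfun (fun x => S (zc x)) q w| ≤ (axial R hR).len (x := q) w →
        |dfun (fun x => S (zc x)) p v| ≤ (axial R hR).len v := by
      rintro q rfl w rfl h
      exact h
    have h3 : ∀ y : Plane, y = 0 →
        |dfun (fun x => S (zc x)) ((extChartAt (𝓡 2) p).symm y) (dsymm p y a)|
          ≤ (axial R hR).len (dsymm p y a) := by
      rintro y rfl
      exact abs_dfun_dsymm_le hR hV' hSm hS₁ hle p a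
    exact h2 _ (extChartAt_to_inv (I := 𝓡 2) p) _ h1 (h3 _ (extChartAt_self_sphere p))
  let N : UnitSphere := ⟨EuclideanSpace.single 2 1, by simp⟩
  have hN : zc N = 1 := by simp [zc, N]
  have hN' : zc (-N) = -1 := by simp [zc, N]
  refine le_trans ?_ (le_iSup₂ (f := fun x y => (axial R hR).dist x y) (-N) N)
  refine le_of_forall_gt fun r hr => ?_
  obtain ⟨γ, h0, h1, hγ, hl⟩ := exists_path _ hr
  have h := ofReal_abs_sub_le (axial R hR) isOpen_univ ((hSm.of_le (by simp)).contMDiffOn) zero_le_one hd hγ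
    (fun t _ => mem_univ _)
  rw [h0, h1, hN, hN', ENNReal.ofReal_one, one_mul] at h
  exact h.trans_lt hl

end Diameter

end SurfaceMetric

/-! ### Capped cylinders nearly attaining the bound -/

namespace SurfaceMetric

section Profile

variable {a ε t : ℝ}

/-- The distance from the equator for the metric `ε² / (a² - z²) g₀` along the axis of height, up to
a factor. -/
def profile (a ε t : ℝ) : ℝ := ε / (2 * a) * (Real.log (a + t) - Real.log (a - t))

/-- The heights at which `profile` is smooth and smaller than `π` in absolute value. -/
def profileDomain (a ε : ℝ) : Set ℝ := Ioo (-a) a ∩ profile a ε ⁻¹' Ioo (-Real.pi) Real.pi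

lemma contDiffOn_profile : ContDiffOn ℝ ∞ (profile a ε) (Ioo (-a) a) :=
  contDiffOn_const.mul (((contDiff_const.add contDiff_id).contDiffOn.log
    fun t ht => by have := ht.1; simp only [id]; linarith).sub
    ((contDiff_const.sub contDiff_id).contDiffOn.log
      fun t ht => by have := ht.2; simp only [id]; linarith))

lemma isOpen_profileDomain : IsOpen (profileDomain a ε) :=
  contDiffOn_profile.continuousOn.isOpen_inter_preimage isOpen_Ioo isOpen_Ioo

lemma sq_sub_sq_pos (ht : t ∈ Ioo (-a) a) : 0 < a ^ 2 - t ^ 2 := by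
  have := mul_pos (by linarith [ht.1] : 0 < a + t) (by linarith [ht.2] : 0 < a - t)
  linarith

lemma hasDerivAt_profile (ht : t ∈ Ioo (-a) a) :
    HasDerivAt (profile a ε) (ε / (a ^ 2 - t ^ 2)) t := by
  have h1 : 0 < a + t := by linarith [ht.1]
  have h2 : 0 < a - t := by linarith [ht.2]
  have ha : 0 < a := by linarith
  have h3 := (((hasDerivAt_id t).const_add a).log h1.ne').sub
    (((hasDerivAt_id t).const_sub a).log h2.ne')
  refine (h3.const_mul (ε / (2 * a))).congr_deriv ?_
  have h4 : a ^ 2 - t ^ 2 = (a + t) * (a - t) := by ring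
  rw [h4]
  simp only [id]
  field_simp
  ring

lemma hasDerivAt_inv_sq_sub_sq (ht : t ∈ Ioo (-a) a) :
    HasDerivAt (fun t => (a ^ 2 - t ^ 2)⁻¹) (2 * t / (a ^ 2 - t ^ 2) ^ 2) t := by
  have h := (((hasDerivAt_id t).pow 2).const_sub (a ^ 2)).inv (sq_sub_sq_pos ht).ne'
  refine h.congr_deriv ?_
  simp

lemma cos_half_pos {s : ℝ} (hs : s ∈ Ioo (-Real.pi) Real.pi) : 0 < Real.cos (s / 2) :=
  Real.cos_pos_of_mem_Ioo ⟨by linarith [hs.1], by linarith [hs.2]⟩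

lemma contDiffOn_log_cos_profile :
    ContDiffOn ℝ ∞ (fun t => 2 * Real.log (Real.cos (profile a ε t / 2))) (profileDomain a ε) :=
  contDiffOn_const.mul (ContDiffOn.log (Real.contDiff_cos.comp_contDiffOn
    ((contDiffOn_profile.mono inter_subset_left).div_const 2)) fun _ ht => (cos_half_pos ht.2).ne')

lemma hasDerivAt_log_cos_profile (ht : t ∈ profileDomain a ε) :
    HasDerivAt (fun t => 2 * Real.log (Real.cos (profile a ε t / 2)))
      (-(Real.tan (profile a ε t / 2) * (ε * (a ^ 2 - t ^ 2)⁻¹))) t := by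
  have hc := (cos_half_pos ht.2).ne'
  have h := (((hasDerivAt_profile ht.1).div_const 2).cos.log hc).const_mul 2
  refine h.congr_deriv ?_
  rw [Real.tan_eq_sin_div_cos]
  field_simp

lemma hasDerivAt_tan_profile (ht : t ∈ profileDomain a ε) :
    HasDerivAt (fun t => -(Real.tan (profile a ε t / 2) * (ε * (a ^ 2 - t ^ 2)⁻¹)))
      (-((1 + Real.tan (profile a ε t / 2) ^ 2) * (ε / (a ^ 2 - t ^ 2) / 2)
          * (ε * (a ^ 2 - t ^ 2)⁻¹)
        + Real.tan (profile a ε t / 2) * (ε * (2 * t / (a ^ 2 - t ^ 2) ^ 2)))) t := by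
  have hc := (cos_half_pos ht.2).ne'
  have h1 := (Real.hasDerivAt_tan hc).comp (h := fun t => profile a ε t / 2) t
    ((hasDerivAt_profile ht.1).div_const 2)
  refine ((h1.mul ((hasDerivAt_inv_sq_sub_sq ht.1).const_mul ε)).neg).congr_deriv ?_
  have h2 : 1 + Real.tan (profile a ε t / 2) ^ 2 = 1 / Real.cos (profile a ε t / 2) ^ 2 := by
    rw [← Real.inv_one_add_tan_sq hc, one_div, inv_inv]
  rw [h2]
  rfl

/-- The logarithm of the factor `ε (a² - t²)^(-1/2)`. -/
def logFactor (a ε t : ℝ) : ℝ := Real.log ε - 1 / 2 * Real.log (a ^ 2 - t ^ 2)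

lemma contDiffOn_logFactor : ContDiffOn ℝ ∞ (logFactor a ε) (Ioo (-a) a) :=
  contDiffOn_const.sub (contDiffOn_const.mul
    ((contDiff_const.sub (contDiff_id.pow 2)).contDiffOn.log fun _ ht => (sq_sub_sq_pos ht).ne'))

lemma exp_logFactor_sq (hε : 0 < ε) (ht : t ∈ Ioo (-a) a) :
    Real.exp (logFactor a ε t) ^ 2 = ε ^ 2 / (a ^ 2 - t ^ 2) := by
  have h := sq_sub_sq_pos ht
  have h1 : (2 : ℕ) * logFactor a ε t = Real.log (ε ^ 2 / (a ^ 2 - t ^ 2)) := by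
    rw [Real.log_div (by positivity) h.ne', Real.log_pow, logFactor]
    push_cast
    ring
  rw [← Real.exp_nat_mul, h1, Real.exp_log (by positivity)]

lemma hasDerivAt_logFactor (ht : t ∈ Ioo (-a) a) :
    HasDerivAt (logFactor a ε) (t * (a ^ 2 - t ^ 2)⁻¹) t := by
  have h := ((((hasDerivAt_id t).pow 2).const_sub (a ^ 2)).log (sq_sub_sq_pos ht).ne').const_mul
    (1 / 2 : ℝ)
  refine (h.const_sub (Real.log ε)).congr_deriv ?_
  simp
  ring

lemma hasDerivAt_logFactor_deriv (ht : t ∈ Ioo (-a) a) :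
    HasDerivAt (fun t => t * (a ^ 2 - t ^ 2)⁻¹)
      ((a ^ 2 - t ^ 2)⁻¹ + t * (2 * t / (a ^ 2 - t ^ 2) ^ 2)) t := by
  exact ((hasDerivAt_id t).mul (hasDerivAt_inv_sq_sub_sq ht)).congr_deriv (by simp)

lemma abs_profile_le (ha : 1 < a) (hε : 0 < ε) (ht : t ∈ Icc (-1 : ℝ) 1) :
    |profile a ε t| ≤ profile a ε 1 := by
  have hc : 0 < ε / (2 * a) := by positivity
  have h1 : Real.log (a + t) ≤ Real.log (a + 1) :=
    Real.log_le_log (by linarith [ht.1]) (by linarith [ht.2])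
  have h2 : Real.log (a - t) ≤ Real.log (a + 1) :=
    Real.log_le_log (by linarith [ht.2]) (by linarith [ht.1])
  have h3 : Real.log (a - 1) ≤ Real.log (a + t) :=
    Real.log_le_log (by linarith) (by linarith [ht.1])
  have h4 : Real.log (a - 1) ≤ Real.log (a - t) :=
    Real.log_le_log (by linarith) (by linarith [ht.2])
  rw [profile, profile, abs_mul, abs_of_pos hc]
  exact mul_le_mul_of_nonneg_left (abs_le.2 ⟨by linarith, by linarith⟩) hc.le

lemma exists_profile_eq {B : ℝ} (hB : 0 < B) {δ : ℝ} (hδ : 0 < δ) :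
    ∃ a ε : ℝ, 1 < a ∧ 0 < ε ∧ ε ≤ δ ∧ profile a ε 1 = B := by
  -- The value `a` below is chosen so that `(a + 1)/(a - 1) = e^ℓ`. Then `profile a ε 1 = ε ℓ /
  -- (2a)`, so `ε = 2aB/ℓ`; as `a ≤ 3`, this is at most `6B/ℓ ≤ δ`. The summand `1` keeps `e^ℓ ≥ 2`.
  set ℓ := 1 + 6 * B / δ with hℓ
  have hℓ1 : 1 ≤ ℓ := by rw [hℓ]; linarith [show 0 ≤ 6 * B / δ by positivity]
  have he : 2 ≤ Real.exp ℓ := by linarith [Real.add_one_le_exp ℓ]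
  have hm : 0 < Real.exp ℓ - 1 := by linarith
  set a := (Real.exp ℓ + 1) / (Real.exp ℓ - 1) with ha
  have ha1 : 1 < a := by rw [ha, lt_div_iff₀ hm]; linarith
  have ha3 : a ≤ 3 := by rw [ha, div_le_iff₀ hm]; linarith
  have hlog : Real.log (a + 1) - Real.log (a - 1) = ℓ := by
    rw [← Real.log_div (by linarith) (by linarith)]
    have : (a + 1) / (a - 1) = Real.exp ℓ := by
      rw [ha]
      field_simp
      ring
    rw [this, Real.log_exp]
  refine ⟨a, 2 * a * B / ℓ, ha1, by positivity, ?_, ?_⟩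
  · rw [div_le_iff₀ (by linarith)]
    have h1 : δ * ℓ = δ + 6 * B := by rw [hℓ]; field_simp
    nlinarith
  · rw [profile, hlog]
    field_simp

end Profile

/-- Metrics on the sphere for which the diameter bound is almost attained. -/
theorem exists_le_diam_sphere {B : ℝ} (hB : 0 < B) (hB' : B < Real.pi) :
    ∃ (g : SurfaceMetric UnitSphere) (u : UnitSphere → ℝ), g.IsPosSupersolution u ∧
      ENNReal.ofReal (2 * B) ≤ g.diam := by
  set T₀ := Real.tan (B / 2) with hT₀
  have hT₀0 : 0 < T₀ := Real.tan_pos_of_pos_of_lt_pi_div_two (by linarith) (by linarith)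
  -- The thinness `ε` must beat `T₀`, a bound for `tan (s/2)` on `|s| ≤ B`, which blows up as `B`
  -- tends to `π`.
  obtain ⟨a, ε, ha, hε, hεδ, hprof⟩ := exists_profile_eq hB (δ := 1 / (1 + 2 * T₀)) (by positivity)
  have hε1 : ε * (1 + 2 * T₀) ≤ 1 := (le_div_iff₀ (by positivity)).1 hεδ
  have hIoo : Icc (-1 : ℝ) 1 ⊆ Ioo (-a) a := fun t ht => ⟨by linarith [ht.1], by linarith [ht.2]⟩
  have hS : ∀ t ∈ Icc (-1 : ℝ) 1, |profile a ε t| ≤ B := fun t ht =>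
    hprof ▸ abs_profile_le ha hε ht
  have hV : IsOpen (profileDomain a ε) := isOpen_profileDomain
  have hV' : Icc (-1) 1 ⊆ profileDomain a ε := fun t ht =>
    ⟨hIoo ht, abs_lt.1 ((hS t ht).trans_lt hB')⟩
  have hR := contMDiff_comp_zc hV hV' (contDiffOn_logFactor.mono inter_subset_left :
    ContDiffOn ℝ ∞ (logFactor a ε) (profileDomain a ε))
  refine ⟨axial _ hR, _, isPosSupersolution_axial hR hV hV'
    (fun t ht => hasDerivAt_logFactor ht.1) (fun t ht => hasDerivAt_logFactor_deriv ht.1)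
    contDiffOn_log_cos_profile (fun t ht => hasDerivAt_log_cos_profile ht)
    (fun t ht => hasDerivAt_tan_profile ht) fun t ht => ?_, ?_⟩
  · rw [exp_logFactor_sq hε (hIoo ht)]
    have hq := sq_sub_sq_pos (hIoo ht)
    have hT : |Real.tan (profile a ε t / 2)| ≤ T₀ := by
      have h := abs_le.1 (hS t ht)
      have hm : ∀ {x y : ℝ}, x ∈ Ioo (-(Real.pi / 2)) (Real.pi / 2) →
          y ∈ Ioo (-(Real.pi / 2)) (Real.pi / 2) → x ≤ y → Real.tan x ≤ Real.tan y :=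
        fun hx hy hxy => Real.strictMonoOn_tan.monotoneOn hx hy hxy
      rw [abs_le, hT₀, ← Real.tan_neg]
      exact ⟨hm ⟨by linarith, by linarith⟩ ⟨by linarith, by linarith⟩ (by linarith),
        hm ⟨by linarith, by linarith⟩ ⟨by linarith, by linarith⟩ (by linarith)⟩
    set T := Real.tan (profile a ε t / 2)
    have hTt : t * T ≤ T₀ := by
      have h1 : |t * T| ≤ 1 * T₀ := by
        rw [abs_mul]
        exact mul_le_mul (abs_le.2 ht) hT (abs_nonneg _) zero_le_one
      linarith [le_abs_self (t * T)]
    -- The left side is at most `ε (1 + 2 T₀) ≤ 1 < a²`.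
    have key : 1 / 2 * ε ^ 2 + 2 * ε * (t * T) ≤ a ^ 2 + t ^ 2 := by
      have h1 := mul_le_mul_of_nonneg_left hTt hε.le
      have h2 : ε ≤ 1 := by nlinarith
      nlinarith [sq_nonneg t]
    set q := a ^ 2 - t ^ 2 with hqdef
    have hid : ∀ x y : ℝ, x * q ^ 2 ≤ y * q ^ 2 → x ≤ y := fun x y h =>
      le_of_mul_le_mul_right h (pow_pos hq 2)
    refine hid _ _ ?_
    have e1 : ((1 - t ^ 2) * -((1 + T ^ 2) * (ε / q / 2) * (ε * q⁻¹) + T * (ε * (2 * t / q ^ 2)))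
        - 2 * t * -(T * (ε * q⁻¹)) + 1 / 2 * ((1 - t ^ 2) * (-(T * (ε * q⁻¹))) ^ 2)) * q ^ 2
        = -(1 / 2 * ε ^ 2 * (1 - t ^ 2)) - 2 * T * ε * t * (1 - t ^ 2) + 2 * t * T * ε * q := by
      field_simp
      ring
    have e2 : (1 - ((1 - t ^ 2) * (q⁻¹ + t * (2 * t / q ^ 2)) - 2 * t * (t * q⁻¹))
        - 1 / 2 * (ε ^ 2 / q)) * q ^ 2
        = q ^ 2 - (1 - t ^ 2) * (q + 2 * t ^ 2) + 2 * t ^ 2 * q - 1 / 2 * ε ^ 2 * q := by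
      field_simp
      ring
    rw [e1, e2]
    -- The difference of the two sides is `(a² - 1)` times the difference in `key`; for `a = 1`, the
    -- cylinder, it is zero.
    have h3 := mul_le_mul_of_nonneg_left key (by nlinarith : 0 ≤ a ^ 2 - 1)
    rw [hqdef]
    nlinarith
  · have h := ofReal_le_diam_axial hR hV hV' (contDiffOn_profile.mono inter_subset_left)
      (fun t ht => hasDerivAt_profile (ε := ε) ht.1) fun t ht => ?_
    · have h1 : profile a ε 1 - profile a ε (-1) = 2 * B := by
        rw [← hprof]; simp only [profile, sub_neg_eq_add, ← sub_eq_add_neg]; ring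
      rwa [h1, abs_of_pos (by linarith)] at h
    -- The gradient bound for `profile` amounts to `1 - t² ≤ a² - t²`.
    · rw [exp_logFactor_sq hε (hIoo ht), div_pow, mul_div_assoc', div_le_div_iff₀ (by
        have := sq_sub_sq_pos (hIoo ht); positivity) (sq_sub_sq_pos (hIoo ht))]
      have hq := sq_sub_sq_pos (hIoo ht)
      have : 0 ≤ ε ^ 2 * (a ^ 2 - t ^ 2) * (a ^ 2 - 1) :=
        mul_nonneg (by positivity) (by nlinarith)
      nlinarith

end SurfaceMetric

end

theorem corollary2p6 :
    (∀ (M : Type*) [TopologicalSpace M] [ChartedSpace Plane M] [IsManifold (𝓡 2) ∞ M]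
        [T2Space M] [CompactSpace M] [ConnectedSpace M]
        (g : SurfaceMetric M) (u : M → ℝ), g.IsPosSupersolution u →
        g.diam < ENNReal.ofReal (2 * Real.pi)) ∧
    (∃ (g : ℕ → SurfaceMetric UnitSphere) (u : ℕ → UnitSphere → ℝ),
        (∀ k, (g k).IsPosSupersolution (u k)) ∧
        Tendsto (fun k => (g k).diam) atTop (𝓝 (ENNReal.ofReal (2 * Real.pi)))) := by
  refine ⟨fun M _ _ _ _ _ _ g u hu => hu.diam_lt, ?_⟩
  have hsphere : ConnectedSpace UnitSphere :=
    Subtype.connectedSpace (isConnected_sphere (by simp [← Module.finrank_eq_rank]) 0 zero_le_one)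
  have hB : ∀ k : ℕ, 0 < Real.pi * (1 - 1 / ((k : ℝ) + 2)) ∧
      Real.pi * (1 - 1 / ((k : ℝ) + 2)) < Real.pi := fun k => by
    have h1 : 1 / ((k : ℝ) + 2) < 1 := by rw [div_lt_one (by positivity)]; linarith [k.cast_nonneg (α := ℝ)]
    have h2 : 0 < 1 / ((k : ℝ) + 2) := by positivity
    have hπ := Real.pi_pos
    exact ⟨mul_pos hπ (by linarith), by nlinarith⟩
  choose g u hu hg using fun k => SurfaceMetric.exists_le_diam_sphere (hB k).1 (hB k).2
  refine ⟨g, u, hu, ?_⟩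
  -- The construction bounds the diameters from below by `2π (1 - 1/(k + 2))`, and the first half of
  -- the theorem bounds them from above by `2π`. The shift by `2` keeps the prescribed value
  -- positive at `k = 0`.
  refine tendsto_of_tendsto_of_tendsto_of_le_of_le ?_ tendsto_const_nhds hg
    fun k => (hu k).diam_lt.le
  refine ENNReal.tendsto_ofReal ?_
  have h : Tendsto (fun k : ℕ => 1 / ((k : ℝ) + 2)) atTop (𝓝 0) :=
    tendsto_const_nhds.div_atTop (tendsto_natCast_atTop_atTop.atTop_add tendsto_const_nhds)
  simpa using ((h.const_sub 1).const_mul Real.pi).const_mul 2
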